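/- Setting. Let $x\in\mathbb R^{p}$ ($p\ge 1$) be independent variables, $u$ one unknown function, and let $J^m$ ($m\ge1$) be the space of jets $(x,u^{(m)})$, where $u^{(m)}=(u_\alpha)_{|\alpha|\le m}$ stands for $u$ and its derivatives up to order $m$. Let $\Delta$ be a $C^\infty$ function on an open set $D\subseteq J^m$ and let $X=\xi_i(x)\,\partial_{x_i}+\varphi(x,u)\,\partial_u$ be a $C^\infty$ projectable vector field on an open set of $\mathbb R^p\times\mathbb R$, with prolongation $X^*$ to $J^m$. Put $X_Qu=\xi_i u_{x_i}-\varphi$, $\Delta^{(0)}=\Delta$ and $\Delta^{(j+1)}=X^*(\Delta^{(j)})$. The equation $X_Qu=0$ is always taken together with its differential consequences $D_\alpha(X_Qu)=0$, $|\alpha|\le m-1$; for $\sigma\ge1$ let $S_\sigma$ be the system $$\Delta=\Delta^{(1)}=\dots=\Delta^{(\sigma-1)}=0,\qquad X_Qu=0 .$$ Fix a jet $\theta_0\in D$ over a point $(x_0,u_0)$ of the domain of $X$ with $\xi(x_0)\neq0$. $X$ is a *symmetry* of a system $F=0$ of equations on $J^m$ near $\theta_0$ if in a neighbourhood of $\theta_0$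 all $X^*(F_i)$ vanish where all $F_k$ vanish; it is a symmetry *in the algebraic sense* if $X^*(F_i)=\sum_kG_{ik}F_k$ near $\theta_0$ with $C^\infty$ functions $G_{ik}$. The system has *maximal rank* at $\theta_0$ if either $\theta_0$ does not satisfy it or the differentials $dF_i(\theta_0)$ are linearly independent. *Adapted variables* for $X$ are $C^\infty$ local coordinates $s=s(x)\in\mathbb R$, $z=z(x)\in\mathbb R^{p-1}$ of $\mathbb R^p$ together with a function $v(x,u)$, such that $(s,z,v)$ are $C^\infty$ local coordinates of $\mathbb R^p\times\mathbb R$ and $Xs=1$, $Xz=0$, $Xv=0$. Write $v_s^{(\ell)}=D_\ell v_s$, $|\ell|\le m-1$, for the derivatives of $v$ of order at most $m$ that contain an $s$-derivative. $X$ is a *standard conditional symmetry* (near $\theta_0$, in given adapted variables) if near the jet corresponding to $\theta_0$ $$\Delta=R(s,z,v^{(m)})\,K(z,v^{(m)})+\sum_\ell\Theta_\ell(s,z,v^{(m)})\,v_s^{(\ell)},\tag{1}$$ and a *weak conditional symmetry of order $\sigma$* if there $$\Delta=\sum_{r=1}^{\sigma}R_r(s,z,v^{(m)})\,K_r(z,v^{(m)})+\sum_\ell\Theta_\ell(s,z,v^{(m)})\,v_s^{(\ell)},\tag{2}$$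 where all functions are $C^\infty$, $R,K,R_r,K_r$ do not contain the $v_s^{(\ell)}$, $K$ and $K_r$ do not contain $s$ explicitly, $R$ does not vanish, and the $R_r$ are linearly independent as functions of $s$ in the sense that their Wronskian $\det(\partial_s^{\,j-1}R_r)_{j,r=1}^{\sigma}$ (at fixed $z$ and $v^{(m)}$) does not vanish. Proposition. Adapted variables exist near $(x_0,u_0)$. For any adapted variables around $(x_0,u_0)$: 1. (standard) $X$ is a standard conditional symmetry of $\Delta=0$, i.e. (1) holds near $\theta_0$, if and only if it is a symmetry, in the algebraic sense, of the system $\{\Delta=0,\ X_Qu=0\}$ near $\theta_0$. It is then a symmetry of this system; conversely, if the system has maximal rank at $\theta_0$ and $X$ is a symmetry of it near $\theta_0$, then (1) holds. 2. (weak) For every $\sigma\ge1$, $X$ is a weak conditional symmetry of order $\sigma$, i.e. (2) holds near $\theta_0$, if and only if it is a symmetry, in the algebraic sense, of the system $S_\sigma$ near $\theta_0$. It is then a symmetry of $S_\sigma$; conversely, if $S_\sigma$ has maximal rank at $\theta_0$ and $X$ is a symmetry of it near $\theta_0$, then (2) holds. 3. (reduced equations) Whenever (1), respectively (2), holds on an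 open set $N$ of adapted jets (corresponding to jets in $D$), the single equation $K^{(0)}(z,w^{(m)})=0$, respectively the system of $\sigma$ equations $K_r^{(0)}(z,w^{(m)})=0$, $r=1,\dots,\sigma$, for a function $w$ of the $p-1$ variables $z$, is a reduced system for $\Delta=0$: for $I\subseteq\mathbb R$ open and non-empty, $Z\subseteq\mathbb R^{p-1}$ open and $w\in C^\infty(Z)$ such that the jets of $v(s,z)=w(z)$, $(s,z)\in I\times Z$, lie in $N$, the function $u(x)$ given by $v=w(z)$ is smooth and $X$-invariant ($X_Qu=0$), and it solves $\Delta=0$ if and only if $w$ solves the reduced equation(s) on $Z$. Here $K^{(0)},K^{(0)}_r$ are $K,K_r$ evaluated on the $m$-jet of $w$. Moreover, for an open non-empty interval $I$ and $Z$ open such that $I\times Z$ lies in the range of the coordinates $(s,z)$, every smooth $X$-invariant function $u(x)$ over $I\times Z$ with graph in the domain of the adapted variables is of the form $v=w(z)$ with $w\in C^\infty(Z)$. -/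

import Mathlib

open scoped ContDiff

noncomputable section

/-! ### Jets of scalar functions of `p` real variables -/

/-- Points of `ℝ^p` (only the smooth structure matters). -/
abbrev Vec (p : ℕ) := Fin p → ℝ

/-- Multi-indices of total order at most `m` in `p` variables. -/
abbrev MIdx (p m : ℕ) := {α : Fin p → ℕ // ∑ i, α i ≤ m}

/-- Multi-indices of total order strictly less than `m` in `p` variables. -/
abbrev SIdx (p m : ℕ) := {α : Fin p → ℕ // ∑ i, α i < m}

instance MIdx.instFintype (p m : ℕ) : Fintype (MIdx p m) :=
  Fintype.ofInjective
    (fun α : MIdx p m => fun i : Fin p => (⟨α.1 i, Nat.lt_succ_of_le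
      ((Finset.single_le_sum (f := α.1) (fun _ _ => Nat.zero_le _)
        (Finset.mem_univ i)).trans α.2)⟩ : Fin (m + 1)))
    (fun _ _ h => Subtype.ext (funext fun i => congrArg Fin.val (congrFun h i)))

instance SIdx.instFintype (p m : ℕ) : Fintype (SIdx p m) :=
  Fintype.ofInjective (fun α : SIdx p m => (⟨α.1, α.2.le⟩ : MIdx p m))
    (fun _ _ h => Subtype.ext (congrArg (fun α : MIdx p m => α.1) h))

/-- The jet space `J^m(ℝ^p, ℝ)`: a base point `x` together with one real number `u_α` for each
multi-index `α` of order at most `m`. -/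
abbrev Jet (p m : ℕ) := Vec p × (MIdx p m → ℝ)

/-- The coordinate `u` (order zero) of a jet. -/
def Jet.val {p m : ℕ} (θ : Jet p m) : ℝ := θ.2 ⟨0, by simp⟩

/-- The partial derivative `∂^α f = ∂_1^{α_1} ⋯ ∂_p^{α_p} f`. -/
def pderiv {p : ℕ} (α : Fin p → ℕ) (f : Vec p → ℝ) : Vec p → ℝ :=
  (List.finRange p).foldr
    (fun i g => (fun (h : Vec p → ℝ) (x : Vec p) => fderiv ℝ h x (Pi.single i 1))^[α i] g) f

/-- The `m`-jet `(x, f^{(m)}(x))` of a function at a point. -/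
def jet {p : ℕ} (m : ℕ) (f : Vec p → ℝ) (x : Vec p) : Jet p m :=
  (x, fun α => pderiv α.1 f x)

/-- The polynomial of degree at most `m` whose `m`-jet at the base point of `θ` is `θ`. -/
def taylor {p m : ℕ} (θ : Jet p m) (x : Vec p) : ℝ :=
  ∑ α : MIdx p m, θ.2 α * ∏ i, (x i - θ.1 i) ^ (α.1 i) / ((α.1 i).factorial : ℝ)

/-! ### Projectable vector fields, prolongation, invariant surface condition -/

/-- A smooth projectable vector field `X = ξ_i(x) ∂/∂x_i + φ(x,u) ∂/∂u` on an open set of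
`ℝ^p × ℝ`. -/
structure ProjectableField (p : ℕ) where
  /-- the open set on which the field is given -/
  dom : Set (Vec p × ℝ)
  /-- the components along the independent variables; they do not depend on `u` -/
  ξ : Vec p → Vec p
  /-- the component along the dependent variable -/
  φ : Vec p × ℝ → ℝ
  isOpen_dom : IsOpen dom
  smooth_ξ : ContDiffOn ℝ ∞ ξ (Prod.fst '' dom)
  smooth_φ : ContDiffOn ℝ ∞ φ dom

namespace ProjectableField

variable {p m : ℕ} (X : ProjectableField p)

/-- The expression `X_Q f = ξ_i ∂f/∂x_i - φ(x, f)`, for a function `f`. -/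
def side (f : Vec p → ℝ) (x : Vec p) : ℝ := fderiv ℝ f x (X.ξ x) - X.φ (x, f x)

/-- The differential consequence `D_α (X_Q u)` of the invariant surface condition, as a function
on `J^m`, for `|α| < m`. The total derivative `D_α P` is characterized by
`(D_α P)(jet of f) = ∂^α (P[f])` and involves only derivatives of `f` of order at most `m` here,
so that it can be computed on the polynomial with the given jet. -/
def sideEq (α : SIdx p m) (θ : Jet p m) : ℝ := pderiv α.1 (X.side (taylor θ)) θ.1

/-- The coefficient `φ_α = D_α (φ - ξ_i u_i) + ξ_i u_{α,i}` of `∂/∂u_α` in the prolongation of `X`,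
for `|α| ≤ m`. The derivatives of order `m + 1` cancel in this expression. -/
def coef (α : MIdx p m) (θ : Jet p m) : ℝ :=
  - pderiv α.1 (X.side (taylor θ)) θ.1
    + ∑ i, X.ξ θ.1 i * pderiv (α.1 + Pi.single i 1) (taylor θ) θ.1

/-- The `m`-th prolongation `X^* = ξ_i ∂/∂x_i + ∑_α φ_α ∂/∂u_α`, acting on functions on `J^m`. -/
def prolong (F : Jet p m → ℝ) (θ : Jet p m) : ℝ :=
  fderiv ℝ F θ (X.ξ θ.1, fun α => X.coef α θ)

/-- The system `Δ = X^*Δ = ⋯ = (X^*)^{σ-1} Δ = 0`, `X_Q u = 0`, the last equation being taken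
together with its differential consequences up to the order `m`. -/
def condSystem (Δ : Jet p m → ℝ) (σ : ℕ) : Fin σ ⊕ SIdx p m → Jet p m → ℝ :=
  Sum.elim (fun j => X.prolong^[(j : ℕ)] Δ) (fun α => X.sideEq α)

/-- `X` is a symmetry of the system `F = 0` near `θ₀`: on some neighbourhood of `θ₀`, all
`X^*(F_i)` vanish wherever all `F_i` vanish. -/
def IsSymmetryNear {ι : Type*} (F : ι → Jet p m → ℝ) (θ₀ : Jet p m) : Prop :=
  ∃ N : Set (Jet p m), IsOpen N ∧ θ₀ ∈ N ∧
    ∀ θ ∈ N, (∀ i, F i θ = 0) → ∀ i, X.prolong (F i) θ = 0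

/-- `X` is a symmetry of the system `F = 0` near `θ₀` in the algebraic sense: on some
neighbourhood of `θ₀`, `X^*(F_i) = ∑_k G_{ik} F_k` with smooth functions `G_{ik}`. -/
def IsAlgebraicSymmetryNear {ι : Type*} [Fintype ι] (F : ι → Jet p m → ℝ) (θ₀ : Jet p m) : Prop :=
  ∃ (N : Set (Jet p m)) (G : ι → ι → Jet p m → ℝ), IsOpen N ∧ θ₀ ∈ N ∧
    (∀ i k, ContDiffOn ℝ ∞ (G i k) N) ∧
    ∀ θ ∈ N, ∀ i, X.prolong (F i) θ = ∑ k, G i k θ * F k θ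

end ProjectableField

/-- The maximal rank condition at `θ₀` for the system `F = 0`: if `θ₀` satisfies the system,
then the differentials of the left-hand sides are linearly independent there. -/
def MaximalRankAt {p m : ℕ} {ι : Type*} (F : ι → Jet p m → ℝ) (θ₀ : Jet p m) : Prop :=
  (∀ i, F i θ₀ = 0) → LinearIndependent ℝ (fun i => fderiv ℝ (F i) θ₀)

/-! ### Adapted variables `s = y_0`, `z = (y_1, …, y_n)`, `v` -/

/-- `X`-adapted variables: smooth local coordinates `y = (s, z)` of `ℝ^{n+1}`, functions of `x`
alone, and a smooth function `v(x,u)`, which together are smooth local coordinates of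
`ℝ^{n+1} × ℝ` with `X s = 1`, `X z = 0`, `X v = 0`. -/
structure AdaptedChart {n : ℕ} (X : ProjectableField (n + 1)) where
  /-- the change of independent variables `x ↦ (s, z)` -/
  base : OpenPartialHomeomorph (Vec (n + 1)) (Vec (n + 1))
  /-- the change of all variables `(x, u) ↦ ((s, z), v)` -/
  total : OpenPartialHomeomorph (Vec (n + 1) × ℝ) (Vec (n + 1) × ℝ)
  source_subset : total.source ⊆ X.dom
  fst_mem : ∀ q ∈ total.source, q.1 ∈ base.source
  fst_eq : ∀ q ∈ total.source, (total q).1 = base q.1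
  smooth_base : ContDiffOn ℝ ∞ base base.source
  smooth_base_symm : ContDiffOn ℝ ∞ base.symm base.target
  smooth_total : ContDiffOn ℝ ∞ total total.source
  smooth_total_symm : ContDiffOn ℝ ∞ total.symm total.target
  straighten : ∀ q ∈ total.source,
    fderiv ℝ total q (X.ξ q.1, X.φ q) = (Pi.single 0 1, 0)

namespace AdaptedChart

variable {n m : ℕ} {X : ProjectableField (n + 1)} (C : AdaptedChart X)

/-- The function `v(s,z)` that expresses the function `u = f(x)` in the adapted variables. -/
def push (f : Vec (n + 1) → ℝ) (y : Vec (n + 1)) : ℝ :=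
  (C.total (C.base.symm y, f (C.base.symm y))).2

/-- The function `u(x)` which in the adapted variables is the function `v = g(s,z)`. -/
def pull (g : Vec (n + 1) → ℝ) (x : Vec (n + 1)) : ℝ :=
  (C.total.symm (C.base x, g (C.base x))).2

/-- The change of variables on jets, `(x, u^{(m)}) ↦ (s, z, v^{(m)})`. -/
def jetMap (θ : Jet (n + 1) m) : Jet (n + 1) m := jet m (C.push (taylor θ)) (C.base θ.1)

/-- The inverse change of variables on jets, `(s, z, v^{(m)}) ↦ (x, u^{(m)})`;
`Δ` expressed in the adapted variables is `Δ ∘ C.jetMapInv`. -/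
def jetMapInv (θ : Jet (n + 1) m) : Jet (n + 1) m := jet m (C.pull (taylor θ)) (C.base.symm θ.1)

/-- The adapted jets `(s, z, v^{(m)})` over the chart that correspond to jets in `D`. -/
def jetDomain (D : Set (Jet (n + 1) m)) : Set (Jet (n + 1) m) :=
  {θ | (θ.1, θ.val) ∈ C.total.target ∧ C.jetMapInv θ ∈ D}

end AdaptedChart

/-- The coordinate `v_s^{(ℓ)} = D_ℓ v_s` on `J^m`, for a multi-index `ℓ` with `|ℓ| < m`
(so `v_s, v_ss, v_{s z_k}, …`, all the derivatives up to order `m` that contain an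
`s`-derivative). -/
def sDeriv {n m : ℕ} (ℓ : SIdx (n + 1) m) (θ : Jet (n + 1) m) : ℝ :=
  θ.2 ⟨ℓ.1 + Pi.single 0 1, by
    have := ℓ.2
    simp only [Pi.add_apply, Finset.sum_add_distrib, Finset.sum_pi_single', Finset.mem_univ,
      if_true]
    omega⟩

/-- The part `(z, v^{(m)} without the v_s^{(ℓ)})` of an adapted jet: `z` together with `v` and its
derivatives with respect to the `z`s only. It is a jet in the `n` variables `z`. -/
def zPart {n m : ℕ} (θ : Jet (n + 1) m) : Jet n m :=
  (Fin.tail θ.1, fun β => θ.2 ⟨Fin.cons 0 β.1, by simpa [Fin.sum_univ_succ] using β.2⟩)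

/-- The part `(s, z, v^{(m)} without the v_s^{(ℓ)})` of an adapted jet. -/
def szPart {n m : ℕ} (θ : Jet (n + 1) m) : ℝ × Jet n m := (θ.1 0, zPart θ)

/-- On the open set `N` of adapted jets, `Δ = R·K(z,v^{(m)}) + ∑_ℓ Θ_ℓ v_s^{(ℓ)}`, where
`R`, `K`, `Θ_ℓ` are smooth, `R`, `K` do not contain the `v_s^{(ℓ)}`, `K` does not contain `s`
and `R` does not vanish. -/
structure IsStandardForm {n m : ℕ} {X : ProjectableField (n + 1)} (C : AdaptedChart X)
    (D : Set (Jet (n + 1) m)) (Δ : Jet (n + 1) m → ℝ) (N : Set (Jet (n + 1) m))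
    (R : ℝ × Jet n m → ℝ) (K : Jet n m → ℝ) (Θ : SIdx (n + 1) m → Jet (n + 1) m → ℝ) : Prop where
  isOpen : IsOpen N
  subset : N ⊆ C.jetDomain D
  smooth_R : ContDiffOn ℝ ∞ R (szPart '' N)
  smooth_K : ContDiffOn ℝ ∞ K (zPart '' N)
  smooth_Θ : ∀ ℓ, ContDiffOn ℝ ∞ (Θ ℓ) N
  R_ne_zero : ∀ θ ∈ N, R (szPart θ) ≠ 0
  eq : ∀ θ ∈ N, Δ (C.jetMapInv θ) = R (szPart θ) * K (zPart θ) + ∑ ℓ, Θ ℓ θ * sDeriv ℓ θ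

/-- On the open set `N` of adapted jets,
`Δ = ∑_{r=1}^σ R_r K_r(z,v^{(m)}) + ∑_ℓ Θ_ℓ v_s^{(ℓ)}`, where `R_r`, `K_r`, `Θ_ℓ` are smooth,
`R_r`, `K_r` do not contain the `v_s^{(ℓ)}`, the `K_r` do not contain `s`, and the `R_r` are
linearly independent as functions of `s`, in the sense that their Wronskian with respect to `s`
does not vanish. -/
structure IsWeakForm {n m : ℕ} {X : ProjectableField (n + 1)} (C : AdaptedChart X)
    (D : Set (Jet (n + 1) m)) (Δ : Jet (n + 1) m → ℝ) (N : Set (Jet (n + 1) m)) {σ : ℕ}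
    (R : Fin σ → ℝ × Jet n m → ℝ) (K : Fin σ → Jet n m → ℝ)
    (Θ : SIdx (n + 1) m → Jet (n + 1) m → ℝ) : Prop where
  isOpen : IsOpen N
  subset : N ⊆ C.jetDomain D
  smooth_R : ∀ r, ContDiffOn ℝ ∞ (R r) (szPart '' N)
  smooth_K : ∀ r, ContDiffOn ℝ ∞ (K r) (zPart '' N)
  smooth_Θ : ∀ ℓ, ContDiffOn ℝ ∞ (Θ ℓ) N
  wronskian_ne_zero : ∀ θ ∈ N, (Matrix.of fun j r : Fin σ =>
    iteratedDeriv (j : ℕ) (fun s => R r (s, zPart θ)) (θ.1 0)).det ≠ 0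
  eq : ∀ θ ∈ N, Δ (C.jetMapInv θ) =
    ∑ r, R r (szPart θ) * K r (zPart θ) + ∑ ℓ, Θ ℓ θ * sDeriv ℓ θ

/-- `X` is a "standard" conditional symmetry of `Δ = 0` near `θ₀`: in the adapted variables `Δ` has
the form `R·K(z,v^{(m)}) + ∑_ℓ Θ_ℓ v_s^{(ℓ)}` near the jet corresponding to `θ₀`. -/
def HasStandardForm {n m : ℕ} {X : ProjectableField (n + 1)} (C : AdaptedChart X)
    (D : Set (Jet (n + 1) m)) (Δ : Jet (n + 1) m → ℝ) (θ₀ : Jet (n + 1) m) : Prop :=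
  ∃ N R K Θ, C.jetMap θ₀ ∈ N ∧ IsStandardForm C D Δ N R K Θ

/-- `X` is a "weak" conditional symmetry of order `σ` of `Δ = 0` near `θ₀`: in the adapted variables
`Δ` has the form `∑_{r=1}^σ R_r K_r(z,v^{(m)}) + ∑_ℓ Θ_ℓ v_s^{(ℓ)}` near the jet corresponding
to `θ₀`. -/
def HasWeakForm {n m : ℕ} {X : ProjectableField (n + 1)} (C : AdaptedChart X)
    (D : Set (Jet (n + 1) m)) (Δ : Jet (n + 1) m → ℝ) (σ : ℕ) (θ₀ : Jet (n + 1) m) : Prop :=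
  ∃ (N : Set (Jet (n + 1) m)) (R : Fin σ → ℝ × Jet n m → ℝ) (K : Fin σ → Jet n m → ℝ)
    (Θ : SIdx (n + 1) m → Jet (n + 1) m → ℝ), C.jetMap θ₀ ∈ N ∧ IsWeakForm C D Δ N R K Θ

namespace AdaptedChart

variable {n m : ℕ} {X : ProjectableField (n + 1)} (C : AdaptedChart X)

/-- The set of the `x` in the chart with `s ∈ I` and `z ∈ Z`. -/
def box (I : Set ℝ) (Z : Set (Vec n)) : Set (Vec (n + 1)) :=
  {x | x ∈ C.base.source ∧ C.base x 0 ∈ I ∧ Fin.tail (C.base x) ∈ Z}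

/-- The function `u(x)` which in the adapted variables is `v = w(z)`. -/
def lift (w : Vec n → ℝ) : Vec (n + 1) → ℝ := C.pull (fun y => w (Fin.tail y))

/-- `K_r^{(0)}(z, w^{(m)}) = 0` is the system of reduced equations for `Δ = 0` on the set `N` of
adapted jets: for every smooth `w(z)` for which the jets of `v(s,z) = w(z)` lie in `N`, the
corresponding `u(x)` is an `X`-invariant function, and it solves `Δ = 0` if and only if `w` solves
all the reduced equations. -/
def IsReducedSystem (Δ : Jet (n + 1) m → ℝ) (N : Set (Jet (n + 1) m)) {ι : Type*}
    (K : ι → Jet n m → ℝ) : Prop :=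
  ∀ (I : Set ℝ) (Z : Set (Vec n)) (w : Vec n → ℝ), IsOpen I → I.Nonempty → IsOpen Z →
    ContDiffOn ℝ ∞ w Z →
    (∀ s ∈ I, ∀ z ∈ Z, jet m (fun y : Vec (n + 1) => w (Fin.tail y)) (Fin.cons s z) ∈ N) →
    ContDiffOn ℝ ∞ (C.lift w) (C.box I Z) ∧
    (∀ x ∈ C.box I Z, X.side (C.lift w) x = 0) ∧
    ((∀ x ∈ C.box I Z, Δ (jet m (C.lift w) x) = 0) ↔ ∀ r, ∀ z ∈ Z, K r (jet m w z) = 0)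

/-- Every smooth `X`-invariant function in the chart is of the form `v = w(z)`. -/
def InvariantsAreLifts : Prop :=
  ∀ (I : Set ℝ) (Z : Set (Vec n)) (f : Vec (n + 1) → ℝ), IsOpen I → I.OrdConnected →
    I.Nonempty → IsOpen Z → (∀ s ∈ I, ∀ z ∈ Z, (Fin.cons s z : Vec (n + 1)) ∈ C.base.target) →
    ContDiffOn ℝ ∞ f (C.box I Z) → (∀ x ∈ C.box I Z, (x, f x) ∈ C.total.source) →
    (∀ x ∈ C.box I Z, X.side f x = 0) →
    ∃ w : Vec n → ℝ, ContDiffOn ℝ ∞ w Z ∧ ∀ x ∈ C.box I Z, f x = C.lift w x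

end AdaptedChart

end

/-! In adapted variables `X` becomes ∂/∂s, and the proposition turns into a statement about one
linear ordinary differential equation in s. Let F(s, a, η) be `Δ` written in adapted variables,
where a stands for z, v and the z-derivatives of v, and η collects the v_s^{(ℓ)}. Two facts carry
the translation. The identity v_s = v_u · X_Q u with v_u ≠ 0 (`dirDeriv_push`) shows, once
differentiated, that the D_α(X_Q u) and the v_s^{(ℓ)} generate the same ideal of germs
(`sideEq_inIdeal`, `sDeriv_inIdeal`). The change of variables on jets carries ∂/∂s to X^*
(`fderiv_jetMapInv_sDir`), so Δ^{(j)} becomes ∂_s^j F. Because X^*Δ^{(j)} = Δ^{(j+1)} and ∂_s η = 0,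
algebraic symmetry of S_σ means exactly that ∂_s^σ F lies in the ideal of F, …, ∂_s^{σ-1} F and η
(`isAlgebraicSymmetryNear_iff_inIdeal`).

If F has the form (2), then modulo η its s-derivatives of order below σ are the Wronskian matrix
applied to the vector of the K_r. Cramer's rule puts each K_r into the ideal, and with them ∂_s^σ F
(`IsProdForm.inIdeal`). Conversely, on η = 0 the ideal condition is a linear equation of order σ for
F with coefficients depending on s and a. Fundamental solutions serve as the R_r, and the initial
values of F, functions of a alone, as the K_r; Hadamard's lemma restores the terms in η
(`exists_isProdForm`). The standard case is σ = 1.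

Under maximal rank a function that vanishes on the zero set lies in the ideal
(`inIdeal_of_linearIndependent`), so a symmetry is an algebraic one. For the reduced equations, v =
w(z) has η = 0 and a independent of s, and the Wronskian forces all K_r to vanish as soon as ∑ R_r
K_r does. An invariant function has v_s = 0, hence is constant in s.

Adapted variables come from the flow of `X`. Smooth flows and the smooth coefficients in Hadamard's
lemma both rest on the smoothness of γ ↦ f ∘ γ on C([-1, 1], E) (`contDiff_superposition`). Jets are
handled by order of contact: the m-jets of f and g at x agree exactly when f - g = O(|y - x|^{m+1})
(`jet_eq_iff_flatAt`). Contact survives composition, so no higher chain rule is needed. -/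

noncomputable section

open Filter Topology Asymptotics

/-! ### Iterated directional derivatives -/

section DirDeriv

variable {E G : Type*} [NormedAddCommGroup E] [NormedSpace ℝ E] [NormedAddCommGroup G]
  [NormedSpace ℝ G]

/-- The directional derivative of a real function, as an operator on functions. -/
def dirDeriv (v : E) (f : E → ℝ) (x : E) : ℝ := fderiv ℝ f x v

/-- The iterated directional derivative along a list of vectors. -/
def dirDerivs (l : List E) (f : E → ℝ) : E → ℝ := l.foldr dirDeriv f

@[simp] theorem dirDerivs_nil (f : E → ℝ) : dirDerivs [] f = f := rfl

@[simp] theorem dirDerivs_cons (v : E) (l : List E) (f : E → ℝ) :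
    dirDerivs (v :: l) f = dirDeriv v (dirDerivs l f) := rfl

theorem dirDerivs_append (l l' : List E) (f : E → ℝ) :
    dirDerivs (l ++ l') f = dirDerivs l (dirDerivs l' f) := by
  simp [dirDerivs]

theorem ContDiffAt.dirDeriv {f : E → ℝ} {x : E} (hf : ContDiffAt ℝ ∞ f x) (v : E) :
    ContDiffAt ℝ ∞ (dirDeriv v f) x :=
  (hf.fderiv_right (m := ∞) (by simp)).clm_apply contDiffAt_const

theorem ContDiffAt.dirDerivs {f : E → ℝ} {x : E} (hf : ContDiffAt ℝ ∞ f x) (l : List E) :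
    ContDiffAt ℝ ∞ (dirDerivs l f) x := by
  induction l with
  | nil => exact hf
  | cons v l ih => exact ih.dirDeriv v

/-- `ContDiffAt ℝ ∞` provides for every finite order a neighbourhood that may depend on the order.
Statements on a neighbourhood are therefore drawn from a finite order, here 1. -/
theorem ContDiffAt.eventually_differentiableAt {f : E → G} {x : E} (hf : ContDiffAt ℝ ∞ f x) :
    ∀ᶠ y in 𝓝 x, DifferentiableAt ℝ f y :=
  ((hf.of_le (m := 1) (by simp)).eventually (by simp)).mono
    fun _ h => h.differentiableAt (by simp)

theorem Filter.EventuallyEq.dirDeriv {f g : E → ℝ} {x : E} (h : f =ᶠ[𝓝 x] g) (v : E) :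
    dirDeriv v f =ᶠ[𝓝 x] dirDeriv v g :=
  (h.fderiv (𝕜 := ℝ)).mono fun y hy => by simp [_root_.dirDeriv, hy]

theorem Filter.EventuallyEq.dirDerivs {f g : E → ℝ} {x : E} (h : f =ᶠ[𝓝 x] g) (l : List E) :
    dirDerivs l f =ᶠ[𝓝 x] dirDerivs l g := by
  induction l with
  | nil => exact h
  | cons v l ih => exact ih.dirDeriv v

theorem dirDeriv_comm {f : E → ℝ} {x : E} (hf : ContDiffAt ℝ ∞ f x) (v w : E) :
    dirDeriv v (dirDeriv w f) =ᶠ[𝓝 x] dirDeriv w (dirDeriv v f) := by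
  filter_upwards [(hf.of_le (m := 2) (by exact WithTop.coe_le_coe.2 le_top)).eventually (by simp)] with y hy
  have hd : DifferentiableAt ℝ (fderiv ℝ f) y :=
    (hy.fderiv_right (m := 1) (by norm_num)).differentiableAt (by simp)
  have hs := hy.isSymmSndFDerivAt (by simp)
  have key : ∀ a b : E, dirDeriv a (dirDeriv b f) y = fderiv ℝ (fderiv ℝ f) y a b := by
    intro a b
    have : dirDeriv b f = fun z => (fderiv ℝ f z) b := rfl
    rw [this, dirDeriv, fderiv_clm_apply hd (differentiableAt_const _)]
    simp
  rw [key, key, hs.eq]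

/-- Equality near `x`, not only at `x`, is what allows further differentiation in the induction. -/
theorem dirDerivs_perm {f : E → ℝ} {x : E} (hf : ContDiffAt ℝ ∞ f x) {l l' : List E}
    (h : l.Perm l') : dirDerivs l f =ᶠ[𝓝 x] dirDerivs l' f := by
  induction h with
  | nil => exact .rfl
  | cons v _ ih => exact ih.dirDeriv v
  | swap v w l => exact dirDeriv_comm (hf.dirDerivs l) _ _
  | trans _ _ h1 h2 => exact h1.trans h2

theorem dirDeriv_add {f g : E → ℝ} {x : E} (hf : DifferentiableAt ℝ f x)
    (hg : DifferentiableAt ℝ g x) (v : E) :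
    dirDeriv v (fun y => f y + g y) x = dirDeriv v f x + dirDeriv v g x := by
  simp [dirDeriv, fderiv_fun_add hf hg]

theorem dirDeriv_const_mul {f : E → ℝ} {x : E} (hf : DifferentiableAt ℝ f x) (c : ℝ) (v : E) :
    dirDeriv v (fun y => c * f y) x = c * dirDeriv v f x := by
  simp [dirDeriv, fderiv_const_mul hf]

theorem dirDeriv_mul {f g : E → ℝ} {x : E} (hf : DifferentiableAt ℝ f x)
    (hg : DifferentiableAt ℝ g x) (v : E) :
    dirDeriv v (fun y => f y * g y) x = dirDeriv v f x * g x + f x * dirDeriv v g x := by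
  simp [dirDeriv, fderiv_fun_mul hf hg]; ring

theorem dirDeriv_sum {ι : Type*} {s : Finset ι} {f : ι → E → ℝ} {x : E}
    (hf : ∀ i ∈ s, DifferentiableAt ℝ (f i) x) (v : E) :
    dirDeriv v (fun y => ∑ i ∈ s, f i y) x = ∑ i ∈ s, dirDeriv v (f i) x := by
  simp [dirDeriv, fderiv_fun_sum hf]

theorem dirDeriv_zero (v : E) : dirDeriv v (fun _ : E => (0 : ℝ)) = fun _ => 0 := by
  ext x; simp [dirDeriv]

theorem dirDerivs_zero (l : List E) : dirDerivs l (fun _ : E => (0 : ℝ)) = fun _ => 0 := by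
  induction l with
  | nil => rfl
  | cons v l ih => rw [dirDerivs_cons, ih, dirDeriv_zero]

theorem dirDerivs_add {f g : E → ℝ} {x : E} (hf : ContDiffAt ℝ ∞ f x) (hg : ContDiffAt ℝ ∞ g x)
    (l : List E) : dirDerivs l (fun y => f y + g y) =ᶠ[𝓝 x]
      fun y => dirDerivs l f y + dirDerivs l g y := by
  induction l with
  | nil => exact .rfl
  | cons v l ih =>
    refine (ih.dirDeriv v).trans ?_
    filter_upwards [(hf.dirDerivs l).eventually_differentiableAt,
      (hg.dirDerivs l).eventually_differentiableAt] with y h1 h2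
    exact dirDeriv_add h1 h2 v

theorem dirDerivs_const_mul {f : E → ℝ} {x : E} (hf : ContDiffAt ℝ ∞ f x) (c : ℝ)
    (l : List E) : dirDerivs l (fun y => c * f y) =ᶠ[𝓝 x] fun y => c * dirDerivs l f y := by
  induction l with
  | nil => exact .rfl
  | cons v l ih =>
    refine (ih.dirDeriv v).trans ?_
    filter_upwards [(hf.dirDerivs l).eventually_differentiableAt] with y h1
    exact dirDeriv_const_mul h1 c v

theorem dirDerivs_sum {ι : Type*} {s : Finset ι} {f : ι → E → ℝ} {x : E}
    (hf : ∀ i ∈ s, ContDiffAt ℝ ∞ (f i) x) (l : List E) :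
    dirDerivs l (fun y => ∑ i ∈ s, f i y) =ᶠ[𝓝 x] fun y => ∑ i ∈ s, dirDerivs l (f i) y := by
  classical
  induction s using Finset.induction_on with
  | empty => simp [dirDerivs_zero]
  | insert a s ha ih =>
    simp only [Finset.sum_insert ha]
    have h1 := hf a (Finset.mem_insert_self _ _)
    have h2 : ∀ i ∈ s, ContDiffAt ℝ ∞ (f i) x := fun i hi => hf i (Finset.mem_insert_of_mem hi)
    refine (dirDerivs_add h1 (ContDiffAt.sum h2) l).trans ?_
    filter_upwards [ih h2] with y hy
    rw [hy]

theorem dirDeriv_slice {H : G × E → ℝ} {e : G} {x : E} (hH : DifferentiableAt ℝ H (e, x)) (v : E) :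
    dirDeriv v (fun y => H (e, y)) x = dirDeriv ((0 : G), v) H (e, x) := by
  have h := hH.hasFDerivAt.comp x ((hasFDerivAt_const e x).prodMk (hasFDerivAt_id x))
  have h2 : fderiv ℝ (fun y => H (e, y)) x = _ := h.fderiv
  rw [dirDeriv, h2]
  simp [dirDeriv]

/-- Derivatives of a slice are derivatives of `H` itself along directions (0, v). This makes them
smooth jointly in the parameter and the point, which is how the jet maps are shown to be smooth. -/
theorem dirDerivs_slice {H : G × E → ℝ} {q : G × E} (hH : ContDiffAt ℝ ∞ H q) (l : List E) :
    ∀ᶠ r in 𝓝 q, dirDerivs l (fun y => H (r.1, y)) r.2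
      = dirDerivs (l.map fun v => ((0 : G), v)) H r := by
  induction l with
  | nil => simp
  | cons v l ih =>
    filter_upwards [ih.eventually_nhds,
      (hH.dirDerivs (l.map fun v => ((0 : G), v))).eventually_differentiableAt] with r hr hd
    have h1 : dirDerivs l (fun y => H (r.1, y)) =ᶠ[𝓝 r.2]
        fun y => dirDerivs (l.map fun v => ((0 : G), v)) H (r.1, y) := by
      have : Tendsto (fun y : E => (r.1, y)) (𝓝 r.2) (𝓝 r) := by
        rcases r with ⟨a, b⟩
        exact Continuous.tendsto (by fun_prop) b
      exact this.eventually hr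
    rw [dirDerivs_cons, (h1.dirDeriv v).self_of_nhds, dirDeriv_slice hd]
    simp

theorem ContDiffAt.dirDerivs_slice {H : G × E → ℝ} {q : G × E} (hH : ContDiffAt ℝ ∞ H q)
    (l : List E) :
    ContDiffAt ℝ ∞ (fun r : G × E => _root_.dirDerivs l (fun y => H (r.1, y)) r.2) q :=
  (hH.dirDerivs _).congr_of_eventuallyEq (_root_.dirDerivs_slice hH l)

end DirDeriv

/-! ### Partial derivatives -/

section PDeriv

variable {p : ℕ}

/-- The word in which each index `i` occurs `α i` times. -/
def idxWord (α : Fin p → ℕ) : List (Fin p) :=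
  (List.finRange p).flatMap fun i => List.replicate (α i) i

/-- The basis vectors indexed by a word. -/
abbrev dirs (l : List (Fin p)) : List (Vec p) := l.map fun i => Pi.single i 1

/-- With a word of directions in place of the nested iteration, commuting partial derivatives
becomes permuting a list. -/
theorem pderiv_eq_dirDerivs (α : Fin p → ℕ) (f : Vec p → ℝ) :
    pderiv α f = dirDerivs (dirs (idxWord α)) f := by
  have rep : ∀ (k : ℕ) (i : Fin p) (g : Vec p → ℝ),
      (fun (h : Vec p → ℝ) (x : Vec p) => fderiv ℝ h x (Pi.single i 1))^[k] g
        = dirDerivs (dirs (List.replicate k i)) g := by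
    intro k i g
    induction k with
    | zero => rfl
    | succ k ih => rw [Function.iterate_succ_apply', ih]; rfl
  unfold pderiv idxWord
  generalize List.finRange p = L
  induction L with
  | nil => rfl
  | cons i L ih =>
    rw [List.foldr_cons, ih, rep, List.flatMap_cons, dirs, dirs, dirs, List.map_append,
      dirDerivs_append]

theorem count_idxWord (α : Fin p → ℕ) (i : Fin p) : (idxWord α).count i = α i := by
  rw [idxWord, List.count_flatMap, ← List.sum_toFinset _ (List.nodup_finRange p)]
  simp [List.count_replicate]

theorem idxWord_zero : idxWord (0 : Fin p → ℕ) = [] := by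
  simp [idxWord]

@[simp] theorem pderiv_zero (f : Vec p → ℝ) : pderiv 0 f = f := by
  rw [pderiv_eq_dirDerivs, idxWord_zero]; rfl

theorem dirDerivs_dirs {f : Vec p → ℝ} {x : Vec p} (hf : ContDiffAt ℝ ∞ f x) (l : List (Fin p)) :
    dirDerivs (dirs l) f =ᶠ[𝓝 x] pderiv (fun i => l.count i) f := by
  rw [pderiv_eq_dirDerivs]
  refine dirDerivs_perm hf (List.Perm.map _ ?_)
  rw [List.perm_iff_count]
  intro i; rw [count_idxWord]

theorem pderiv_add_single {f : Vec p → ℝ} {x : Vec p} (hf : ContDiffAt ℝ ∞ f x)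
    (α : Fin p → ℕ) (i : Fin p) :
    pderiv (α + Pi.single i 1) f =ᶠ[𝓝 x] dirDeriv (Pi.single i 1) (pderiv α f) := by
  have h := dirDerivs_dirs hf (i :: idxWord α)
  have e : (fun j => (i :: idxWord α).count j) = α + Pi.single i 1 := by
    ext j; simp [List.count_cons, count_idxWord, Pi.single_apply, eq_comm (a := i)]
  rw [e] at h
  refine h.symm.trans ?_
  rw [pderiv_eq_dirDerivs]; exact .rfl

/-- The companion of `pderiv_add_single` with the extra derivative innermost; it turns v_s^{(ℓ)}
into D_ℓ applied to v_s. -/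
theorem pderiv_add_single' {f : Vec p → ℝ} {x : Vec p} (hf : ContDiffAt ℝ ∞ f x)
    (α : Fin p → ℕ) (i : Fin p) :
    pderiv (α + Pi.single i 1) f =ᶠ[𝓝 x] pderiv α (dirDeriv (Pi.single i 1) f) := by
  have h := dirDerivs_dirs hf (idxWord α ++ [i])
  have e : (fun j => (idxWord α ++ [i]).count j) = α + Pi.single i 1 := by
    ext j; simp [List.count_append, List.count_cons, count_idxWord, Pi.single_apply, eq_comm (a := i)]
  rw [e] at h
  refine h.symm.trans ?_
  rw [pderiv_eq_dirDerivs, dirs, List.map_append, dirDerivs_append]; exact .rfl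

theorem Filter.EventuallyEq.pderiv {f g : Vec p → ℝ} {x : Vec p} (h : f =ᶠ[𝓝 x] g)
    (α : Fin p → ℕ) : pderiv α f =ᶠ[𝓝 x] pderiv α g := by
  rw [pderiv_eq_dirDerivs, pderiv_eq_dirDerivs]; exact h.dirDerivs _

theorem pderiv_sum {ι : Type*} {s : Finset ι} {f : ι → Vec p → ℝ} {x : Vec p}
    (hf : ∀ i ∈ s, ContDiffAt ℝ ∞ (f i) x) (α : Fin p → ℕ) :
    pderiv α (fun y => ∑ i ∈ s, f i y) =ᶠ[𝓝 x] fun y => ∑ i ∈ s, pderiv α (f i) y := by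
  simp only [pderiv_eq_dirDerivs]; exact dirDerivs_sum hf _

theorem pderiv_add {f g : Vec p → ℝ} {x : Vec p} (hf : ContDiffAt ℝ ∞ f x)
    (hg : ContDiffAt ℝ ∞ g x) (α : Fin p → ℕ) :
    pderiv α (fun y => f y + g y) =ᶠ[𝓝 x] fun y => pderiv α f y + pderiv α g y := by
  simp only [pderiv_eq_dirDerivs]; exact dirDerivs_add hf hg _

theorem pderiv_const_mul {f : Vec p → ℝ} {x : Vec p} (hf : ContDiffAt ℝ ∞ f x) (c : ℝ)
    (α : Fin p → ℕ) : pderiv α (fun y => c * f y) =ᶠ[𝓝 x] fun y => c * pderiv α f y := by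
  simp only [pderiv_eq_dirDerivs]; exact dirDerivs_const_mul hf c _

theorem pderiv_neg {f : Vec p → ℝ} {x : Vec p} (hf : ContDiffAt ℝ ∞ f x)
    (α : Fin p → ℕ) : pderiv α (fun y => - f y) =ᶠ[𝓝 x] fun y => - pderiv α f y := by
  simpa using pderiv_const_mul hf (-1) α

theorem pderiv_sub {f g : Vec p → ℝ} {x : Vec p} (hf : ContDiffAt ℝ ∞ f x)
    (hg : ContDiffAt ℝ ∞ g x) (α : Fin p → ℕ) :
    pderiv α (fun y => f y - g y) =ᶠ[𝓝 x] fun y => pderiv α f y - pderiv α g y := by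
  have h := pderiv_add hf hg.neg α
  simp only [← sub_eq_add_neg] at h
  refine h.trans ?_
  filter_upwards [pderiv_neg hg α] with y hy
  rw [hy]; ring

theorem pderiv_sum_at {ι : Type*} {s : Finset ι} {f : ι → Vec p → ℝ} {x : Vec p}
    (hf : ∀ i ∈ s, ContDiffAt ℝ ∞ (f i) x) (α : Fin p → ℕ) :
    pderiv α (fun y => ∑ i ∈ s, f i y) x = ∑ i ∈ s, pderiv α (f i) x :=
  (pderiv_sum hf α).self_of_nhds

theorem pderiv_const_mul_at {f : Vec p → ℝ} {x : Vec p} (hf : ContDiffAt ℝ ∞ f x) (c : ℝ)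
    (α : Fin p → ℕ) : pderiv α (fun y => c * f y) x = c * pderiv α f x :=
  (pderiv_const_mul hf c α).self_of_nhds

theorem pderiv_sub_at {f g : Vec p → ℝ} {x : Vec p} (hf : ContDiffAt ℝ ∞ f x)
    (hg : ContDiffAt ℝ ∞ g x) (α : Fin p → ℕ) :
    pderiv α (fun y => f y - g y) x = pderiv α f x - pderiv α g x :=
  (pderiv_sub hf hg α).self_of_nhds

theorem pderiv_neg_at {f : Vec p → ℝ} {x : Vec p} (hf : ContDiffAt ℝ ∞ f x)
    (α : Fin p → ℕ) : pderiv α (fun y => - f y) x = - pderiv α f x :=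
  (pderiv_neg hf α).self_of_nhds

theorem pderiv_const_zero (α : Fin p → ℕ) : pderiv α (fun _ : Vec p => (0 : ℝ)) = fun _ => 0 := by
  rw [pderiv_eq_dirDerivs]; exact dirDerivs_zero _

theorem ContDiffAt.pderiv_slice {G : Type*} [NormedAddCommGroup G] [NormedSpace ℝ G]
    {H : G × Vec p → ℝ} {q : G × Vec p} (hH : ContDiffAt ℝ ∞ H q) (α : Fin p → ℕ) :
    ContDiffAt ℝ ∞ (fun r : G × Vec p => _root_.pderiv α (fun y => H (r.1, y)) r.2) q := by
  simp only [pderiv_eq_dirDerivs]; exact hH.dirDerivs_slice _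

/-- A derivative in the parameter commutes with those in space: on `H` it is one more letter of the
word, moved from the front to the back. -/
theorem dirDeriv_pderiv_slice {G : Type*} [NormedAddCommGroup G] [NormedSpace ℝ G]
    {H : G × Vec p → ℝ} {q : G × Vec p} (hH : ContDiffAt ℝ ∞ H q) (α : Fin p → ℕ) (v : G) :
    dirDeriv (v, 0) (fun r : G × Vec p => pderiv α (fun y => H (r.1, y)) r.2) q
      = pderiv α (fun y => dirDeriv (v, 0) H (q.1, y)) q.2 := by
  simp only [pderiv_eq_dirDerivs]
  have h1 : (fun r : G × Vec p => dirDerivs (dirs (idxWord α)) (fun y => H (r.1, y)) r.2)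
      =ᶠ[𝓝 q] dirDerivs ((dirs (idxWord α)).map fun w => ((0 : G), w)) H := dirDerivs_slice hH _
  rw [(h1.dirDeriv (v, 0)).self_of_nhds, (dirDerivs_slice (hH.dirDeriv (v, 0)) _).self_of_nhds,
    ← dirDerivs_cons]
  refine ((dirDerivs_perm hH (List.perm_append_singleton (v, 0) _).symm).self_of_nhds).trans ?_
  rw [dirDerivs_append]; rfl

theorem dirDeriv_eq_sum {f : Vec p → ℝ} (v x : Vec p) :
    dirDeriv v f x = ∑ i, v i * dirDeriv (Pi.single i 1) f x := by
  have hv : v = ∑ i, v i • (Pi.single i 1 : Vec p) := by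
    ext j; simp [Finset.sum_apply, Pi.single_apply]
  conv_lhs => rw [dirDeriv, hv, map_sum]
  simp [dirDeriv]

end PDeriv

/-! ### Taylor monomials -/

section Monomials

variable {p : ℕ}

/-- The Taylor monomial `(x - a)^β / β!`. -/
def tmono (a : Vec p) (β : Fin p → ℕ) (x : Vec p) : ℝ :=
  ∏ i, (x i - a i) ^ (β i) / ((β i).factorial : ℝ)

theorem contDiff_tmono_uncurry (β : Fin p → ℕ) :
    ContDiff ℝ ∞ fun q : Vec p × Vec p => tmono q.1 β q.2 := by
  unfold tmono
  exact contDiff_prod fun i _ => by fun_prop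

theorem contDiff_tmono (a : Vec p) (β : Fin p → ℕ) : ContDiff ℝ ∞ (tmono a β) :=
  (contDiff_tmono_uncurry β).comp (contDiff_const.prodMk contDiff_id)

theorem tmono_self (a : Vec p) (β : Fin p → ℕ) : tmono a β a = if β = 0 then 1 else 0 := by
  split_ifs with h
  · simp [tmono, h]
  · obtain ⟨i, hi⟩ := Function.ne_iff.1 h
    refine Finset.prod_eq_zero (Finset.mem_univ i) ?_
    simp [zero_pow hi]

theorem dirDeriv_tmono (a : Vec p) (β : Fin p → ℕ) (i : Fin p) :
    dirDeriv (Pi.single i 1) (tmono a β)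
      -- The case β i = 0 has to be separated because subtraction of exponents is truncated there.
      = if β i = 0 then fun _ => 0 else tmono a (β - Pi.single i 1) := by
  ext x
  have hfac : ∀ j, HasFDerivAt (fun y : Vec p => (y j - a j) ^ (β j) / ((β j).factorial : ℝ))
      (((β j : ℝ) * (x j - a j) ^ (β j - 1) / ((β j).factorial : ℝ)) •
        (ContinuousLinearMap.proj j : Vec p →L[ℝ] ℝ)) x := by
    intro j
    have h0 : HasFDerivAt (fun y : Vec p => y j) (ContinuousLinearMap.proj j : Vec p →L[ℝ] ℝ) x :=
      (ContinuousLinearMap.proj j : Vec p →L[ℝ] ℝ).hasFDerivAt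
    have h := (((hasDerivAt_pow (β j) (x j - a j)).div_const ((β j).factorial : ℝ)).comp_hasFDerivAt x
      (h0.sub_const (a j)))
    exact h
  have h := HasFDerivAt.finsetProd (u := Finset.univ) (fun j _ => hfac j)
  have h2 : fderiv ℝ (tmono a β) x = _ := h.fderiv
  rw [dirDeriv, h2, sum_apply, Finset.sum_eq_single i]
  · simp only [smul_apply, ContinuousLinearMap.proj_apply, Pi.single_eq_same,
      smul_eq_mul, mul_one]
    split_ifs with hi
    · simp [hi]
    · unfold tmono
      rw [← Finset.mul_prod_erase Finset.univ _ (Finset.mem_univ i), mul_comm]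
      obtain ⟨k, hk⟩ := Nat.exists_eq_succ_of_ne_zero hi
      congr 1
      · simp only [Pi.sub_apply, Pi.single_eq_same, hk, Nat.succ_sub_one, Nat.factorial_succ,
          Nat.succ_eq_add_one]
        have : ((k.factorial : ℕ) : ℝ) ≠ 0 := by exact_mod_cast k.factorial_ne_zero
        push_cast
        field_simp
      · refine Finset.prod_congr rfl fun j hj => ?_
        have : j ≠ i := Finset.ne_of_mem_erase hj
        simp [this]
  · intro j _ hj
    simp [hj]
  · simp

theorem dirDerivs_tmono (a : Vec p) (β : Fin p → ℕ) (l : List (Fin p)) :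
    dirDerivs (dirs l) (tmono a β) = if ∀ i, l.count i ≤ β i then
      tmono a (fun i => β i - l.count i) else fun _ => 0 := by
  induction l with
  | nil => simp
  | cons j l ih =>
    rw [dirs, List.map_cons, dirDerivs_cons]
    change dirDeriv _ (dirDerivs (dirs l) _) = _
    rw [ih]
    by_cases h : ∀ i, l.count i ≤ β i
    · rw [if_pos h, dirDeriv_tmono]
      by_cases hj : β j - l.count j = 0
      · have : ¬ ∀ i, (j :: l).count i ≤ β i := fun h' => by
          have := h' j
          simp at this; omega
        rw [if_pos hj, if_neg this]
      · have : ∀ i, (j :: l).count i ≤ β i := by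
          intro i
          rw [List.count_cons]
          have := h i
          by_cases hij : j = i
          · subst hij; simp; omega
          · simp [hij, this]
        rw [if_neg hj, if_pos this]
        congr 1
        ext i
        by_cases hij : j = i
        · subst hij; simp; omega
        · simp [hij, Ne.symm hij]
    · have : ¬ ∀ i, (j :: l).count i ≤ β i := fun h' => h fun i =>
        (List.count_le_count_cons ..).trans (h' i)
      rw [if_neg h, if_neg this, dirDeriv_zero]

/-- Derivatives at `a` and Taylor monomials centred at `a` are dual bases. Hence `taylor θ` realizes
the jet `θ`. -/
theorem pderiv_tmono_self (a : Vec p) (α β : Fin p → ℕ) :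
    pderiv α (tmono a β) a = if β = α then 1 else 0 := by
  rw [pderiv_eq_dirDerivs, dirDerivs_tmono]
  simp only [count_idxWord]
  by_cases h : ∀ i, α i ≤ β i
  · rw [if_pos h, tmono_self]
    have : (fun i => β i - α i) = 0 ↔ β = α := by
      constructor
      · intro h0; ext i
        have := congrFun h0 i
        have := h i
        simp only [Pi.zero_apply] at *
        omega
      · rintro rfl; ext i; simp
    simp [this]
  · rw [if_neg h, if_neg]
    rintro rfl
    exact h fun i => le_rfl

theorem taylor_eq {m : ℕ} (θ : Jet p m) : taylor θ = fun x => ∑ α, θ.2 α * tmono θ.1 α.1 x := rfl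

theorem contDiff_taylor_uncurry (m : ℕ) :
    ContDiff ℝ ∞ fun q : Jet p m × Vec p => taylor q.1 q.2 := by
  simp only [taylor_eq]
  refine ContDiff.sum fun α _ => ContDiff.mul (by fun_prop) ?_
  exact (contDiff_tmono_uncurry α.1).comp
    (f := fun q : Jet p m × Vec p => (q.1.1, q.2)) (by fun_prop)

theorem contDiff_taylor {m : ℕ} (θ : Jet p m) : ContDiff ℝ ∞ (taylor θ) :=
  (contDiff_taylor_uncurry m).comp (contDiff_const.prodMk contDiff_id)

theorem pderiv_taylor {m : ℕ} (θ : Jet p m) (α : MIdx p m) :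
    pderiv α.1 (taylor θ) θ.1 = θ.2 α := by
  rw [taylor_eq, pderiv_sum_at (x := θ.1) (fun β _ =>
    (contDiff_const.mul (contDiff_tmono _ _)).contDiffAt) α.1]
  have : ∀ β : MIdx p m, pderiv α.1 (fun y => θ.2 β * tmono θ.1 β.1 y) θ.1
      = if β = α then θ.2 α else 0 := by
    intro β
    rw [pderiv_const_mul_at (contDiff_tmono _ _).contDiffAt _ α.1, pderiv_tmono_self]
    by_cases h : β = α
    · simp [h]
    · rw [if_neg h, if_neg (fun h' => h (Subtype.ext h')), mul_zero]
  simp [this]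

theorem jet_taylor {m : ℕ} (θ : Jet p m) : jet m (taylor θ) θ.1 = θ := by
  ext α
  · rfl
  · exact pderiv_taylor θ α

theorem taylor_self {m : ℕ} (θ : Jet p m) : taylor θ θ.1 = θ.val := by
  have h := pderiv_taylor θ ⟨0, by simp⟩
  rwa [pderiv_zero] at h

end Monomials

/-! ### Functions that vanish to a given order -/

section Flat

variable {p : ℕ}

/-- `h` vanishes at `x` to the order `k`: `h(y) = O(|y - x|^k)`. -/
def FlatAt (k : ℕ) (h : Vec p → ℝ) (x : Vec p) : Prop :=
  h =O[𝓝 x] fun y => ‖y - x‖ ^ k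

/-- Induction on `k`: the first partial derivatives are O(|y - x|^k), and the mean value inequality
gains one power. Words are used instead of multi-indices so that the innermost derivative can be
split off without commuting anything. -/
theorem flatAt_of_dirDerivs_eq_zero (k : ℕ) {h : Vec p → ℝ} {x : Vec p} (hh : ContDiffAt ℝ ∞ h x)
    (h0 : ∀ l : List (Fin p), l.length < k → dirDerivs (dirs l) h x = 0) : FlatAt k h x := by
  induction k generalizing h with
  | zero =>
    simpa [FlatAt] using hh.continuousAt.norm.isBoundedUnder_le.isBigO_one ℝ
  | succ k ih =>
    have h1 : ∀ i : Fin p, FlatAt k (dirDeriv (Pi.single i 1) h) x := by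
      intro i
      refine ih (hh.dirDeriv _) fun l hl => ?_
      have := h0 (l ++ [i]) (by simpa using hl)
      simpa [dirs, dirDerivs_append] using this
    have hx : h x = 0 := h0 [] (by simp)
    have h2 : (fun y => ∑ i : Fin p, ‖dirDeriv (Pi.single i 1) h y‖)
        =O[𝓝 x] fun y => ‖y - x‖ ^ k :=
      IsBigO.fun_sum fun i _ => (h1 i).norm_left
    obtain ⟨C, hC0, hC⟩ := h2.exists_nonneg
    have hev := (hC.bound.and hh.eventually_differentiableAt)
    obtain ⟨r, hr, hball⟩ := Metric.eventually_nhds_iff_ball.1 hev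
    refine IsBigO.of_bound C ?_
    filter_upwards [Metric.ball_mem_nhds x hr] with y hy
    -- The mean value inequality is applied on the ball of radius ‖y - x‖, where the gradient is at
    -- most C‖y - x‖^k.
    have hsub : Metric.closedBall x ‖y - x‖ ⊆ Metric.ball x r := by
      apply Metric.closedBall_subset_ball
      rwa [Metric.mem_ball, dist_eq_norm] at hy
    have hmv := (convex_closedBall x ‖y - x‖).norm_image_sub_le_of_norm_fderiv_le (𝕜 := ℝ)
      (f := h) (C := C * ‖y - x‖ ^ k) (x := x) (y := y)
      (fun z hz => (hball z (hsub hz)).2) (fun z hz => ?_)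
      (Metric.mem_closedBall_self (norm_nonneg _)) (by simp [dist_eq_norm])
    · rw [hx, sub_zero] at hmv
      refine hmv.trans (le_of_eq ?_)
      rw [norm_pow, norm_norm, pow_succ, mul_assoc]
    · have hb := (hball z (hsub hz)).1
      have hn : ‖fderiv ℝ h z‖ ≤ ∑ i : Fin p, ‖dirDeriv (Pi.single i 1) h z‖ := by
        refine ContinuousLinearMap.opNorm_le_bound _ (Finset.sum_nonneg fun _ _ => norm_nonneg _) ?_
        intro v
        have hv : v = ∑ i, v i • (Pi.single i 1 : Vec p) := by
          ext j; simp [Finset.sum_apply, Pi.single_apply]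
        conv_lhs => rw [hv, map_sum]
        refine (norm_sum_le _ _).trans ?_
        rw [Finset.sum_mul]
        refine Finset.sum_le_sum fun i _ => ?_
        rw [map_smul, norm_smul, mul_comm]
        exact mul_le_mul_of_nonneg_left (norm_le_pi_norm v i) (norm_nonneg _)
      refine hn.trans ((Real.le_norm_self _).trans (hb.trans ?_))
      refine mul_le_mul_of_nonneg_left ?_ hC0
      rw [norm_pow, norm_norm]
      refine pow_le_pow_left₀ (norm_nonneg _) ?_ k
      rwa [Metric.mem_closedBall, dist_eq_norm] at hz

theorem flatAt_of_pderiv_eq_zero {k : ℕ} {h : Vec p → ℝ} {x : Vec p} (hh : ContDiffAt ℝ ∞ h x)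
    (h0 : ∀ α : Fin p → ℕ, ∑ i, α i < k → pderiv α h x = 0) : FlatAt k h x := by
  refine flatAt_of_dirDerivs_eq_zero k hh fun l hl => ?_
  rw [(dirDerivs_dirs hh l).self_of_nhds]
  refine h0 _ ?_
  have := Multiset.sum_count_eq_card (s := Finset.univ) (m := (l : Multiset (Fin p)))
    (fun _ _ => Finset.mem_univ _)
  simp only [Multiset.coe_count, Multiset.coe_card] at this
  rwa [this]

/-- The bound forces a root at 0. Dividing by X lowers both the degree and the order of the bound by
one. -/
theorem Polynomial.eq_zero_of_isBigO {P : Polynomial ℝ} {k : ℕ} (hd : P.degree < k)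
    (hP : (fun t : ℝ => P.eval t) =O[𝓝 0] fun t => t ^ k) : P = 0 := by
  induction k generalizing P with
  | zero => simpa [Polynomial.degree_lt_iff_coeff_zero, Polynomial.ext_iff] using hd
  | succ k ih =>
    have h0 : P.eval 0 = 0 := by
      have h1 : Tendsto (fun t : ℝ => P.eval t) (𝓝 0) (𝓝 0) := by
        refine hP.trans_tendsto ?_
        have : Continuous fun t : ℝ => t ^ (k + 1) := by fun_prop
        simpa using this.tendsto 0
      exact tendsto_nhds_unique (P.continuous.tendsto 0) h1
    have hdvd : Polynomial.X ∣ P := by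
      rw [Polynomial.X_dvd_iff, Polynomial.coeff_zero_eq_eval_zero, h0]
    obtain ⟨Q, rfl⟩ := hdvd
    have hQd : Q.degree < k := by
      rw [Polynomial.degree_lt_iff_coeff_zero] at hd ⊢
      intro j hj
      have := hd (j + 1) (by omega)
      rwa [Polynomial.coeff_X_mul] at this
    have hQ : (fun t : ℝ => Q.eval t) =O[𝓝 0] fun t => t ^ k := by
      obtain ⟨C, hC⟩ := hP.bound
      have hC' : ∀ᶠ t in 𝓝[≠] (0 : ℝ), ‖Q.eval t‖ ≤ C * ‖t ^ k‖ := by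
        filter_upwards [nhdsWithin_le_nhds hC, self_mem_nhdsWithin] with t ht hne
        have hne' : (0 : ℝ) < ‖t‖ := norm_pos_iff.2 hne
        rw [Polynomial.eval_mul, Polynomial.eval_X, norm_mul, pow_succ, norm_mul] at ht
        refine le_of_mul_le_mul_left ?_ hne'
        linarith [ht]
      -- Division by t gives the bound only for t ≠ 0; at t = 0 it follows by continuity.
      have hle : ‖Q.eval 0‖ ≤ C * ‖(0 : ℝ) ^ k‖ :=
        le_of_tendsto_of_tendsto
          ((by fun_prop : Continuous fun t : ℝ => ‖Q.eval t‖).continuousWithinAt)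
          ((by fun_prop : Continuous fun t : ℝ => C * ‖t ^ k‖).continuousWithinAt) hC'
      refine IsBigO.of_bound C ?_
      rw [eventually_nhdsWithin_iff] at hC'
      filter_upwards [hC'] with t ht
      by_cases h : t = 0
      · rw [h]; exact hle
      · exact ht h
    rw [ih hQd hQ, mul_zero]

theorem tmono_line (a v : Vec p) (β : Fin p → ℕ) (t : ℝ) :
    tmono a β (a + t • v) = tmono a β (a + v) * t ^ (∑ i, β i) := by
  unfold tmono
  rw [← Finset.prod_pow_eq_pow_sum, ← Finset.prod_mul_distrib]
  refine Finset.prod_congr rfl fun i _ => ?_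
  simp only [Pi.add_apply, Pi.smul_apply, smul_eq_mul, add_sub_cancel_left, mul_pow]
  ring

theorem FlatAt.comp {q : ℕ} {k : ℕ} {h : Vec p → ℝ} {b : Vec q → Vec p} {x : Vec q}
    (hh : FlatAt k h (b x)) (hb : DifferentiableAt ℝ b x) : FlatAt k (fun y => h (b y)) x := by
  refine (IsBigO.comp_tendsto hh hb.continuousAt).trans ?_
  refine IsBigO.of_norm_left (g := fun y => ‖y - x‖ ^ k) ?_
  simp only [norm_norm, norm_pow, Function.comp_def]
  simpa using (hb.isBigO_sub.norm_left.norm_right.pow k)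

theorem FlatAt.sub {k : ℕ} {f g : Vec p → ℝ} {x : Vec p} (hf : FlatAt k f x) (hg : FlatAt k g x) :
    FlatAt k (fun y => f y - g y) x := IsBigO.sub hf hg

theorem FlatAt.sum {ι : Type*} {s : Finset ι} {k : ℕ} {f : ι → Vec p → ℝ} {x : Vec p}
    (hf : ∀ i ∈ s, FlatAt k (f i) x) : FlatAt k (fun y => ∑ i ∈ s, f i y) x :=
  IsBigO.fun_sum hf

theorem FlatAt.mul {k l : ℕ} {f g : Vec p → ℝ} {x : Vec p} (hf : FlatAt k f x)
    (hg : FlatAt l g x) : FlatAt (k + l) (fun y => f y * g y) x := by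
  have := IsBigO.mul hf hg
  simpa [FlatAt, pow_add] using this

theorem flatAt_zero_of_continuousAt {f : Vec p → ℝ} {x : Vec p} (hf : ContinuousAt f x) :
    FlatAt 0 f x := by
  simpa [FlatAt] using hf.norm.isBoundedUnder_le.isBigO_one ℝ

theorem flatAt_one_of_differentiableAt {f : Vec p → ℝ} {x : Vec p} (hf : DifferentiableAt ℝ f x)
    (h0 : f x = 0) : FlatAt 1 f x := by
  have := hf.isBigO_sub.norm_right
  simpa [FlatAt, h0] using this

theorem FlatAt.congr {k : ℕ} {f g : Vec p → ℝ} {x : Vec p} (hf : FlatAt k f x)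
    (h : f =ᶠ[𝓝 x] g) : FlatAt k g x :=
  IsBigO.congr' hf h .rfl

/-- The Taylor polynomial of order less than `k`. -/
theorem flatAt_sub_taylor {k : ℕ} {h : Vec p → ℝ} {x : Vec p} (hh : ContDiffAt ℝ ∞ h x) :
    FlatAt k (fun y => h y - ∑ β : SIdx p k, pderiv β.1 h x * tmono x β.1 y) x := by
  have hs : ∀ β : SIdx p k, ContDiffAt ℝ ∞ (fun y => pderiv β.1 h x * tmono x β.1 y) x :=
    fun β => (contDiff_const.mul (contDiff_tmono _ _)).contDiffAt
  have hS : ContDiffAt ℝ ∞ (fun y => ∑ β : SIdx p k, pderiv β.1 h x * tmono x β.1 y) x :=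
    ContDiffAt.sum fun β _ => hs β
  refine flatAt_of_pderiv_eq_zero (hh.sub hS) fun α hα => ?_
  rw [pderiv_sub_at hh hS α, pderiv_sum_at (fun β _ => hs β) α,
    Finset.sum_eq_single ⟨α, hα⟩]
  · rw [pderiv_const_mul_at (contDiff_tmono _ _).contDiffAt _ α, pderiv_tmono_self]
    simp
  · intro β _ hβ
    rw [pderiv_const_mul_at (contDiff_tmono _ _).contDiffAt _ α, pderiv_tmono_self,
      if_neg (fun h' => hβ (Subtype.ext h')), mul_zero]
  · simp

/-- The Taylor polynomial of order below `k` differs from `h` by O(|y - x|^k), so it has this order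
too. On each line through `x` it is a polynomial of degree below `k`, hence zero, and its
coefficients are the derivatives in question. -/
theorem FlatAt.pderiv_eq_zero {k : ℕ} {h : Vec p → ℝ} {x : Vec p} (hf : FlatAt k h x)
    (hh : ContDiffAt ℝ ∞ h x) {α : Fin p → ℕ} (hα : ∑ i, α i < k) : pderiv α h x = 0 := by
  have hT : FlatAt k (fun y => ∑ β : SIdx p k, pderiv β.1 h x * tmono x β.1 y) x := by
    simpa using hf.sub (flatAt_sub_taylor (k := k) hh)
  have hT0 : (fun y => ∑ β : SIdx p k, pderiv β.1 h x * tmono x β.1 y) = fun _ => 0 := by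
    ext y
    set v := y - x with hv
    let P : Polynomial ℝ := ∑ β : SIdx p k,
      Polynomial.C (pderiv β.1 h x * tmono x β.1 (x + v)) * Polynomial.X ^ (∑ i, β.1 i)
    have hev : ∀ t : ℝ, P.eval t
        = ∑ β : SIdx p k, pderiv β.1 h x * tmono x β.1 (x + t • v) := by
      intro t
      simp only [P, Polynomial.eval_finsetSum, Polynomial.eval_mul, Polynomial.eval_C,
        Polynomial.eval_pow, Polynomial.eval_X]
      refine Finset.sum_congr rfl fun β _ => ?_
      rw [tmono_line, mul_assoc]
    have hP : P = 0 := by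
      refine Polynomial.eq_zero_of_isBigO (k := k) ?_ ?_
      · rw [← Polynomial.mem_degreeLT]
        refine Submodule.sum_mem _ fun β _ => Polynomial.mem_degreeLT.2 ?_
        exact (Polynomial.degree_C_mul_X_pow_le _ _).trans_lt (by exact_mod_cast β.2)
      · simp only [hev]
        have ht : Tendsto (fun t : ℝ => x + t • v) (𝓝 0) (𝓝 x) := by
          have : Continuous fun t : ℝ => x + t • v := by fun_prop
          simpa using this.tendsto 0
        refine (IsBigO.comp_tendsto hT ht).trans ?_
        refine IsBigO.of_bound (‖v‖ ^ k) (Eventually.of_forall fun t => ?_)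
        simp [norm_smul, mul_pow, mul_comm]
    have := hev 1
    rw [hP, Polynomial.eval_zero, one_smul, hv, add_sub_cancel] at this
    exact this.symm
  have hs : ∀ β : SIdx p k, ContDiffAt ℝ ∞ (fun y => pderiv β.1 h x * tmono x β.1 y) x :=
    fun β => (contDiff_const.mul (contDiff_tmono _ _)).contDiffAt
  have hz := congrFun (pderiv_const_zero α) x
  rw [← hT0, pderiv_sum_at (fun β _ => hs β) α,
    Finset.sum_eq_single ⟨α, hα⟩] at hz
  · rw [pderiv_const_mul_at (contDiff_tmono _ _).contDiffAt _ α, pderiv_tmono_self] at hz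
    simpa using hz
  · intro β _ hβ
    rw [pderiv_const_mul_at (contDiff_tmono _ _).contDiffAt _ α, pderiv_tmono_self,
      if_neg (fun h' => hβ (Subtype.ext h')), mul_zero]
  · simp

/-- Superposition with a smooth function preserves agreement to a given order. -/
theorem FlatAt.superpose {k : ℕ} {Φ : Vec p × ℝ → ℝ} {f g : Vec p → ℝ} {x : Vec p}
    (h : FlatAt k (fun y => f y - g y) x) (hfg : f x = g x) (hf : ContinuousAt f x)
    (hg : ContinuousAt g x) (hΦ : ContDiffAt ℝ ∞ Φ (x, f x)) :
    FlatAt k (fun y => Φ (y, f y) - Φ (y, g y)) x := by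
  -- A local Lipschitz constant of `Φ` suffices, since the two arguments of `Φ` share their first
  -- component.
  obtain ⟨K, t, ht, hK⟩ := (hΦ.of_le (m := 1) (by simp)).exists_lipschitzOnWith
  have h1 : Tendsto (fun y => (y, f y)) (𝓝 x) (𝓝 (x, f x)) := continuousAt_id.prodMk hf
  have h2 : Tendsto (fun y => (y, g y)) (𝓝 x) (𝓝 (x, f x)) := by
    rw [hfg]; exact continuousAt_id.prodMk hg
  refine IsBigO.trans ?_ h
  refine IsBigO.of_bound K ?_
  filter_upwards [h1.eventually ht, h2.eventually ht] with y hy1 hy2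
  have := hK.dist_le_mul _ hy1 _ hy2
  rw [Prod.dist_eq, dist_self, max_eq_right dist_nonneg, dist_eq_norm, dist_eq_norm] at this
  exact this

/-- Equality of jets as order of contact. This form passes through superposition
(`FlatAt.superpose`) and change of base variables (`FlatAt.comp`), which makes the transformation of
jets well defined. -/
theorem jet_eq_iff_flatAt {m : ℕ} {f g : Vec p → ℝ} {x : Vec p} (hf : ContDiffAt ℝ ∞ f x)
    (hg : ContDiffAt ℝ ∞ g x) :
    jet m f x = jet m g x ↔ FlatAt (m + 1) (fun y => f y - g y) x := by
  constructor
  · intro h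
    refine flatAt_of_pderiv_eq_zero (hf.sub hg) fun α hα => ?_
    rw [pderiv_sub_at hf hg α]
    have := congrFun (congrArg Prod.snd h) ⟨α, Nat.lt_succ_iff.1 hα⟩
    exact sub_eq_zero.2 this
  · intro h
    refine Prod.ext rfl (funext fun α => ?_)
    have := h.pderiv_eq_zero (hf.sub hg) (Nat.lt_succ_iff.2 α.2)
    rw [pderiv_sub_at hf hg _] at this
    exact sub_eq_zero.1 this

theorem jet_congr {m : ℕ} {f g : Vec p → ℝ} {x : Vec p} (h : f =ᶠ[𝓝 x] g) :
    jet m f x = jet m g x :=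
  Prod.ext rfl (funext fun α => (h.pderiv α.1).self_of_nhds)

theorem jet_val {m : ℕ} (f : Vec p → ℝ) (x : Vec p) : (jet m f x).val = f x := by
  change pderiv 0 f x = f x
  rw [pderiv_zero]

/-- The jets of `A · (q ∘ b)` depend linearly on those of `q`. -/
theorem pderiv_mul_comp {r k : ℕ} {A : Vec p → ℝ} {b : Vec p → Vec r} {q : Vec r → ℝ} {x : Vec p}
    (hA : ContDiffAt ℝ ∞ A x) (hb : ContDiffAt ℝ ∞ b x) (hq : ContDiffAt ℝ ∞ q (b x))
    {α : Fin p → ℕ} (hα : ∑ i, α i < k) :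
    pderiv α (fun y => A y * q (b y)) x
      = ∑ β : SIdx r k, pderiv β.1 q (b x) * pderiv α (fun y => A y * tmono (b x) β.1 (b y)) x := by
  have hm : ∀ β : SIdx r k, ContDiffAt ℝ ∞ (fun y => A y * tmono (b x) β.1 (b y)) x := fun β =>
    hA.mul ((contDiff_tmono _ _).contDiffAt.comp x hb)
  have hms : ∀ β : SIdx r k,
      ContDiffAt ℝ ∞ (fun y => pderiv β.1 q (b x) * (A y * tmono (b x) β.1 (b y))) x := fun β =>
    contDiffAt_const.mul (hm β)
  have h1 : ContDiffAt ℝ ∞ (fun y => A y * q (b y)) x := hA.mul (hq.comp x hb)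
  have h2 : ContDiffAt ℝ ∞ (fun y => ∑ β : SIdx r k,
      pderiv β.1 q (b x) * (A y * tmono (b x) β.1 (b y))) x := ContDiffAt.sum fun β _ => hms β
  -- Replacing `q` by its Taylor polynomial at `b x` changes the product by O(|y - x|^k), which
  -- derivatives of order below `k` do not see.
  have hflat : FlatAt k (fun y => A y * q (b y)
      - ∑ β : SIdx r k, pderiv β.1 q (b x) * (A y * tmono (b x) β.1 (b y))) x := by
    have := (flatAt_zero_of_continuousAt hA.continuousAt).mul
      ((flatAt_sub_taylor (k := k) hq).comp (hb.differentiableAt (by simp)))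
    rw [zero_add] at this
    refine this.congr (Eventually.of_forall fun y => ?_)
    simp only [mul_sub, Finset.mul_sum]
    congr 1
    exact Finset.sum_congr rfl fun β _ => by ring
  have h3 := hflat.pderiv_eq_zero (h1.sub h2) hα
  rw [pderiv_sub_at h1 h2 α, sub_eq_zero] at h3
  rw [h3, pderiv_sum_at (fun β _ => hms β) α]
  exact Finset.sum_congr rfl fun β _ => pderiv_const_mul_at (hm β) _ α

end Flat

/-! ### Smoothness near a point -/

section SmoothNear

variable {E F G : Type*} [NormedAddCommGroup E] [NormedSpace ℝ E] [NormedAddCommGroup F]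
  [NormedSpace ℝ F] [NormedAddCommGroup G] [NormedSpace ℝ G]

/-- `f` is `C^∞` on a neighbourhood of `x`. -/
def SmoothNear (f : E → F) (x : E) : Prop := ∀ᶠ y in 𝓝 x, ContDiffAt ℝ ∞ f y

/-- The converse is not available, as the neighbourhoods hidden in `ContDiffAt ℝ ∞` may shrink with
the order. Normal forms and symmetry coefficients have to be smooth on one open set, hence the
stronger notion. -/
theorem SmoothNear.contDiffAt {f : E → F} {x : E} (h : SmoothNear f x) : ContDiffAt ℝ ∞ f x :=
  h.self_of_nhds

theorem ContDiff.smoothNear {f : E → F} (h : ContDiff ℝ ∞ f) (x : E) : SmoothNear f x :=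
  Eventually.of_forall fun _ => h.contDiffAt

theorem ContDiffOn.smoothNear {f : E → F} {s : Set E} (h : ContDiffOn ℝ ∞ f s) (hs : IsOpen s)
    {x : E} (hx : x ∈ s) : SmoothNear f x := by
  filter_upwards [hs.mem_nhds hx] with y hy
  exact h.contDiffAt (hs.mem_nhds hy)

theorem SmoothNear.congr {f g : E → F} {x : E} (h : SmoothNear f x) (hfg : f =ᶠ[𝓝 x] g) :
    SmoothNear g x := by
  filter_upwards [h, hfg.eventuallyEq_nhds] with y hy hy'
  exact hy.congr_of_eventuallyEq hy'.symm

theorem SmoothNear.comp {g : F → G} {f : E → F} {x : E} (hg : SmoothNear g (f x))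
    (hf : SmoothNear f x) : SmoothNear (fun y => g (f y)) x := by
  filter_upwards [hf, hf.contDiffAt.continuousAt.eventually hg] with y hy hy'
  exact hy'.comp y hy

theorem SmoothNear.add {f g : E → F} {x : E} (hf : SmoothNear f x) (hg : SmoothNear g x) :
    SmoothNear (fun y => f y + g y) x := by
  filter_upwards [hf, hg] with y h1 h2 using h1.add h2

theorem SmoothNear.mul {f g : E → ℝ} {x : E} (hf : SmoothNear f x) (hg : SmoothNear g x) :
    SmoothNear (fun y => f y * g y) x := by
  filter_upwards [hf, hg] with y h1 h2 using h1.mul h2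

theorem SmoothNear.inv {f : E → ℝ} {x : E} (hf : SmoothNear f x) (h0 : f x ≠ 0) :
    SmoothNear (fun y => (f y)⁻¹) x := by
  filter_upwards [hf, hf.contDiffAt.continuousAt.eventually_ne h0] with y h1 h2 using h1.inv h2

theorem SmoothNear.sum {ι : Type*} {s : Finset ι} {f : ι → E → F} {x : E}
    (hf : ∀ i ∈ s, SmoothNear (f i) x) : SmoothNear (fun y => ∑ i ∈ s, f i y) x := by
  filter_upwards [(Finset.eventually_all s).2 hf] with y hy using ContDiffAt.sum hy

theorem SmoothNear.prodMk {f : E → F} {g : E → G} {x : E} (hf : SmoothNear f x)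
    (hg : SmoothNear g x) : SmoothNear (fun y => (f y, g y)) x := by
  filter_upwards [hf, hg] with y h1 h2 using h1.prodMk h2

theorem smoothNear_const (c : F) (x : E) : SmoothNear (fun _ : E => c) x :=
  contDiff_const.smoothNear x

theorem smoothNear_pi {ι : Type*} [Fintype ι] {f : E → ι → ℝ} {x : E}
    (hf : ∀ i, SmoothNear (fun y => f y i) x) : SmoothNear f x := by
  filter_upwards [eventually_all.2 hf] with y hy using contDiffAt_pi.2 hy

theorem SmoothNear.apply {ι : Type*} [Fintype ι] {f : E → ι → ℝ} {x : E} (hf : SmoothNear f x)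
    (i : ι) : SmoothNear (fun y => f y i) x := by
  filter_upwards [hf] with y hy using contDiffAt_pi.1 hy i

theorem SmoothNear.dirDeriv {f : E → ℝ} {x : E} (hf : SmoothNear f x) (v : E) :
    SmoothNear (dirDeriv v f) x := by
  filter_upwards [hf] with y hy using hy.dirDeriv v

theorem SmoothNear.dirDeriv_iterate {f : E → ℝ} {x : E} (hf : SmoothNear f x) (v : E) (k : ℕ) :
    SmoothNear ((_root_.dirDeriv v)^[k] f) x := by
  induction k with
  | zero => exact hf
  | succ k ih => rw [Function.iterate_succ_apply']; exact ih.dirDeriv v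

/-- A function that is smooth near a point agrees there with a compactly supported smooth
function. -/
theorem SmoothNear.exists_cutoff [FiniteDimensional ℝ E] {f : E → F} {x : E}
    (hf : SmoothNear f x) :
    ∃ g : E → F, ContDiff ℝ ∞ g ∧ HasCompactSupport g ∧ g =ᶠ[𝓝 x] f := by
  obtain ⟨r, hr, hball⟩ := Metric.eventually_nhds_iff_ball.1 hf
  let χ : ContDiffBump x := ⟨r / 4, r / 2, by positivity, by linarith⟩
  refine ⟨fun y => χ y • f y, ?_, χ.hasCompactSupport.smul_right, ?_⟩
  · refine contDiff_iff_contDiffAt.2 fun y => ?_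
    by_cases hy : y ∈ tsupport (χ : E → ℝ)
    swap
    · refine (contDiffAt_const (c := (0 : F))).congr_of_eventuallyEq ?_
      filter_upwards [notMem_tsupport_iff_eventuallyEq.1 hy] with z hz
      rw [hz]; simp
    have := hy
    rw [χ.tsupport_eq] at this
    have hy' : y ∈ Metric.ball x r :=
      Metric.closedBall_subset_ball (by change r / 2 < r; linarith) this
    exact χ.contDiffAt.smul (hball y hy')
  · filter_upwards [χ.eventuallyEq_one] with y hy
    simp [hy]

/-- The inverse function theorem, with smoothness on a whole neighbourhood. -/
theorem SmoothNear.exists_openPartialHomeomorph [CompleteSpace E] {f : E → F} {a : E}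
    (hf : SmoothNear f a) (f' : E ≃L[ℝ] F) (hf' : HasFDerivAt f (f' : E →L[ℝ] F) a)
    {U : Set E} (hU : U ∈ 𝓝 a) :
    ∃ e : OpenPartialHomeomorph E F, a ∈ e.source ∧ e.source ⊆ U ∧ (∀ x, e x = f x) ∧
      ContDiffOn ℝ ∞ e e.source ∧ ContDiffOn ℝ ∞ e.symm e.target := by
  have hfa := hf.contDiffAt
  let e0 := hfa.toOpenPartialHomeomorph f hf' (by simp)
  have he0 : ∀ x, e0 x = f x := fun x => by
    rw [show ⇑e0 = f from ContDiffAt.toOpenPartialHomeomorph_coe hfa hf' (by simp)]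
  have hc : ContinuousAt (fderiv ℝ f) a :=
    (hfa.fderiv_right (m := ∞) (by simp)).continuousAt
  -- Invertibility of the derivative is an open condition. Restricting to points where it holds
  -- makes the inverse smooth on the whole target, not merely at the image of `a`.
  have hinv : ∀ᶠ x in 𝓝 a, fderiv ℝ f x ∈ Set.range ((↑) : (E ≃L[ℝ] F) → E →L[ℝ] F) := by
    refine hc.eventually (ContinuousLinearEquiv.isOpen.mem_nhds ⟨f', ?_⟩)
    exact hf'.fderiv.symm
  obtain ⟨W, hWsub, hWo, haW⟩ := mem_nhds_iff.1 (hf.and (hinv.and hU))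
  refine ⟨e0.restrOpen W hWo, ⟨?_, haW⟩, ?_, he0, ?_, ?_⟩
  · exact ContDiffAt.mem_toOpenPartialHomeomorph_source hfa hf' (by simp)
  · rintro x ⟨_, hx⟩
    exact (hWsub hx).2.2
  · rintro x ⟨_, hx⟩
    have h : ContDiffAt ℝ ∞ f x := (hWsub hx).1
    exact (h.congr_of_eventuallyEq (Eventually.of_forall he0)).contDiffWithinAt
  · intro y hy
    have hx := (e0.restrOpen W hWo).map_target hy
    obtain ⟨g', hg'⟩ := (hWsub hx.2).2.1
    have hsm : ContDiffAt ℝ ∞ f ((e0.restrOpen W hWo).symm y) := (hWsub hx.2).1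
    have hcongr := Eventually.of_forall (f := 𝓝 ((e0.restrOpen W hWo).symm y)) he0
    refine (OpenPartialHomeomorph.contDiffAt_symm (f₀' := g') (e0.restrOpen W hWo) hy ?_
      (hsm.congr_of_eventuallyEq hcongr)).contDiffWithinAt
    rw [hg']
    exact (hsm.differentiableAt (by simp)).hasFDerivAt.congr_of_eventuallyEq hcongr

end SmoothNear

/-! ### The superposition operator on spaces of continuous functions -/

section Superposition

-- A common universe lets the induction in `contDiff_superposition` replace `F` by `E →L[ℝ] F`.
universe u

variable {K : Type*} [TopologicalSpace K] [CompactSpace K]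
  {E F : Type u} [NormedAddCommGroup E] [NormedSpace ℝ E] [NormedAddCommGroup F] [NormedSpace ℝ F]

/-- The operator `γ ↦ f ∘ γ`. -/
def superposition {f : E → F} (hf : Continuous f) (γ : C(K, E)) : C(K, F) :=
  (⟨f, hf⟩ : C(E, F)).comp γ

/-- Pointwise application of operator-valued functions. -/
def pointwiseApply : C(K, E →L[ℝ] F) →L[ℝ] C(K, E) →L[ℝ] C(K, F) :=
  LinearMap.mkContinuous₂
    (LinearMap.mk₂ ℝ (fun (A : C(K, E →L[ℝ] F)) (γ : C(K, E)) => (⟨fun k => A k (γ k), by fun_prop⟩ : C(K, F)))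
      (fun _ _ _ => by ext; simp) (fun _ _ _ => by ext; simp)
      (fun _ _ _ => by ext; simp) (fun _ _ _ => by ext; simp)) 1
    (fun A γ => by
      rw [one_mul, ContinuousMap.norm_le _ (by positivity)]
      intro k
      exact (A k).le_opNorm_of_le (γ.norm_coe_le_norm k) |>.trans
        (mul_le_mul_of_nonneg_right (A.norm_coe_le_norm k) (norm_nonneg _)))

/-- Compact support makes f' globally Lipschitz, so the first order remainder of `f` is at most C‖y
- x‖² uniformly in the base point. This bounds the remainder of γ ↦ f ∘ γ in the supremum norm. -/
theorem hasFDerivAt_superposition {f : E → F} (hf : ContDiff ℝ ∞ f) (hc : HasCompactSupport f)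
    (γ : C(K, E)) :
    HasFDerivAt (superposition hf.continuous)
      (pointwiseApply (superposition (hf.continuous_fderiv (by simp)) γ)) γ := by
  obtain ⟨C, hC⟩ := ContDiff.lipschitzWith_of_hasCompactSupport (𝕂 := ℝ) (hc.fderiv ℝ)
    (hf.fderiv_right (m := ∞) (by simp)) (by simp)
  have key : ∀ x y : E, ‖f y - f x - fderiv ℝ f x (y - x)‖ ≤ C * ‖y - x‖ * ‖y - x‖ := by
    intro x y
    refine (convex_closedBall x ‖y - x‖).norm_image_sub_le_of_norm_fderiv_le' (𝕜 := ℝ)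
      (fun z _ => hf.differentiable (by simp) z) (fun z hz => ?_)
      (Metric.mem_closedBall_self (norm_nonneg _)) (by simp [dist_eq_norm])
    have := hC.dist_le_mul z x
    rw [dist_eq_norm, dist_eq_norm] at this
    rw [Metric.mem_closedBall, dist_eq_norm] at hz
    exact this.trans (mul_le_mul_of_nonneg_left hz C.2)
  rw [hasFDerivAt_iff_isLittleO]
  refine IsBigO.trans_isLittleO (g := fun δ => ‖δ - γ‖ * ‖δ - γ‖) ?_ ?_
  · refine IsBigO.of_bound C (Eventually.of_forall fun δ => ?_)
    rw [ContinuousMap.norm_le _ (by positivity)]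
    intro k
    refine (key (γ k) (δ k)).trans ?_
    have h : ‖δ k - γ k‖ ≤ ‖δ - γ‖ := (δ - γ).norm_coe_le_norm k
    rw [norm_mul, norm_norm, mul_assoc]
    gcongr
  · have h0 : Tendsto (fun δ : C(K, E) => ‖δ - γ‖) (𝓝 γ) (𝓝 0) := by
      have : Continuous fun δ : C(K, E) => ‖δ - γ‖ := by fun_prop
      simpa using this.tendsto γ
    have h1 := ((isLittleO_one_iff ℝ).2 h0).mul_isBigO
      (isBigO_refl (fun δ : C(K, E) => ‖δ - γ‖) (𝓝 γ))
    simpa using h1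

/-- The derivative is the superposition operator of f', followed by a continuous linear map. Since
f' again has compact support, induction on the order applies. -/
theorem contDiff_superposition {f : E → F} (hf : ContDiff ℝ ∞ f) (hc : HasCompactSupport f) :
    ContDiff ℝ ∞ (superposition hf.continuous : C(K, E) → C(K, F)) := by
  rw [contDiff_infty]
  intro n
  induction n generalizing F with
  | zero =>
    rw [CharP.cast_eq_zero, contDiff_zero, continuous_iff_continuousAt]
    exact fun γ => (hasFDerivAt_superposition hf hc γ).continuousAt
  | succ n ih =>
    rw [Nat.cast_add, Nat.cast_one, contDiff_succ_iff_hasFDerivAt]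
    refine ⟨_, ?_, hasFDerivAt_superposition hf hc⟩
    exact pointwiseApply.contDiff.comp (ih (hf.fderiv_right (m := ∞) (by simp)) (hc.fderiv ℝ))

end Superposition

/-! ### The Volterra integral -/

section Volterra

variable {E : Type*} [NormedAddCommGroup E] [NormedSpace ℝ E]

/-- The interval `[-1, 1]`. -/
abbrev SymIcc := Set.Icc (-1 : ℝ) 1

/-- Extension of a continuous function from `[-1, 1]` to the line. -/
def extendIcc (γ : C(SymIcc, E)) (s : ℝ) : E :=
  γ (Set.projIcc (-1) 1 (by norm_num) s)

theorem continuous_extendIcc (γ : C(SymIcc, E)) : Continuous (extendIcc γ) :=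
  γ.continuous.comp continuous_projIcc

theorem extendIcc_of_mem (γ : C(SymIcc, E)) {s : ℝ} (hs : s ∈ SymIcc) :
    extendIcc γ s = γ ⟨s, hs⟩ := by
  rw [extendIcc, Set.projIcc_of_mem _ hs]

theorem norm_extendIcc_le (γ : C(SymIcc, E)) (s : ℝ) : ‖extendIcc γ s‖ ≤ ‖γ‖ :=
  γ.norm_coe_le_norm _

/-- The operator `γ ↦ (τ ↦ ∫_0^τ γ)` on `C([-1, 1], E)`. -/
def volterra : C(SymIcc, E) →L[ℝ] C(SymIcc, E) :=
  LinearMap.mkContinuous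
    { toFun := fun γ => ⟨fun τ => ∫ s in (0 : ℝ)..τ, extendIcc γ s,
        (intervalIntegral.continuous_primitive
          (fun a b => (continuous_extendIcc γ).intervalIntegrable a b) 0).comp
            continuous_subtype_val⟩
      map_add' := fun γ δ => by
        ext τ
        exact intervalIntegral.integral_add ((continuous_extendIcc γ).intervalIntegrable _ _)
          ((continuous_extendIcc δ).intervalIntegrable _ _)
      map_smul' := fun c γ => by
        ext τ
        exact intervalIntegral.integral_smul _ _ } 1
    (fun γ => by
      rw [one_mul, ContinuousMap.norm_le _ (norm_nonneg _)]
      intro τ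
      refine (intervalIntegral.norm_integral_le_of_norm_le_const
        (fun s _ => norm_extendIcc_le γ s)).trans ?_
      rw [sub_zero]
      exact mul_le_of_le_one_right (norm_nonneg _) (abs_le.2 τ.2))

end Volterra

/-! ### Smooth local flows -/

section Flow

variable {E : Type*} [NormedAddCommGroup E] [NormedSpace ℝ E] [CompleteSpace E]

/-- The map whose zeros are the solutions of `γ' = a f(γ)`, `γ(0) = x` on `[-1, 1]`. -/
def integralEq {f : E → E} (hf : Continuous f) (q : (ℝ × E) × C(SymIcc, E)) :
    (ℝ × E) × C(SymIcc, E) :=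
  (q.1, q.2 - (ContinuousMap.const SymIcc q.1.2 + q.1.1 • volterra (superposition hf q.2)))

theorem contDiff_integralEq {f : E → E} (hf : ContDiff ℝ ∞ f) (hc : HasCompactSupport f) :
    ContDiff ℝ ∞ (integralEq hf.continuous) := by
  have hS : ContDiff ℝ ∞ (superposition hf.continuous : C(SymIcc, E) → C(SymIcc, E)) :=
    contDiff_superposition hf hc
  have hconst : ContDiff ℝ ∞ fun q : (ℝ × E) × C(SymIcc, E) => ContinuousMap.const SymIcc q.1.2 :=
    (ContinuousLinearMap.const ℝ SymIcc : E →L[ℝ] C(SymIcc, E)).contDiff.comp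
      (contDiff_snd.comp contDiff_fst)
  have hv : ContDiff ℝ ∞ fun q : (ℝ × E) × C(SymIcc, E) =>
      volterra (superposition hf.continuous q.2) :=
    volterra.contDiff.comp (hS.comp contDiff_snd)
  unfold integralEq
  fun_prop

/-- The shear `(y, h) ↦ (y, h - B y)`. -/
def shearEquiv {V W : Type*} [NormedAddCommGroup V] [NormedSpace ℝ V] [NormedAddCommGroup W]
    [NormedSpace ℝ W] (B : V →L[ℝ] W) : (V × W) ≃L[ℝ] (V × W) :=
  ContinuousLinearEquiv.equivOfInverse
    ((ContinuousLinearMap.fst ℝ V W).prod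
      (ContinuousLinearMap.snd ℝ V W - B.comp (ContinuousLinearMap.fst ℝ V W)))
    ((ContinuousLinearMap.fst ℝ V W).prod
      (ContinuousLinearMap.snd ℝ V W + B.comp (ContinuousLinearMap.fst ℝ V W)))
    (fun _ => by simp) (fun _ => by simp)

theorem integralEq_eq_iff {f : E → E} (hf : Continuous f) (a : ℝ) (x : E) (γ : C(SymIcc, E)) :
    integralEq hf ((a, x), γ) = ((a, x), 0) ↔
      ∀ τ : SymIcc, γ τ = x + a • ∫ s in (0 : ℝ)..τ, f (extendIcc γ s) := by
  simp only [integralEq, Prod.mk.injEq, true_and, sub_eq_zero]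
  constructor
  · intro h τ
    exact congrFun (congrArg DFunLike.coe h) τ
  · intro h
    ext τ
    exact h τ

/-- At a = 0 the nonlinear term carries the factor a, so the derivative in the curve is the
identity. The full derivative is a shear, and the inverse function theorem applies. -/
theorem hasFDerivAt_integralEq {f : E → E} (hf : ContDiff ℝ ∞ f) (hc : HasCompactSupport f)
    (x₀ : E) : HasFDerivAt (integralEq hf.continuous)
      ((shearEquiv ((ContinuousLinearMap.const ℝ SymIcc : E →L[ℝ] C(SymIcc, E)).comp
        (ContinuousLinearMap.snd ℝ ℝ E) + (ContinuousLinearMap.fst ℝ ℝ E).smulRight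
          (volterra (superposition hf.continuous (ContinuousMap.const SymIcc x₀)))) :
        ((ℝ × E) × C(SymIcc, E)) ≃L[ℝ] ((ℝ × E) × C(SymIcc, E))) :
        ((ℝ × E) × C(SymIcc, E)) →L[ℝ] ((ℝ × E) × C(SymIcc, E)))
      ((0, x₀), ContinuousMap.const SymIcc x₀) := by
  set p₀ : (ℝ × E) × C(SymIcc, E) := ((0, x₀), ContinuousMap.const SymIcc x₀) with hp₀
  have hS := contDiff_superposition (K := SymIcc) hf hc
  have hvd : Differentiable ℝ (fun q : (ℝ × E) × C(SymIcc, E) =>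
      volterra (superposition hf.continuous q.2)) :=
    (volterra.contDiff.comp (hS.comp contDiff_snd)).differentiable (by simp)
  have hv := (hvd p₀).hasFDerivAt
  have ha : HasFDerivAt (fun q : (ℝ × E) × C(SymIcc, E) => q.1.1) _ p₀ :=
    (hasFDerivAt_fst (𝕜 := ℝ) (p := p₀.1)).comp p₀ hasFDerivAt_fst
  have hx : HasFDerivAt (fun q : (ℝ × E) × C(SymIcc, E) => ContinuousMap.const SymIcc q.1.2) _ p₀ :=
    (ContinuousLinearMap.const ℝ SymIcc : E →L[ℝ] C(SymIcc, E)).hasFDerivAt.comp p₀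
      ((hasFDerivAt_snd (𝕜 := ℝ) (p := p₀.1)).comp p₀ hasFDerivAt_fst)
  have h := (hasFDerivAt_fst (𝕜 := ℝ) (p := p₀)).prodMk
    ((hasFDerivAt_snd (𝕜 := ℝ) (p := p₀)).sub (hx.add (ha.smul hv)))
  refine h.congr_fderiv ?_
  ext q <;> simp [shearEquiv, hp₀]

/-- The local flow of a compactly supported smooth vector field. -/
theorem exists_flow_of_hasCompactSupport {f : E → E} (hf : ContDiff ℝ ∞ f)
    (hc : HasCompactSupport f) (x₀ : E) :
    ∃ Φ : ℝ × E → E, SmoothNear Φ (0, x₀) ∧ (∀ᶠ x in 𝓝 x₀, Φ (0, x) = x) ∧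
      ∀ᶠ q in 𝓝 ((0 : ℝ), x₀), HasDerivAt (fun t => Φ (t, q.2)) (f (Φ q)) q.1 := by
  set γ₀ := ContinuousMap.const SymIcc x₀ with hγ₀
  set p₀ : (ℝ × E) × C(SymIcc, E) := ((0, x₀), γ₀) with hp₀
  obtain ⟨e, hmem, -, hef, -, hsymm⟩ :=
    ((contDiff_integralEq hf hc).smoothNear p₀).exists_openPartialHomeomorph _
      (hasFDerivAt_integralEq hf hc x₀) univ_mem
  have hep₀ : e p₀ = ((0, x₀), 0) := by
    rw [hef, hp₀, integralEq_eq_iff]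
    intro τ; simp [hγ₀]
  -- `c (a, x)` is the curve on [-1, 1] with γ' = a f(γ) and γ(0) = x. It depends smoothly on (a,
  -- x), being read off from the local inverse.
  let c : ℝ × E → C(SymIcc, E) := fun q => (e.symm (q, 0)).2
  have htarget : ((0, x₀), 0) ∈ e.target := hep₀ ▸ e.map_source hmem
  have hcs : SmoothNear c (0, x₀) := by
    have h1 : SmoothNear (fun q : ℝ × E => e.symm (q, (0 : C(SymIcc, E)))) (0, x₀) :=
      (hsymm.smoothNear e.open_target htarget).comp
        (f := fun q : ℝ × E => (q, (0 : C(SymIcc, E))))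
        ((contDiff_id.prodMk contDiff_const).smoothNear _)
    exact (contDiff_snd.smoothNear _).comp h1
  have hc0 : c (0, x₀) = γ₀ := by
    change (e.symm ((0, x₀), 0)).2 = γ₀
    rw [← hep₀, e.left_inv hmem]
  -- a product neighbourhood contained in the source
  obtain ⟨V, hV, B, hB, hVB⟩ := mem_nhds_prod_iff.1 (e.open_source.mem_nhds hmem)
  obtain ⟨r, hr, hrB⟩ := Metric.mem_nhds_iff.1 hB
  have hgood : ∀ᶠ q in 𝓝 ((0 : ℝ), x₀), q ∈ V ∧ c q ∈ Metric.ball γ₀ r ∧ (q, 0) ∈ e.target ∧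
      dist (q.2) x₀ < r := by
    have h1 : Tendsto (fun q : ℝ × E => (q, (0 : C(SymIcc, E)))) (𝓝 (0, x₀)) (𝓝 ((0, x₀), 0)) :=
      Continuous.tendsto (by fun_prop) _
    have h2 : Tendsto c (𝓝 (0, x₀)) (𝓝 γ₀) := hc0 ▸ hcs.contDiffAt.continuousAt
    have h3 : Tendsto (fun q : ℝ × E => dist q.2 x₀) (𝓝 (0, x₀)) (𝓝 0) := by
      have : Continuous fun q : ℝ × E => dist q.2 x₀ := by fun_prop
      simpa using this.tendsto (0, x₀)
    exact (show ∀ᶠ q in 𝓝 ((0 : ℝ), x₀), q ∈ V from hV).and ((h2.eventually (Metric.ball_mem_nhds _ hr)).and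
      ((h1.eventually (e.open_target.mem_nhds htarget)).and (h3.eventually_lt_const hr)))
  have hsol : ∀ q, (q, 0) ∈ e.target → ∀ τ : SymIcc,
      c q τ = q.2 + q.1 • ∫ s in (0 : ℝ)..τ, f (extendIcc (c q) s) := by
    intro q hq
    have h1 : integralEq hf.continuous (e.symm (q, 0)) = (q, 0) := by
      rw [← hef, e.right_inv hq]
    have h2 : (e.symm (q, 0)) = (q, c q) := by
      refine Prod.ext ?_ rfl
      have := congrArg Prod.fst h1
      exact this
    rw [h2] at h1
    exact (integralEq_eq_iff _ _ _ _).1 h1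
  -- Local uniqueness costs nothing: `e` is injective on its source.
  have huniq : ∀ q ∈ V, ∀ γ ∈ Metric.ball γ₀ r,
      integralEq hf.continuous (q, γ) = (q, 0) → c q = γ := by
    intro q hq γ hγ h
    have hs : (q, γ) ∈ e.source := hVB ⟨hq, hrB hγ⟩
    change (e.symm (q, 0)).2 = γ
    rw [← h, ← hef, e.left_inv hs]
  obtain ⟨I, hI, U, hU, hIU⟩ := mem_nhds_prod_iff.1 hgood
  obtain ⟨ε', hε', hεI⟩ := Metric.mem_nhds_iff.1 hI
  obtain ⟨ε, hε0, hεε'⟩ := exists_between hε'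
  have hin : ∀ a : ℝ, |a| ≤ ε → a ∈ I := fun a ha => hεI (by
    rw [Metric.mem_ball, dist_zero_right]; exact ha.trans_lt hεε')
  -- Slowing the solution for ε down by the factor σ gives the solution for σε, by local uniqueness.
  -- Thus one curve `c (ε, x)` contains the flow for all times |t| ≤ ε.
  have hscale : ∀ x ∈ U, ∀ σ : SymIcc, ∀ τ : SymIcc,
      c (σ.1 * ε, x) τ = c (ε, x) ⟨σ.1 * τ.1, by
        rw [Set.mem_Icc, ← abs_le, abs_mul]
        exact mul_le_one₀ (abs_le.2 σ.2) (abs_nonneg _) (abs_le.2 τ.2)⟩ := by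
    intro x hx σ τ
    have hmul : ∀ τ : SymIcc, σ.1 * τ.1 ∈ SymIcc := fun τ => by
      rw [Set.mem_Icc, ← abs_le, abs_mul]
      exact mul_le_one₀ (abs_le.2 σ.2) (abs_nonneg _) (abs_le.2 τ.2)
    let δ : C(SymIcc, E) := (c (ε, x)).comp ⟨fun τ => ⟨σ.1 * τ.1, hmul τ⟩, by fun_prop⟩
    have g1 := hIU (Set.mk_mem_prod (hin ε (abs_of_pos hε0).le) hx)
    have g2 := hIU (Set.mk_mem_prod (hin (σ.1 * ε) (by
      rw [abs_mul, abs_of_pos hε0]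
      exact mul_le_of_le_one_left hε0.le (abs_le.2 σ.2))) hx)
    have hδ : δ ∈ Metric.ball γ₀ r := by
      rw [Metric.mem_ball, ContinuousMap.dist_lt_iff hr]
      intro τ
      exact (ContinuousMap.dist_apply_le_dist (f := c (ε, x)) (g := γ₀) ⟨σ.1 * τ.1, hmul τ⟩).trans_lt
        g1.2.1
    have := huniq _ g2.1 δ hδ ((integralEq_eq_iff _ _ _ _).2 fun τ => ?_)
    · rw [this]; rfl
    · have hs := hsol _ g1.2.2.1 ⟨σ.1 * τ.1, hmul τ⟩
      change c (ε, x) ⟨σ.1 * τ.1, hmul τ⟩ = _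
      rw [hs, mul_comm σ.1 ε, mul_smul]
      congr 2
      have hsub := intervalIntegral.smul_integral_comp_mul_left (a := 0) (b := τ.1)
        (fun s => f (extendIcc (c (ε, x)) s)) σ.1
      rw [mul_zero] at hsub
      rw [← hsub]
      congr 1
      refine intervalIntegral.integral_congr fun s hs => ?_
      have hs' : s ∈ SymIcc := by
        have h0 : (0 : ℝ) ∈ SymIcc := by constructor <;> norm_num
        exact Set.ordConnected_Icc.uIcc_subset h0 τ.2 hs
      rw [extendIcc_of_mem _ hs', extendIcc_of_mem _ (hmul ⟨s, hs'⟩)]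
      rfl
  have h1mem : (1 : ℝ) ∈ SymIcc := by constructor <;> norm_num
  -- The flow at time t is the endpoint at τ = 1 of the curve with speed factor t.
  refine ⟨fun q => c q ⟨1, h1mem⟩, ?_, ?_, ?_⟩
  · exact ((ContinuousMap.evalCLM ℝ (⟨1, h1mem⟩ : SymIcc) :
      C(SymIcc, E) →L[ℝ] E).contDiff.smoothNear _).comp hcs
  · filter_upwards [hU] with x hx
    have g := hIU (Set.mk_mem_prod (hin 0 (by simpa using hε0.le)) hx)
    have := hsol _ g.2.2.1 ⟨1, h1mem⟩
    simpa using this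
  · have hev : ∀ᶠ q in 𝓝 ((0 : ℝ), x₀), q.1 ∈ Metric.ball (0 : ℝ) ε ∧ q.2 ∈ U :=
      prod_mem_nhds (Metric.ball_mem_nhds _ hε0) hU
    filter_upwards [hev] with q hq
    rcases q with ⟨t, x⟩
    obtain ⟨ht, hx⟩ := hq
    simp only at ht hx
    -- After rescaling, s enters only through the upper limit of the integral, so the fundamental
    -- theorem of calculus gives the derivative.
    have hflow : ∀ s ∈ Metric.ball (0 : ℝ) ε,
        c (s, x) ⟨1, h1mem⟩ = x + ε • ∫ u in (0 : ℝ)..(s / ε), f (extendIcc (c (ε, x)) u) := by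
      intro s hs
      have hsε : s / ε ∈ SymIcc := by
        rw [Metric.mem_ball, dist_zero_right, Real.norm_eq_abs] at hs
        rw [Set.mem_Icc, ← abs_le, abs_div, abs_of_pos hε0, div_le_one hε0]
        exact hs.le
      have h := hscale x hx ⟨s / ε, hsε⟩ ⟨1, h1mem⟩
      simp only [div_mul_cancel₀ _ hε0.ne', mul_one] at h
      rw [h]
      exact hsol _ (hIU (Set.mk_mem_prod (hin ε (abs_of_pos hε0).le) hx)).2.2.1 _
    have hfc : Continuous fun u => f (extendIcc (c (ε, x)) u) :=
      hf.continuous.comp (continuous_extendIcc _)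
    have hd : HasDerivAt (fun s => x + ε • ∫ u in (0 : ℝ)..(s / ε), f (extendIcc (c (ε, x)) u))
        (f (extendIcc (c (ε, x)) (t / ε))) t := by
      have h1 := (hfc.integral_hasStrictDerivAt 0 (t / ε)).hasDerivAt
      have h2 := (h1.scomp t ((hasDerivAt_id t).div_const ε)).const_smul ε
      have h3 := h2.const_add x
      rw [smul_smul, mul_one_div_cancel hε0.ne', one_smul] at h3
      exact h3
    have hval : f (extendIcc (c (ε, x)) (t / ε)) = f (c (t, x) ⟨1, h1mem⟩) := by
      have htε : t / ε ∈ SymIcc := by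
        rw [Metric.mem_ball, dist_zero_right, Real.norm_eq_abs] at ht
        rw [Set.mem_Icc, ← abs_le, abs_div, abs_of_pos hε0, div_le_one hε0]
        exact ht.le
      have h := hscale x hx ⟨t / ε, htε⟩ ⟨1, h1mem⟩
      simp only [div_mul_cancel₀ _ hε0.ne', mul_one] at h
      rw [h, extendIcc_of_mem _ htε]
    rw [hval] at hd
    refine hd.congr_of_eventuallyEq ?_
    filter_upwards [Metric.isOpen_ball.mem_nhds ht] with s hs
    exact hflow s hs

/-- The local flow of a smooth vector field on a finite-dimensional space. -/
theorem SmoothNear.exists_flow [FiniteDimensional ℝ E] {f : E → E} {x₀ : E}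
    (hf : SmoothNear f x₀) :
    ∃ Φ : ℝ × E → E, SmoothNear Φ (0, x₀) ∧ (∀ᶠ x in 𝓝 x₀, Φ (0, x) = x) ∧
      ∀ᶠ q in 𝓝 ((0 : ℝ), x₀), HasDerivAt (fun t => Φ (t, q.2)) (f (Φ q)) q.1 := by
  obtain ⟨g, hg, hgc, hgf⟩ := hf.exists_cutoff
  obtain ⟨Φ, h1, h2, h3⟩ := exists_flow_of_hasCompactSupport hg hgc x₀
  refine ⟨Φ, h1, h2, ?_⟩
  have h4 : Tendsto Φ (𝓝 (0, x₀)) (𝓝 x₀) := by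
    have := h1.contDiffAt.continuousAt
    rwa [ContinuousAt, h2.self_of_nhds] at this
  filter_upwards [h3, h4.eventually hgf] with q hq hq'
  rwa [← hq']

/-- Local solutions of a smooth ordinary differential equation `y' = g(t, π, y)` depend smoothly on
the time, the parameters and the initial value. -/
theorem SmoothNear.exists_ode_solution {P : Type*} [NormedAddCommGroup P] [NormedSpace ℝ P]
    [FiniteDimensional ℝ P] [FiniteDimensional ℝ E] {g : ℝ × P × E → E} {t₀ : ℝ} {π₀ : P} {y₀ : E}
    (hg : SmoothNear g (t₀, π₀, y₀)) :
    ∃ Y : ℝ × P × E → E, SmoothNear Y (t₀, π₀, y₀) ∧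
      (∀ᶠ q in 𝓝 (π₀, y₀), Y (t₀, q) = q.2) ∧
      ∀ᶠ q in 𝓝 (t₀, π₀, y₀), HasDerivAt (fun t => Y (t, q.2)) (g (q.1, q.2.1, Y q)) q.1 := by
  have : CompleteSpace P := FiniteDimensional.complete ℝ P
  -- The equation is made autonomous by treating time and parameters as components of the state.
  have hf : SmoothNear (fun w : ℝ × P × E => ((1 : ℝ), (0 : P), g w)) (t₀, π₀, y₀) :=
    (smoothNear_const _ _).prodMk ((smoothNear_const _ _).prodMk hg)
  obtain ⟨Φ, h1, h2, h3⟩ := hf.exists_flow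
  let shift : ℝ × P × E → ℝ × (ℝ × P × E) := fun q => (q.1 - t₀, (t₀, q.2))
  have hshift : ContDiff ℝ ∞ shift := by unfold shift; fun_prop
  have hs0 : shift (t₀, π₀, y₀) = (0, (t₀, π₀, y₀)) := by simp [shift]
  have hst : Tendsto shift (𝓝 (t₀, π₀, y₀)) (𝓝 (0, (t₀, π₀, y₀))) :=
    hs0 ▸ hshift.continuous.tendsto _
  obtain ⟨I, hI, U, hU, hIU⟩ := mem_nhds_prod_iff.1 h3
  obtain ⟨ε, hε, hεI⟩ := Metric.mem_nhds_iff.1 hI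
  -- Along the flow the time component grows with unit speed and the parameter stays fixed.
  have hconst : ∀ w ∈ U, Φ (0, w) = w → ∀ t ∈ Metric.ball (0 : ℝ) ε,
      (Φ (t, w)).1 = w.1 + t ∧ (Φ (t, w)).2.1 = w.2.1 := by
    intro w hw hw0 t ht
    have hd : ∀ s ∈ Metric.ball (0 : ℝ) ε,
        HasDerivAt (fun t => Φ (t, w)) ((1 : ℝ), (0 : P), g (Φ (s, w))) s := fun s hs =>
      hIU (Set.mk_mem_prod (hεI hs) hw)
    have h0 : (0 : ℝ) ∈ Metric.ball (0 : ℝ) ε := Metric.mem_ball_self hε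
    constructor
    · have hd1 : ∀ s ∈ Metric.ball (0 : ℝ) ε, HasDerivAt (fun t => (Φ (t, w)).1 - t) 0 s := by
        intro s hs
        have h1 : HasDerivAt (fun t => (Φ (t, w)).1) 1 s :=
          (ContinuousLinearMap.fst ℝ ℝ (P × E)).hasFDerivAt.comp_hasDerivAt s (hd s hs)
        have : HasDerivAt (fun t => (Φ (t, w)).1 - t) (1 - 1) s := h1.sub (hasDerivAt_id' s)
        rwa [sub_self] at this
      have := Metric.isOpen_ball.is_const_of_deriv_eq_zero
        (convex_ball (0 : ℝ) ε).isPreconnected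
        (fun s hs => (hd1 s hs).differentiableAt.differentiableWithinAt)
        (fun s hs => (hd1 s hs).deriv) ht h0
      simp only [hw0, sub_zero] at this
      linarith
    · have hd1 : ∀ s ∈ Metric.ball (0 : ℝ) ε, HasDerivAt (fun t => (Φ (t, w)).2.1) 0 s := by
        intro s hs
        exact (hasFDerivAt_fst (𝕜 := ℝ)).comp_hasDerivAt s
          ((hasFDerivAt_snd (𝕜 := ℝ)).comp_hasDerivAt s (hd s hs))
      have := Metric.isOpen_ball.is_const_of_deriv_eq_zero
        (convex_ball (0 : ℝ) ε).isPreconnected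
        (fun s hs => (hd1 s hs).differentiableAt.differentiableWithinAt)
        (fun s hs => (hd1 s hs).deriv) ht h0
      simpa [hw0] using this
  refine ⟨fun q => (Φ (shift q)).2.2, ?_, ?_, ?_⟩
  · exact ((contDiff_snd.comp contDiff_snd).smoothNear _).comp
      (SmoothNear.comp (hs0.symm ▸ h1) (hshift.smoothNear _))
  · have : Tendsto (fun q : P × E => (t₀, q)) (𝓝 (π₀, y₀)) (𝓝 (t₀, π₀, y₀)) :=
      Continuous.tendsto (by fun_prop) _
    filter_upwards [this.eventually h2] with q hq
    simp [shift, hq]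
  · have hU' : ∀ᶠ w in 𝓝 (t₀, π₀, y₀), w ∈ U ∧ Φ (0, w) = w := (show ∀ᶠ w in _, w ∈ U from hU).and h2
    have h4 : Tendsto (fun q : ℝ × P × E => ((t₀, q.2) : ℝ × P × E)) (𝓝 (t₀, π₀, y₀))
        (𝓝 (t₀, π₀, y₀)) := by
      have : Continuous fun q : ℝ × P × E => ((t₀, q.2) : ℝ × P × E) := by fun_prop
      exact this.tendsto (t₀, π₀, y₀)
    have h5 : ∀ᶠ q : ℝ × P × E in 𝓝 (t₀, π₀, y₀), q.1 - t₀ ∈ Metric.ball (0 : ℝ) ε := by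
      have : Tendsto (fun q : ℝ × P × E => q.1 - t₀) (𝓝 (t₀, π₀, y₀)) (𝓝 0) := by
        have : Continuous fun q : ℝ × P × E => q.1 - t₀ := by fun_prop
        simpa using this.tendsto (t₀, π₀, y₀)
      exact this.eventually (Metric.ball_mem_nhds _ hε)
    filter_upwards [h4.eventually hU', h5] with q hq hq5
    obtain ⟨c1, c2⟩ := hconst _ hq.1 hq.2 _ hq5
    have hd : HasDerivAt (fun t => Φ (t, (t₀, q.2)))
        ((1 : ℝ), (0 : P), g (Φ (q.1 - t₀, (t₀, q.2)))) (q.1 - t₀) :=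
      hIU (Set.mk_mem_prod (hεI hq5) hq.1)
    have hd2 := (hasFDerivAt_snd (𝕜 := ℝ)).comp_hasDerivAt _
      ((hasFDerivAt_snd (𝕜 := ℝ)).comp_hasDerivAt _ hd)
    have hd3 := hd2.comp_sub_const q.1 t₀
    have e : Φ (q.1 - t₀, (t₀, q.2)) = (q.1, q.2.1, (Φ (shift q)).2.2) := by
      refine Prod.ext ?_ (Prod.ext ?_ rfl)
      · rw [c1]; ring
      · exact c2
    rw [e] at hd3
    exact hd3

end Flow

/-! ### Hadamard's lemma -/

section Hadamard

variable {A : Type} [NormedAddCommGroup A] [NormedSpace ℝ A] {ι : Type} [Fintype ι]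

/-- The segment `τ ↦ (a, τ η)`, depending linearly on `(a, η)`. -/
def fibreSegment : (A × (ι → ℝ)) →L[ℝ] C(SymIcc, A × (ι → ℝ)) :=
  LinearMap.mkContinuous
    { toFun := fun q => ⟨fun τ => (q.1, (τ : ℝ) • q.2), by fun_prop⟩
      map_add' := fun q r => by ext τ <;> simp
      map_smul' := fun c q => by ext τ <;> simp; ring } 1
    (fun q => by
      rw [one_mul, ContinuousMap.norm_le _ (norm_nonneg _)]
      intro τ
      refine max_le (le_max_left _ _) ?_
      change ‖(τ : ℝ) • q.2‖ ≤ _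
      rw [norm_smul]
      exact (mul_le_of_le_one_left (norm_nonneg _) (abs_le.2 τ.2)).trans (le_max_right _ _))

/-- F(a, η) - F(a, 0) is the integral over τ ∈ [0, 1] of ∑ ∂_i F(a, τη) η_i. The coefficients are
smooth because they arise from the linear segment map, a superposition operator, the Volterra
operator and an evaluation. -/
theorem SmoothNear.hadamard [FiniteDimensional ℝ A] {F : A × (ι → ℝ) → ℝ} {a : A}
    (hF : SmoothNear F (a, 0)) :
    ∃ h : ι → A × (ι → ℝ) → ℝ, (∀ i, SmoothNear (h i) (a, 0)) ∧
      ∀ᶠ q in 𝓝 (a, (0 : ι → ℝ)), F q = F (q.1, 0) + ∑ i, h i q * q.2 i := by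
  classical
  obtain ⟨g, hg, hgc, hgF⟩ := hF.exists_cutoff
  let D : ι → A × (ι → ℝ) → ℝ := fun i q => fderiv ℝ g q (0, Pi.single i 1)
  have hD : ∀ i, ContDiff ℝ ∞ (D i) := fun i =>
    (hg.fderiv_right (m := ∞) (by simp)).clm_apply contDiff_const
  have hDc : ∀ i, HasCompactSupport (D i) := fun i => hgc.fderiv_apply ℝ _
  have h1mem : (1 : ℝ) ∈ SymIcc := by constructor <;> norm_num
  have h0mem : (0 : ℝ) ∈ SymIcc := by constructor <;> norm_num
  let h : ι → A × (ι → ℝ) → ℝ := fun i q =>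
    volterra (superposition (hD i).continuous (fibreSegment q)) ⟨1, h1mem⟩
  refine ⟨h, fun i => ?_, ?_⟩
  · refine ContDiff.smoothNear ?_ _
    exact (ContinuousMap.evalCLM ℝ (⟨1, h1mem⟩ : SymIcc) : C(SymIcc, ℝ) →L[ℝ] ℝ).contDiff.comp
      (volterra.contDiff.comp
        ((contDiff_superposition (hD i) (hDc i)).comp fibreSegment.contDiff))
  · have hglob : ∀ q : A × (ι → ℝ), g q = g (q.1, 0) + ∑ i, h i q * q.2 i := by
      intro q
      have hd : ∀ s : ℝ, HasDerivAt (fun t : ℝ => g (q.1, t • q.2))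
          (∑ i, D i (q.1, s • q.2) * q.2 i) s := by
        intro s
        have h1 : HasDerivAt (fun t : ℝ => ((q.1, t • q.2) : A × (ι → ℝ))) (0, (1 : ℝ) • q.2) s :=
          (hasDerivAt_const s q.1).prodMk ((hasDerivAt_id s).smul_const q.2)
        have h2 := ((hg.differentiable (by simp)) (q.1, s • q.2)).hasFDerivAt.comp_hasDerivAt s h1
        refine h2.congr_deriv ?_
        have hv : ((0 : A), (1 : ℝ) • q.2) = ∑ i, q.2 i • ((0 : A), (Pi.single i (1 : ℝ) : ι → ℝ)) := by
          refine Prod.ext ?_ ?_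
          · simp [Prod.fst_sum]
          · ext j; simp [Prod.snd_sum, Finset.sum_apply, Pi.single_apply]
        rw [hv, map_sum]
        refine Finset.sum_congr rfl fun i _ => ?_
        rw [map_smul, smul_eq_mul, mul_comm]
      have hcont : Continuous fun s : ℝ => ∑ i, D i (q.1, s • q.2) * q.2 i := by
        refine continuous_finsetSum _ fun i _ => ?_
        have := (hD i).continuous
        fun_prop
      have hftc := intervalIntegral.integral_eq_sub_of_hasDerivAt (a := 0) (b := 1)
        (fun s _ => hd s) (hcont.intervalIntegrable _ _)
      rw [one_smul, zero_smul] at hftc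
      have hh : ∀ i, h i q = ∫ s in (0 : ℝ)..1, D i (q.1, s • q.2) := by
        intro i
        refine intervalIntegral.integral_congr fun s hs => ?_
        have hs' : s ∈ SymIcc := Set.ordConnected_Icc.uIcc_subset h0mem h1mem hs
        rw [extendIcc_of_mem _ hs']
        rfl
      rw [intervalIntegral.integral_finsetSum] at hftc
      · simp only [intervalIntegral.integral_mul_const] at hftc
        simp only [hh, hftc]
        ring
      · intro i _
        have := (hD i).continuous
        exact Continuous.intervalIntegrable (by fun_prop) _ _
    have ht : Tendsto (fun q : A × (ι → ℝ) => ((q.1, 0) : A × (ι → ℝ))) (𝓝 (a, 0)) (𝓝 (a, 0)) := by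
      have : Continuous fun q : A × (ι → ℝ) => ((q.1, 0) : A × (ι → ℝ)) := by fun_prop
      exact this.tendsto (a, 0)
    filter_upwards [hgF, ht.eventually hgF] with q h1 h2
    rw [← h1, ← h2]
    exact hglob q

end Hadamard

/-! ### Smooth combinations of functions -/

section InIdeal

variable {E E' : Type*} [NormedAddCommGroup E] [NormedSpace ℝ E] [NormedAddCommGroup E']
  [NormedSpace ℝ E'] {ι κ : Type*} [Fintype ι] [Fintype κ]

/-- Near `x`, the function `h` is a linear combination of the `F i` with smooth coefficients. -/
def InIdeal (F : ι → E → ℝ) (h : E → ℝ) (x : E) : Prop :=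
  ∃ G : ι → E → ℝ, (∀ i, SmoothNear (G i) x) ∧ h =ᶠ[𝓝 x] fun y => ∑ i, G i y * F i y

variable {F : ι → E → ℝ} {x : E}

theorem InIdeal.congr {h h' : E → ℝ} (hh : InIdeal F h x) (e : h =ᶠ[𝓝 x] h') : InIdeal F h' x := by
  obtain ⟨G, hG, hsum⟩ := hh
  exact ⟨G, hG, e.symm.trans hsum⟩

theorem inIdeal_self (i : ι) : InIdeal F (F i) x := by
  classical
  refine ⟨fun j _ => if j = i then 1 else 0, fun j => smoothNear_const _ _,
    Eventually.of_forall fun y => ?_⟩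
  simp

theorem InIdeal.add {h h' : E → ℝ} (hh : InIdeal F h x) (hh' : InIdeal F h' x) :
    InIdeal F (fun y => h y + h' y) x := by
  obtain ⟨G, hG, hs⟩ := hh
  obtain ⟨G', hG', hs'⟩ := hh'
  refine ⟨fun i y => G i y + G' i y, fun i => (hG i).add (hG' i), ?_⟩
  filter_upwards [hs, hs'] with y h1 h2
  rw [h1, h2, ← Finset.sum_add_distrib]
  exact Finset.sum_congr rfl fun i _ => by ring

theorem InIdeal.mul_left {h c : E → ℝ} (hc : SmoothNear c x) (hh : InIdeal F h x) :
    InIdeal F (fun y => c y * h y) x := by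
  obtain ⟨G, hG, hs⟩ := hh
  refine ⟨fun i y => c y * G i y, fun i => hc.mul (hG i), ?_⟩
  filter_upwards [hs] with y h1
  rw [h1, Finset.mul_sum]
  exact Finset.sum_congr rfl fun i _ => by ring

theorem InIdeal.sub {h h' : E → ℝ} (hh : InIdeal F h x) (hh' : InIdeal F h' x) :
    InIdeal F (fun y => h y - h' y) x :=
  (hh.add (hh'.mul_left (smoothNear_const (-1) x))).congr
    (Eventually.of_forall fun y => by ring)

theorem inIdeal_zero : InIdeal F (fun _ => 0) x :=
  ⟨fun _ _ => 0, fun _ => smoothNear_const _ _, Eventually.of_forall fun _ => by simp⟩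

theorem InIdeal.sum {τ : Type*} {s : Finset τ} {h : τ → E → ℝ}
    (hh : ∀ t ∈ s, InIdeal F (h t) x) : InIdeal F (fun y => ∑ t ∈ s, h t y) x := by
  classical
  induction s using Finset.induction_on with
  | empty => simpa using inIdeal_zero
  | insert a s ha ih =>
    simp only [Finset.sum_insert ha]
    exact (hh a (Finset.mem_insert_self _ _)).add
      (ih fun t ht => hh t (Finset.mem_insert_of_mem ht))

theorem InIdeal.trans {F' : κ → E → ℝ} {h : E → ℝ} (hh : InIdeal F h x)
    (hF : ∀ i, InIdeal F' (F i) x) : InIdeal F' h x := by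
  obtain ⟨G, hG, hs⟩ := hh
  exact (InIdeal.sum fun i _ => (hF i).mul_left (hG i)).congr hs.symm

theorem InIdeal.comp {h : E → ℝ} {φ : E' → E} {x' : E'} (hh : InIdeal F h (φ x'))
    (hφ : SmoothNear φ x') : InIdeal (fun i y => F i (φ y)) (fun y => h (φ y)) x' := by
  obtain ⟨G, hG, hs⟩ := hh
  exact ⟨fun i y => G i (φ y), fun i => (hG i).comp hφ,
    hφ.contDiffAt.continuousAt.eventually hs⟩

/-- A generator that does not vanish at `x` is a unit, so the ideal contains every smooth germ. This
settles points that do not satisfy the system. -/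
theorem inIdeal_of_ne_zero {h : E → ℝ} {i : ι} (hi : SmoothNear (F i) x) (h0 : F i x ≠ 0)
    (hh : SmoothNear h x) : InIdeal F h x := by
  refine ((inIdeal_self i).mul_left (hh.mul (hi.inv h0))).congr ?_
  filter_upwards [hi.contDiffAt.continuousAt.eventually_ne h0] with y hy
  field_simp

end InIdeal

/-! ### Functions vanishing on the zero set of a system of maximal rank -/

section MaximalRank

/-- A proper range would be annihilated by a non-zero functional, whose coefficients give a linear
relation among the `L i`. -/
theorem ContinuousLinearMap.range_pi_eq_top_of_linearIndependent {E : Type*}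
    [NormedAddCommGroup E] [NormedSpace ℝ E] {ι : Type*} [Fintype ι] {L : ι → E →L[ℝ] ℝ}
    (hL : LinearIndependent ℝ L) : (ContinuousLinearMap.pi L).range = ⊤ := by
  classical
  by_contra hne
  obtain ⟨f, hf0, hf⟩ := Submodule.exists_le_ker_of_lt_top _ (lt_top_iff_ne_top.2 hne)
  refine hf0 ?_
  have hfe : ∀ w : ι → ℝ, f w = ∑ i, w i * f (Pi.single i 1) := by
    intro w
    conv_lhs => rw [show w = ∑ i, w i • (Pi.single i 1 : ι → ℝ) by
      ext j; simp [Finset.sum_apply, Pi.single_apply]]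
    simp
  have h0 : ∑ i, f (Pi.single i 1) • L i = 0 := by
    ext v
    have h1 : f (ContinuousLinearMap.pi L v) = 0 := hf ⟨v, rfl⟩
    rw [hfe] at h1
    simpa [mul_comm] using h1
  have h2 := Fintype.linearIndependent_iff.1 hL _ h0
  ext i
  simpa using h2 i

/-- By the inverse function theorem the `F i` can be completed to local coordinates. In these the
zero set is η = 0, and Hadamard's lemma writes a function vanishing there as ∑ c_i η_i. -/
theorem inIdeal_of_linearIndependent {E : Type} [NormedAddCommGroup E] [NormedSpace ℝ E]
    [FiniteDimensional ℝ E] {ι : Type} [Fintype ι] {F : ι → E → ℝ} {x : E} {h : E → ℝ}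
    (hF : ∀ i, SmoothNear (F i) x) (h0 : ∀ i, F i x = 0)
    (hli : LinearIndependent ℝ fun i => fderiv ℝ (F i) x) (hh : SmoothNear h x)
    (hvan : ∀ᶠ y in 𝓝 x, (∀ i, F i y = 0) → h y = 0) : InIdeal F h x := by
  have : CompleteSpace E := FiniteDimensional.complete ℝ E
  set L : E →L[ℝ] (ι → ℝ) := ContinuousLinearMap.pi fun i => fderiv ℝ (F i) x with hL
  have hLr : L.range = ⊤ := ContinuousLinearMap.range_pi_eq_top_of_linearIndependent hli
  -- A projection onto the common kernel of the differentials supplies the complementary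
  -- coordinates.
  obtain ⟨π, hπ⟩ := L.ker_closedComplemented_of_finiteDimensional_range
  have hcompl : IsCompl π.ker L.ker := (LinearMap.isCompl_of_proj hπ).symm
  have hπr : π.range = ⊤ := LinearMap.range_eq_top.2 fun k => ⟨k, hπ k⟩
  let T := π.equivProdOfSurjectiveOfIsCompl L hπr hLr hcompl
  let Ψ : E → L.ker × (ι → ℝ) := fun y => (π y, fun i => F i y)
  have hΨ : SmoothNear Ψ x := (π.contDiff.smoothNear x).prodMk (smoothNear_pi hF)
  have hΨ' : HasFDerivAt Ψ (T : E →L[ℝ] L.ker × (ι → ℝ)) x := by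
    have h1 : HasFDerivAt (fun y i => F i y) L x :=
      hasFDerivAt_pi.2 fun i => ((hF i).contDiffAt.differentiableAt (by simp)).hasFDerivAt
    exact (π.hasFDerivAt.prodMk h1)
  obtain ⟨e, hxe, -, heΨ, -, hes⟩ := hΨ.exists_openPartialHomeomorph T hΨ' univ_mem
  have hex : e x = (π x, 0) := by
    rw [heΨ]; exact Prod.ext rfl (funext h0)
  have ht : (π x, (0 : ι → ℝ)) ∈ e.target := hex ▸ e.map_source hxe
  have hsx : e.symm (π x, 0) = x := by rw [← hex, e.left_inv hxe]
  have hsm : SmoothNear e.symm (π x, 0) := hes.smoothNear e.open_target ht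
  have hH : SmoothNear (fun q => h (e.symm q)) (π x, 0) := SmoothNear.comp (hsx.symm ▸ hh) hsm
  obtain ⟨c, hc, hsum⟩ := hH.hadamard
  refine ⟨fun i y => c i (Ψ y), fun i => SmoothNear.comp (by
    have : Ψ x = (π x, 0) := by rw [← heΨ, hex]
    rw [this]; exact hc i) hΨ, ?_⟩
  have hzero : ∀ᶠ q in 𝓝 (π x, (0 : ι → ℝ)), h (e.symm (q.1, 0)) = 0 := by
    have h1 : Tendsto (fun q : L.ker × (ι → ℝ) => ((q.1, 0) : L.ker × (ι → ℝ)))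
        (𝓝 (π x, 0)) (𝓝 (π x, 0)) := by
      have : Continuous fun q : L.ker × (ι → ℝ) => ((q.1, 0) : L.ker × (ι → ℝ)) := by fun_prop
      exact this.tendsto (π x, 0)
    have h2 : Tendsto e.symm (𝓝 (π x, 0)) (𝓝 x) := by
      have := hsm.contDiffAt.continuousAt
      rwa [ContinuousAt, hsx] at this
    have h3 : ∀ᶠ q in 𝓝 (π x, (0 : ι → ℝ)), q ∈ e.target := e.open_target.mem_nhds ht
    filter_upwards [h1.eventually (h2.eventually hvan), h1.eventually h3] with q hq hq3
    refine hq fun i => ?_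
    have := e.right_inv hq3
    rw [heΨ] at this
    exact congrFun (congrArg Prod.snd this) i
  have hΨt : Tendsto Ψ (𝓝 x) (𝓝 (π x, 0)) := by
    have := hΨ.contDiffAt.continuousAt
    rwa [ContinuousAt, ← heΨ x, hex] at this
  filter_upwards [hΨt.eventually (hsum.and hzero), e.open_source.mem_nhds hxe] with y hy hys
  have hsy : e.symm (Ψ y) = y := by rw [← heΨ, e.left_inv hys]
  have h1 := hy.1
  rw [hy.2, hsy, zero_add] at h1
  exact h1

end MaximalRank

/-! ### The coefficients of the prolongation -/

namespace ProjectableField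

variable {p m : ℕ} (X : ProjectableField p)

theorem contDiffAt_ξ {q : Vec p × ℝ} (hq : q ∈ X.dom) : ContDiffAt ℝ ∞ X.ξ q.1 :=
  X.smooth_ξ.contDiffAt ((isOpenMap_fst _ X.isOpen_dom).mem_nhds ⟨q, hq, rfl⟩)

theorem contDiffAt_φ {q : Vec p × ℝ} (hq : q ∈ X.dom) : ContDiffAt ℝ ∞ X.φ q :=
  X.smooth_φ.contDiffAt (X.isOpen_dom.mem_nhds hq)

theorem side_eq_sum (f : Vec p → ℝ) :
    X.side f = fun x => ∑ i, X.ξ x i * dirDeriv (Pi.single i 1) f x - X.φ (x, f x) := by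
  ext x
  rw [← dirDeriv_eq_sum]; rfl

theorem contDiffAt_side {f : Vec p → ℝ} {x : Vec p} (hf : ContDiffAt ℝ ∞ f x)
    (hx : (x, f x) ∈ X.dom) : ContDiffAt ℝ ∞ (X.side f) x := by
  rw [side_eq_sum]
  refine ContDiffAt.sub (ContDiffAt.sum fun i _ => ?_) ?_
  · exact (contDiffAt_pi.1 (X.contDiffAt_ξ hx) i).mul (hf.dirDeriv _)
  · exact ContDiffAt.comp x (X.contDiffAt_φ hx) (contDiffAt_id.prodMk hf)

/-- The expression `D_α (φ - ξ_i u_i) + ξ_i u_{α,i}` depends only on derivatives of order at most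
`m`. -/
theorem coef_congr {f g : Vec p → ℝ} {x : Vec p} (hf : ContDiffAt ℝ ∞ f x)
    (hg : ContDiffAt ℝ ∞ g x) (hx : (x, f x) ∈ X.dom) (hfg : jet m f x = jet m g x)
    (α : MIdx p m) :
    - pderiv α.1 (X.side f) x + ∑ i, X.ξ x i * pderiv (α.1 + Pi.single i 1) f x
      = - pderiv α.1 (X.side g) x + ∑ i, X.ξ x i * pderiv (α.1 + Pi.single i 1) g x := by
  have hval : f x = g x := by rw [← jet_val (m := m) f x, hfg, jet_val]
  have hxg : (x, g x) ∈ X.dom := hval ▸ hx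
  have hflat := (jet_eq_iff_flatAt hf hg).1 hfg
  have hφ : FlatAt (m + 1) (fun y => X.φ (y, f y) - X.φ (y, g y)) x :=
    hflat.superpose hval hf.continuousAt hg.continuousAt (X.contDiffAt_φ hx)
  have hh : ContDiffAt ℝ ∞ (fun y => f y - g y) x := hf.sub hg
  have hξ : ∀ i, ContDiffAt ℝ ∞ (fun y => X.ξ y i) x := contDiffAt_pi.1 (X.contDiffAt_ξ hx)
  have hdi : ∀ i, FlatAt m (dirDeriv (Pi.single i 1) fun y => f y - g y) x := by
    intro i
    refine flatAt_of_pderiv_eq_zero (hh.dirDeriv _) fun β hβ => ?_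
    rw [← (pderiv_add_single' hh β i).self_of_nhds]
    refine hflat.pderiv_eq_zero hh ?_
    simp [Finset.sum_add_distrib]
    exact hβ
  -- This is where the derivatives of order m + 1 cancel: first derivatives agree only to order m,
  -- but the factor ξ_i(y) - ξ_i(x) vanishes at x and restores the missing order.
  have hξd : ∀ i, FlatAt (m + 1)
      (fun y => (X.ξ y i - X.ξ x i) * dirDeriv (Pi.single i 1) (fun y => f y - g y) y) x := by
    intro i
    have h1 : FlatAt 1 (fun y => X.ξ y i - X.ξ x i) x :=
      flatAt_one_of_differentiableAt (((hξ i).differentiableAt (by simp)).sub_const _) (by simp)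
    have := h1.mul (hdi i)
    rwa [add_comm] at this
  have hsf := X.contDiffAt_side hf hx
  have hsg := X.contDiffAt_side hg hxg
  have hT : ∀ i, ContDiffAt ℝ ∞
      (fun y => X.ξ x i * dirDeriv (Pi.single i 1) (fun y => f y - g y) y) x := fun i =>
    contDiffAt_const.mul (hh.dirDeriv _)
  have hTs : ContDiffAt ℝ ∞
      (fun y => ∑ i, X.ξ x i * dirDeriv (Pi.single i 1) (fun y => f y - g y) y) x :=
    ContDiffAt.sum fun i _ => hT i
  have hmain : FlatAt (m + 1) (fun y => (X.side f y - X.side g y)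
      - ∑ i, X.ξ x i * dirDeriv (Pi.single i 1) (fun y => f y - g y) y) x := by
    refine ((FlatAt.sum fun i (_ : i ∈ Finset.univ) => hξd i).sub hφ).congr ?_
    filter_upwards [hf.eventually_differentiableAt, hg.eventually_differentiableAt] with y h1 h2
    have : ∀ i, dirDeriv (Pi.single i 1) (fun y => f y - g y) y
        = dirDeriv (Pi.single i 1) f y - dirDeriv (Pi.single i 1) g y := by
      intro i; simp [dirDeriv, fderiv_fun_sub h1 h2]
    simp only [side_eq_sum, this, sub_mul, mul_sub, Finset.sum_sub_distrib]
    ring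
  have h0 := hmain.pderiv_eq_zero ((hsf.sub hsg).sub hTs) (Nat.lt_succ_iff.2 α.2)
  rw [pderiv_sub_at (hsf.sub hsg) hTs, pderiv_sub_at hsf hsg, pderiv_sum_at fun i _ => hT i] at h0
  have h1 : ∀ i, pderiv α.1 (fun y => X.ξ x i * dirDeriv (Pi.single i 1) (fun y => f y - g y) y) x
      = X.ξ x i * pderiv (α.1 + Pi.single i 1) f x
        - X.ξ x i * pderiv (α.1 + Pi.single i 1) g x := by
    intro i
    rw [pderiv_const_mul_at (hh.dirDeriv _), ← (pderiv_add_single' hh α.1 i).self_of_nhds,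
      pderiv_sub_at hf hg, mul_sub]
  simp only [h1, Finset.sum_sub_distrib] at h0
  linarith

end ProjectableField

/-! ### Change of variables on functions -/

theorem continuous_jet_val {p m : ℕ} : Continuous fun θ : Jet p m => θ.val := by
  unfold Jet.val; fun_prop

namespace AdaptedChart

variable {n m : ℕ} {X : ProjectableField (n + 1)} (C : AdaptedChart X)

theorem contDiffAt_total {q : Vec (n + 1) × ℝ} (hq : q ∈ C.total.source) :
    ContDiffAt ℝ ∞ C.total q :=
  C.smooth_total.contDiffAt (C.total.open_source.mem_nhds hq)

theorem contDiffAt_total_symm {q : Vec (n + 1) × ℝ} (hq : q ∈ C.total.target) :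
    ContDiffAt ℝ ∞ C.total.symm q :=
  C.smooth_total_symm.contDiffAt (C.total.open_target.mem_nhds hq)

theorem contDiffAt_base {x : Vec (n + 1)} (hx : x ∈ C.base.source) : ContDiffAt ℝ ∞ C.base x :=
  C.smooth_base.contDiffAt (C.base.open_source.mem_nhds hx)

theorem contDiffAt_base_symm {x : Vec (n + 1)} (hx : x ∈ C.base.target) :
    ContDiffAt ℝ ∞ C.base.symm x :=
  C.smooth_base_symm.contDiffAt (C.base.open_target.mem_nhds hx)

theorem total_symm_fst {r : Vec (n + 1) × ℝ} (hr : r ∈ C.total.target) :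
    r.1 ∈ C.base.target ∧ (C.total.symm r).1 = C.base.symm r.1 := by
  have h1 := C.total.map_target hr
  have h2 := C.fst_eq _ h1
  rw [C.total.right_inv hr] at h2
  have h3 := C.fst_mem _ h1
  rw [h2]
  exact ⟨C.base.map_source h3, (C.base.left_inv h3).symm⟩

theorem total_eq {f : Vec (n + 1) → ℝ} {x : Vec (n + 1)} (hx : (x, f x) ∈ C.total.source) :
    C.total (x, f x) = (C.base x, C.push f (C.base x)) := by
  refine Prod.ext (C.fst_eq _ hx) ?_
  rw [push, C.base.left_inv (C.fst_mem _ hx)]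

theorem total_symm_eq {g : Vec (n + 1) → ℝ} {x : Vec (n + 1)} (hx : x ∈ C.base.source)
    (hg : (C.base x, g (C.base x)) ∈ C.total.target) :
    C.total.symm (C.base x, g (C.base x)) = (x, C.pull g x) := by
  refine Prod.ext ?_ rfl
  rw [(C.total_symm_fst hg).2, C.base.left_inv hx]

theorem graph_push_mem {f : Vec (n + 1) → ℝ} {x : Vec (n + 1)}
    (hx : (x, f x) ∈ C.total.source) : (C.base x, C.push f (C.base x)) ∈ C.total.target :=
  C.total_eq hx ▸ C.total.map_source hx

theorem graph_pull_mem {g : Vec (n + 1) → ℝ} {x : Vec (n + 1)} (hx : x ∈ C.base.source)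
    (hg : (C.base x, g (C.base x)) ∈ C.total.target) : (x, C.pull g x) ∈ C.total.source :=
  C.total_symm_eq hx hg ▸ C.total.map_target hg

theorem contDiffAt_push {f : Vec (n + 1) → ℝ} {x : Vec (n + 1)} (hf : ContDiffAt ℝ ∞ f x)
    (hx : (x, f x) ∈ C.total.source) : ContDiffAt ℝ ∞ (C.push f) (C.base x) := by
  have hb := C.fst_mem _ hx
  have hbi : C.base.symm (C.base x) = x := C.base.left_inv hb
  have h1 := C.contDiffAt_base_symm (C.base.map_source hb)
  have h2 : ContDiffAt ℝ ∞ (fun x => C.total (x, f x)) (C.base.symm (C.base x)) := by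
    rw [hbi]
    exact ContDiffAt.comp x (C.contDiffAt_total hx) (contDiffAt_id.prodMk hf)
  exact contDiffAt_snd.comp _ (h2.comp _ h1)

theorem contDiffAt_pull {g : Vec (n + 1) → ℝ} {x : Vec (n + 1)}
    (hg : ContDiffAt ℝ ∞ g (C.base x)) (hx : x ∈ C.base.source)
    (hgx : (C.base x, g (C.base x)) ∈ C.total.target) : ContDiffAt ℝ ∞ (C.pull g) x := by
  have h1 := C.contDiffAt_base hx
  have h2 : ContDiffAt ℝ ∞ (fun y => C.total.symm (y, g y)) (C.base x) :=
    ContDiffAt.comp _ (C.contDiffAt_total_symm hgx) (contDiffAt_id.prodMk hg)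
  exact contDiffAt_snd.comp _ (h2.comp _ h1)

theorem pull_push_apply {f : Vec (n + 1) → ℝ} {x : Vec (n + 1)}
    (hx : (x, f x) ∈ C.total.source) : C.pull (C.push f) x = f x := by
  rw [pull, ← C.total_eq hx, C.total.left_inv hx]

theorem pull_push {f : Vec (n + 1) → ℝ} {x : Vec (n + 1)} (hf : ContinuousAt f x)
    (hx : (x, f x) ∈ C.total.source) : C.pull (C.push f) =ᶠ[𝓝 x] f := by
  have h : Tendsto (fun y => (y, f y)) (𝓝 x) (𝓝 (x, f x)) := continuousAt_id.prodMk hf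
  filter_upwards [h.eventually (C.total.open_source.mem_nhds hx)] with y hy
  exact C.pull_push_apply hy

theorem push_pull {g : Vec (n + 1) → ℝ} {y : Vec (n + 1)} (hg : ContinuousAt g y)
    (hy : (y, g y) ∈ C.total.target) : C.push (C.pull g) =ᶠ[𝓝 y] g := by
  have h : Tendsto (fun y => (y, g y)) (𝓝 y) (𝓝 (y, g y)) := continuousAt_id.prodMk hg
  filter_upwards [h.eventually (C.total.open_target.mem_nhds hy)] with z hz
  have h1 := (C.total_symm_fst hz).1
  have h2 := C.base.map_target h1
  have h3 : (C.base (C.base.symm z), g (C.base (C.base.symm z))) ∈ C.total.target := by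
    rwa [C.base.right_inv h1]
  rw [push, ← C.total_symm_eq h2 h3, C.base.right_inv h1, C.total.right_inv hz]

/-- Contact of order m + 1 is preserved by inserting the functions into v(x, u) and by the change of
base variables. -/
theorem jet_push_congr {f g : Vec (n + 1) → ℝ} {x : Vec (n + 1)} (hf : ContDiffAt ℝ ∞ f x)
    (hg : ContDiffAt ℝ ∞ g x) (hx : (x, f x) ∈ C.total.source) (hfg : jet m f x = jet m g x) :
    jet m (C.push f) (C.base x) = jet m (C.push g) (C.base x) := by
  have hval : f x = g x := by rw [← jet_val (m := m) f x, hfg, jet_val]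
  have hb := C.fst_mem _ hx
  have hbi : C.base.symm (C.base x) = x := C.base.left_inv hb
  rw [jet_eq_iff_flatAt (C.contDiffAt_push hf hx) (C.contDiffAt_push hg (hval ▸ hx))]
  have h := ((jet_eq_iff_flatAt hf hg).1 hfg).superpose (Φ := fun q => (C.total q).2) hval
    hf.continuousAt hg.continuousAt (contDiffAt_snd.comp _ (C.contDiffAt_total hx))
  rw [← hbi] at h
  exact h.comp ((C.contDiffAt_base_symm (C.base.map_source hb)).differentiableAt (by simp))

theorem jet_pull_congr {f g : Vec (n + 1) → ℝ} {y : Vec (n + 1)} (hf : ContDiffAt ℝ ∞ f y)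
    (hg : ContDiffAt ℝ ∞ g y) (hy : (y, f y) ∈ C.total.target) (hfg : jet m f y = jet m g y) :
    jet m (C.pull f) (C.base.symm y) = jet m (C.pull g) (C.base.symm y) := by
  have hval : f y = g y := by rw [← jet_val (m := m) f y, hfg, jet_val]
  have hyt := (C.total_symm_fst hy).1
  have hb := C.base.map_target hyt
  have hbi : C.base (C.base.symm y) = y := C.base.right_inv hyt
  rw [jet_eq_iff_flatAt (C.contDiffAt_pull (hbi.symm ▸ hf) hb (hbi.symm ▸ hy))
    (C.contDiffAt_pull (hbi.symm ▸ hg) hb (hbi.symm ▸ hval ▸ hy))]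
  have h := ((jet_eq_iff_flatAt hf hg).1 hfg).superpose (Φ := fun q => (C.total.symm q).2) hval
    hf.continuousAt hg.continuousAt (contDiffAt_snd.comp _ (C.contDiffAt_total_symm hy))
  rw [← hbi] at h
  exact h.comp ((C.contDiffAt_base hb).differentiableAt (by simp))

/-! ### Change of variables on jets -/

/-- The jets over the domain of the chart. -/
def jetSource (m : ℕ) : Set (Jet (n + 1) m) := {θ | (θ.1, θ.val) ∈ C.total.source}

/-- The adapted jets over the range of the chart. -/
def jetTarget (m : ℕ) : Set (Jet (n + 1) m) := {θ | (θ.1, θ.val) ∈ C.total.target}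

theorem isOpen_jetSource : IsOpen (C.jetSource m) :=
  C.total.open_source.preimage (continuous_fst.prodMk continuous_jet_val)

theorem isOpen_jetTarget : IsOpen (C.jetTarget m) :=
  C.total.open_target.preimage (continuous_fst.prodMk continuous_jet_val)

/-- The Taylor polynomial in the definition of `jetMap` may be replaced by any function with the
same jet. -/
theorem jetMap_jet {f : Vec (n + 1) → ℝ} {x : Vec (n + 1)} (hf : ContDiffAt ℝ ∞ f x)
    (hx : (x, f x) ∈ C.total.source) :
    C.jetMap (jet m f x) = jet m (C.push f) (C.base x) := by
  refine C.jet_push_congr (contDiff_taylor _).contDiffAt hf ?_ (jet_taylor _)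
  have := taylor_self (jet m f x)
  rw [jet_val] at this
  change (x, taylor (jet m f x) (jet m f x).1) ∈ _
  rwa [this]

theorem jetMapInv_jet {g : Vec (n + 1) → ℝ} {y : Vec (n + 1)} (hg : ContDiffAt ℝ ∞ g y)
    (hy : (y, g y) ∈ C.total.target) :
    C.jetMapInv (jet m g y) = jet m (C.pull g) (C.base.symm y) := by
  refine C.jet_pull_congr (contDiff_taylor _).contDiffAt hg ?_ (jet_taylor _)
  have := taylor_self (jet m g y)
  rw [jet_val] at this
  change (y, taylor (jet m g y) (jet m g y).1) ∈ _
  rwa [this]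

theorem taylor_mem_source {θ : Jet (n + 1) m} (hθ : θ ∈ C.jetSource m) :
    (θ.1, taylor θ θ.1) ∈ C.total.source := by rw [taylor_self]; exact hθ

theorem taylor_mem_target {θ : Jet (n + 1) m} (hθ : θ ∈ C.jetTarget m) :
    (θ.1, taylor θ θ.1) ∈ C.total.target := by rw [taylor_self]; exact hθ

theorem jetMap_mem {θ : Jet (n + 1) m} (hθ : θ ∈ C.jetSource m) :
    C.jetMap θ ∈ C.jetTarget m := by
  change (C.base θ.1, (jet m (C.push (taylor θ)) (C.base θ.1)).val) ∈ C.total.target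
  rw [jet_val]
  exact C.graph_push_mem (C.taylor_mem_source hθ)

theorem base_symm_mem {θ : Jet (n + 1) m} (hθ : θ ∈ C.jetTarget m) :
    θ.1 ∈ C.base.target ∧ C.base.symm θ.1 ∈ C.base.source ∧ C.base (C.base.symm θ.1) = θ.1 := by
  have h := (C.total_symm_fst hθ).1
  exact ⟨h, C.base.map_target h, C.base.right_inv h⟩

theorem base_mem {θ : Jet (n + 1) m} (hθ : θ ∈ C.jetSource m) :
    θ.1 ∈ C.base.source ∧ C.base θ.1 ∈ C.base.target ∧ C.base.symm (C.base θ.1) = θ.1 := by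
  have h := C.fst_mem _ hθ
  exact ⟨h, C.base.map_source h, C.base.left_inv h⟩

theorem graph_pull_taylor_mem {θ : Jet (n + 1) m} (hθ : θ ∈ C.jetTarget m) :
    (C.base.symm θ.1, C.pull (taylor θ) (C.base.symm θ.1)) ∈ C.total.source := by
  obtain ⟨_, h2, h3⟩ := C.base_symm_mem hθ
  exact C.graph_pull_mem h2 (by rw [h3]; exact C.taylor_mem_target hθ)

theorem contDiffAt_pull_taylor {θ : Jet (n + 1) m} (hθ : θ ∈ C.jetTarget m) :
    ContDiffAt ℝ ∞ (C.pull (taylor θ)) (C.base.symm θ.1) := by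
  obtain ⟨_, h2, h3⟩ := C.base_symm_mem hθ
  exact C.contDiffAt_pull (contDiff_taylor _).contDiffAt h2
    (by rw [h3]; exact C.taylor_mem_target hθ)

theorem jetMapInv_jetMap {θ : Jet (n + 1) m} (hθ : θ ∈ C.jetSource m) :
    C.jetMapInv (C.jetMap θ) = θ := by
  have hs := C.taylor_mem_source hθ
  rw [jetMap, C.jetMapInv_jet (C.contDiffAt_push (contDiff_taylor _).contDiffAt hs)
    (C.graph_push_mem hs), (C.base_mem hθ).2.2,
    jet_congr (C.pull_push (contDiff_taylor _).continuous.continuousAt hs), jet_taylor]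

theorem jetMap_jetMapInv {θ : Jet (n + 1) m} (hθ : θ ∈ C.jetTarget m) :
    C.jetMap (C.jetMapInv θ) = θ := by
  rw [jetMapInv, C.jetMap_jet (C.contDiffAt_pull_taylor hθ) (C.graph_pull_taylor_mem hθ),
    (C.base_symm_mem hθ).2.2,
    jet_congr (C.push_pull (contDiff_taylor _).continuous.continuousAt (C.taylor_mem_target hθ)),
    jet_taylor]

/-- The transformed polynomial is smooth jointly in the jet and the point, and
`ContDiffAt.pderiv_slice` differentiates it in the point while keeping the jet as a parameter. -/
theorem contDiffAt_jetMap {θ : Jet (n + 1) m} (hθ : θ ∈ C.jetSource m) :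
    ContDiffAt ℝ ∞ C.jetMap θ := by
  obtain ⟨h1, h2, h3⟩ := C.base_mem hθ
  have hb : ContDiffAt ℝ ∞ (fun η : Jet (n + 1) m => C.base η.1) θ :=
    ContDiffAt.comp θ (C.contDiffAt_base h1) contDiffAt_fst
  refine hb.prodMk (contDiffAt_pi.2 fun α => ?_)
  have hH : ContDiffAt ℝ ∞ (fun q : Jet (n + 1) m × Vec (n + 1) => C.push (taylor q.1) q.2)
      (θ, C.base θ.1) := by
    have hs : ContDiffAt ℝ ∞ (fun q : Jet (n + 1) m × Vec (n + 1) => C.base.symm q.2)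
        (θ, C.base θ.1) := ContDiffAt.comp _ (C.contDiffAt_base_symm h2) contDiffAt_snd
    have ht : ContDiffAt ℝ ∞ (fun q : Jet (n + 1) m × Vec (n + 1) =>
        (C.base.symm q.2, taylor q.1 (C.base.symm q.2))) (θ, C.base θ.1) :=
      hs.prodMk ((contDiff_taylor_uncurry m).contDiffAt.comp _ (contDiffAt_fst.prodMk hs))
    refine contDiffAt_snd.comp _ (ContDiffAt.comp _ (C.contDiffAt_total ?_) ht)
    simp only [h3]
    exact C.taylor_mem_source hθ
  exact (hH.pderiv_slice α.1).comp θ (contDiffAt_id.prodMk hb)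

theorem contDiffAt_pull_taylor_uncurry {θ : Jet (n + 1) m} (hθ : θ ∈ C.jetTarget m) :
    ContDiffAt ℝ ∞ (fun q : Jet (n + 1) m × Vec (n + 1) => C.pull (taylor q.1) q.2)
      (θ, C.base.symm θ.1) := by
  obtain ⟨h1, h2, h3⟩ := C.base_symm_mem hθ
  have hs : ContDiffAt ℝ ∞ (fun q : Jet (n + 1) m × Vec (n + 1) => C.base q.2)
      (θ, C.base.symm θ.1) := ContDiffAt.comp _ (C.contDiffAt_base h2) contDiffAt_snd
  have ht : ContDiffAt ℝ ∞ (fun q : Jet (n + 1) m × Vec (n + 1) =>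
      (C.base q.2, taylor q.1 (C.base q.2))) (θ, C.base.symm θ.1) :=
    hs.prodMk ((contDiff_taylor_uncurry m).contDiffAt.comp _ (contDiffAt_fst.prodMk hs))
  refine contDiffAt_snd.comp _ (ContDiffAt.comp _ (C.contDiffAt_total_symm ?_) ht)
  simp only [h3]
  exact C.taylor_mem_target hθ

theorem contDiffAt_jetMapInv {θ : Jet (n + 1) m} (hθ : θ ∈ C.jetTarget m) :
    ContDiffAt ℝ ∞ C.jetMapInv θ := by
  obtain ⟨h1, h2, h3⟩ := C.base_symm_mem hθ
  have hb : ContDiffAt ℝ ∞ (fun η : Jet (n + 1) m => C.base.symm η.1) θ :=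
    ContDiffAt.comp θ (C.contDiffAt_base_symm h1) contDiffAt_fst
  refine hb.prodMk (contDiffAt_pi.2 fun α => ?_)
  exact ((C.contDiffAt_pull_taylor_uncurry hθ).pderiv_slice α.1).comp θ (contDiffAt_id.prodMk hb)

theorem smoothNear_jetMap {θ : Jet (n + 1) m} (hθ : θ ∈ C.jetSource m) :
    SmoothNear C.jetMap θ := by
  filter_upwards [C.isOpen_jetSource.mem_nhds hθ] with η hη using C.contDiffAt_jetMap hη

theorem smoothNear_jetMapInv {θ : Jet (n + 1) m} (hθ : θ ∈ C.jetTarget m) :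
    SmoothNear C.jetMapInv θ := by
  filter_upwards [C.isOpen_jetTarget.mem_nhds hθ] with η hη using C.contDiffAt_jetMapInv hη

end AdaptedChart

namespace AdaptedChart

variable {n m : ℕ} {X : ProjectableField (n + 1)} (C : AdaptedChart X)

/-! ### The invariant surface condition in adapted variables -/

/-- The derivative `∂v/∂u`. -/
def vcoef (q : Vec (n + 1) × ℝ) : ℝ := (fderiv ℝ C.total q (0, 1)).2

theorem contDiffAt_vcoef {q : Vec (n + 1) × ℝ} (hq : q ∈ C.total.source) :
    ContDiffAt ℝ ∞ C.vcoef q :=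
  contDiffAt_snd.comp _
    (((C.contDiffAt_total hq).fderiv_right (m := ∞) (by simp)).clm_apply contDiffAt_const)

theorem fderiv_total_fst {q : Vec (n + 1) × ℝ} (hq : q ∈ C.total.source) (w : Vec (n + 1) × ℝ) :
    (fderiv ℝ C.total q w).1 = fderiv ℝ C.base q.1 w.1 := by
  have h1 : HasFDerivAt (fun r => (C.total r).1) _ q :=
    (ContinuousLinearMap.fst ℝ (Vec (n + 1)) ℝ).hasFDerivAt.comp q
      ((C.contDiffAt_total hq).differentiableAt (by simp)).hasFDerivAt
  have h2 : HasFDerivAt (fun r : Vec (n + 1) × ℝ => C.base r.1) _ q :=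
    ((C.contDiffAt_base (C.fst_mem q hq)).differentiableAt (by simp)).hasFDerivAt.comp q
      hasFDerivAt_fst
  have h3 : (fun r => (C.total r).1) =ᶠ[𝓝 q] fun r : Vec (n + 1) × ℝ => C.base r.1 := by
    filter_upwards [C.total.open_source.mem_nhds hq] with r hr using C.fst_eq r hr
  exact DFunLike.congr_fun (h1.unique (h2.congr_of_eventuallyEq h3)) w

theorem fderiv_base_ξ {q : Vec (n + 1) × ℝ} (hq : q ∈ C.total.source) :
    fderiv ℝ C.base q.1 (X.ξ q.1) = Pi.single 0 1 := by
  rw [← C.fderiv_total_fst hq (X.ξ q.1, X.φ q), C.straighten q hq]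

/-- The base variables do not involve u. If ∂v/∂u vanished too, ∂/∂u would lie in the kernel of an
invertible derivative. -/
theorem vcoef_ne_zero {q : Vec (n + 1) × ℝ} (hq : q ∈ C.total.source) : C.vcoef q ≠ 0 := by
  intro h
  have h0 : fderiv ℝ C.total q (0, 1) = 0 := by
    refine Prod.ext ?_ h
    rw [C.fderiv_total_fst hq]; simp
  have h1 : HasFDerivAt (fun r => C.total.symm (C.total r)) _ q :=
    ((C.contDiffAt_total_symm (C.total.map_source hq)).differentiableAt
      (by simp)).hasFDerivAt.comp q
      ((C.contDiffAt_total hq).differentiableAt (by simp)).hasFDerivAt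
  have h2 : (fun r => C.total.symm (C.total r)) =ᶠ[𝓝 q] id := by
    filter_upwards [C.total.open_source.mem_nhds hq] with r hr using C.total.left_inv hr
  have h3 := DFunLike.congr_fun (h1.unique ((hasFDerivAt_id q).congr_of_eventuallyEq h2)) (0, 1)
  rw [ContinuousLinearMap.comp_apply, h0, map_zero] at h3
  have := congrArg Prod.snd h3
  simp at this

/-- The central identity v_s = v_u · X_Q u. The vector ξ is ∂/∂s in the base, and its lift to the
graph of f is (ξ, φ) + X_Q f · ∂/∂u; the first summand does not change v. -/
theorem dirDeriv_push {f : Vec (n + 1) → ℝ} {x : Vec (n + 1)} (hf : ContDiffAt ℝ ∞ f x)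
    (hx : (x, f x) ∈ C.total.source) :
    dirDeriv (Pi.single 0 1) (C.push f) (C.base x) = C.vcoef (x, f x) * X.side f x := by
  have hfd := (hf.differentiableAt (by simp)).hasFDerivAt
  have h1 : HasFDerivAt (fun y => (C.total (y, f y)).2) _ x :=
    (ContinuousLinearMap.snd ℝ (Vec (n + 1)) ℝ).hasFDerivAt.comp x
      (HasFDerivAt.comp x ((C.contDiffAt_total hx).differentiableAt (by simp)).hasFDerivAt
        ((hasFDerivAt_id x).prodMk hfd))
  have h2 : HasFDerivAt (fun y => C.push f (C.base y)) _ x :=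
    ((C.contDiffAt_push hf hx).differentiableAt (by simp)).hasFDerivAt.comp x
      ((C.contDiffAt_base (C.fst_mem _ hx)).differentiableAt (by simp)).hasFDerivAt
  have h3 : (fun y => (C.total (y, f y)).2) =ᶠ[𝓝 x] fun y => C.push f (C.base y) := by
    have h : Tendsto (fun y => (y, f y)) (𝓝 x) (𝓝 (x, f x)) := continuousAt_id.prodMk hf.continuousAt
    filter_upwards [h.eventually (C.total.open_source.mem_nhds hx)] with y hy
    rw [C.total_eq hy]
  have h4 := DFunLike.congr_fun (h1.unique (h2.congr_of_eventuallyEq h3)) (X.ξ x)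
  simp only [ContinuousLinearMap.comp_apply, ContinuousLinearMap.prod_apply] at h4
  rw [C.fderiv_base_ξ hx] at h4
  rw [dirDeriv, ← h4]
  have h5 : ((ContinuousLinearMap.id ℝ (Vec (n + 1))) (X.ξ x), fderiv ℝ f x (X.ξ x))
      = (X.ξ x, X.φ (x, f x)) + X.side f x • ((0 : Vec (n + 1)), (1 : ℝ)) := by
    refine Prod.ext (by simp) ?_
    simp [ProjectableField.side]
  rw [h5, map_add, C.straighten _ hx, map_smul]
  simp [vcoef, mul_comm]

theorem graph_eventually_mem {f : Vec (n + 1) → ℝ} {x : Vec (n + 1)} (hf : ContDiffAt ℝ ∞ f x)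
    (hx : (x, f x) ∈ C.total.source) : ∀ᶠ y in 𝓝 x, (y, f y) ∈ C.total.source := by
  have h : Tendsto (fun y => (y, f y)) (𝓝 x) (𝓝 (x, f x)) :=
    continuousAt_id.prodMk hf.continuousAt
  exact h.eventually (C.total.open_source.mem_nhds hx)

theorem contDiffAt_vcoef_taylor {θ : Jet (n + 1) m} (hθ : θ ∈ C.jetSource m) :
    ContDiffAt ℝ ∞ (fun q : Jet (n + 1) m × Vec (n + 1) => C.vcoef (q.2, taylor q.1 q.2))
      (θ, θ.1) :=
  ContDiffAt.comp (g := C.vcoef) (θ, θ.1) (C.contDiffAt_vcoef (C.taylor_mem_source hθ))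
    (contDiffAt_snd.prodMk (contDiff_taylor_uncurry m).contDiffAt)

theorem sDeriv_jet {f : Vec (n + 1) → ℝ} {x : Vec (n + 1)} (hf : ContDiffAt ℝ ∞ f x)
    (ℓ : SIdx (n + 1) m) :
    sDeriv ℓ (jet m f x) = pderiv ℓ.1 (dirDeriv (Pi.single 0 1) f) x :=
  (pderiv_add_single' hf ℓ.1 0).self_of_nhds

/-- D_α is applied to X_Q u = v_u⁻¹ · v_s. By `pderiv_mul_comp` the result is linear in the
derivatives of v_s of order below m, and the coefficients are smooth in the jet. -/
theorem sideEq_inIdeal (α : SIdx (n + 1) m) {θ : Jet (n + 1) m} (hθ : θ ∈ C.jetSource m) :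
    InIdeal (fun (ℓ : SIdx (n + 1) m) η => sDeriv ℓ (C.jetMap η)) (X.sideEq α) θ := by
  refine ⟨fun ℓ η => pderiv α.1 (fun x => (C.vcoef (x, taylor η x))⁻¹ *
    tmono (C.base η.1) ℓ.1 (C.base x)) η.1, fun ℓ => ?_, ?_⟩
  · filter_upwards [C.isOpen_jetSource.mem_nhds hθ] with η hη
    have hb : ContDiffAt ℝ ∞ (fun q : Jet (n + 1) m × Vec (n + 1) => C.base q.2) (η, η.1) :=
      ContDiffAt.comp _ (C.contDiffAt_base (C.base_mem hη).1) contDiffAt_snd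
    have hb' : ContDiffAt ℝ ∞ (fun q : Jet (n + 1) m × Vec (n + 1) => C.base q.1.1) (η, η.1) :=
      ContDiffAt.comp _ (C.contDiffAt_base (C.base_mem hη).1) (contDiffAt_fst.comp _ contDiffAt_fst)
    have h1 := (C.contDiffAt_vcoef_taylor hη).inv
      (C.vcoef_ne_zero (C.taylor_mem_source hη))
    have h2 := (contDiff_tmono_uncurry ℓ.1).contDiffAt.comp (η, η.1) (hb'.prodMk hb)
    exact ((h1.mul h2).pderiv_slice α.1).comp η (contDiffAt_id.prodMk contDiffAt_fst)
  · filter_upwards [C.isOpen_jetSource.mem_nhds hθ] with η hη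
    set f := taylor η with hfdef
    have hf : ∀ x, ContDiffAt ℝ ∞ f x := fun x => (contDiff_taylor η).contDiffAt
    have hs := C.taylor_mem_source hη
    have hside : X.side f =ᶠ[𝓝 η.1] fun x => (C.vcoef (x, f x))⁻¹ *
        dirDeriv (Pi.single 0 1) (C.push f) (C.base x) := by
      filter_upwards [C.graph_eventually_mem (hf _) hs] with x hx
      rw [C.dirDeriv_push (hf x) hx, inv_mul_cancel_left₀ (C.vcoef_ne_zero hx)]
    have hA : ContDiffAt ℝ ∞ (fun x => (C.vcoef (x, f x))⁻¹) η.1 :=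
      (ContDiffAt.comp (g := C.vcoef) η.1 (C.contDiffAt_vcoef hs) (contDiffAt_id.prodMk (hf _))).inv
        (C.vcoef_ne_zero hs)
    have hp := C.contDiffAt_push (hf _) hs
    change pderiv α.1 (X.side f) η.1 = _
    rw [(hside.pderiv α.1).self_of_nhds, pderiv_mul_comp hA (C.contDiffAt_base (C.base_mem hη).1)
      (hp.dirDeriv _) α.2]
    refine Finset.sum_congr rfl fun ℓ _ => ?_
    rw [jetMap, sDeriv_jet hp, mul_comm]

/-- The converse of `sideEq_inIdeal`, from v_s = v_u · X_Q u differentiated in the adapted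
variables. -/
theorem sDeriv_inIdeal (ℓ : SIdx (n + 1) m) {θ : Jet (n + 1) m} (hθ : θ ∈ C.jetSource m) :
    InIdeal (fun (α : SIdx (n + 1) m) => X.sideEq α) (fun η => sDeriv ℓ (C.jetMap η)) θ := by
  refine ⟨fun α η => pderiv ℓ.1 (fun y => C.vcoef (C.base.symm y, taylor η (C.base.symm y)) *
    tmono η.1 α.1 (C.base.symm y)) (C.base η.1), fun α => ?_, ?_⟩
  · filter_upwards [C.isOpen_jetSource.mem_nhds hθ] with η hη
    obtain ⟨hb1, hb2, hb3⟩ := C.base_mem hη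
    have hb : ContDiffAt ℝ ∞ (fun η : Jet (n + 1) m => C.base η.1) η :=
      ContDiffAt.comp _ (C.contDiffAt_base hb1) contDiffAt_fst
    have hbs : ContDiffAt ℝ ∞ (fun q : Jet (n + 1) m × Vec (n + 1) => C.base.symm q.2)
        (η, C.base η.1) :=
      ContDiffAt.comp _ (C.contDiffAt_base_symm hb2) contDiffAt_snd
    have h1 : ContDiffAt ℝ ∞ (fun q : Jet (n + 1) m × Vec (n + 1) =>
        C.vcoef (C.base.symm q.2, taylor q.1 (C.base.symm q.2))) (η, C.base η.1) := by
      have hv : ContDiffAt ℝ ∞ (fun q : Jet (n + 1) m × Vec (n + 1) =>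
        C.vcoef (q.2, taylor q.1 q.2)) (η, C.base.symm (C.base η.1)) := by
        rw [hb3]; exact C.contDiffAt_vcoef_taylor hη
      exact ContDiffAt.comp (g := fun q : Jet (n + 1) m × Vec (n + 1) =>
        C.vcoef (q.2, taylor q.1 q.2)) (η, C.base η.1) hv (contDiffAt_fst.prodMk hbs)
    have h2 := (contDiff_tmono_uncurry α.1).contDiffAt.comp (η, C.base η.1)
      ((contDiffAt_fst.comp _ contDiffAt_fst).prodMk hbs)
    exact ((h1.mul h2).pderiv_slice ℓ.1).comp η (contDiffAt_id.prodMk hb)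
  · filter_upwards [C.isOpen_jetSource.mem_nhds hθ] with η hη
    obtain ⟨hb1, hb2, hb3⟩ := C.base_mem hη
    set f := taylor η with hfdef
    have hf : ∀ x, ContDiffAt ℝ ∞ f x := fun x => (contDiff_taylor η).contDiffAt
    have hs := C.taylor_mem_source hη
    have hbs := C.contDiffAt_base_symm hb2
    have hdp : dirDeriv (Pi.single 0 1) (C.push f) =ᶠ[𝓝 (C.base η.1)] fun y =>
        C.vcoef (C.base.symm y, f (C.base.symm y)) * X.side f (C.base.symm y) := by
      have ht : Tendsto C.base.symm (𝓝 (C.base η.1)) (𝓝 η.1) := by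
        have := hbs.continuousAt
        rwa [ContinuousAt, hb3] at this
      filter_upwards [ht.eventually (C.graph_eventually_mem (hf _) hs),
        C.base.open_target.mem_nhds hb2] with y hy hyt
      rw [← C.dirDeriv_push (hf _) hy, C.base.right_inv hyt]
    have hA : ContDiffAt ℝ ∞ (fun y => C.vcoef (C.base.symm y, f (C.base.symm y)))
        (C.base η.1) := by
      have : ContDiffAt ℝ ∞ (fun x => C.vcoef (x, f x)) (C.base.symm (C.base η.1)) := by
        rw [hb3]
        exact ContDiffAt.comp (g := C.vcoef) η.1 (C.contDiffAt_vcoef hs) (contDiffAt_id.prodMk (hf _))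
      exact ContDiffAt.comp (g := fun x => C.vcoef (x, f x)) _ this hbs
    have hsd : ContDiffAt ℝ ∞ (X.side f) (C.base.symm (C.base η.1)) := by
      rw [hb3]; exact X.contDiffAt_side (hf _) (C.source_subset hs)
    rw [jetMap, sDeriv_jet (C.contDiffAt_push (hf _) hs), (hdp.pderiv ℓ.1).self_of_nhds,
      pderiv_mul_comp hA hbs hsd ℓ.2]
    refine Finset.sum_congr rfl fun α _ => ?_
    rw [hb3, mul_comm]
    rfl

/-! ### The prolongation in adapted variables -/

/-- The direction `∂/∂s` in the space of adapted jets. -/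
def sDir (n m : ℕ) : Jet (n + 1) m := (Pi.single 0 1, 0)

theorem taylor_add_smul_sDir (θ : Jet (n + 1) m) (t : ℝ) (y : Vec (n + 1)) :
    taylor (θ + t • sDir n m) y = taylor θ (y - t • Pi.single 0 1) := by
  have h1 : (θ + t • sDir n m).1 = θ.1 + t • Pi.single 0 1 := rfl
  have h2 : (θ + t • sDir n m).2 = θ.2 := by simp [sDir]
  simp only [taylor_eq, tmono, h1, h2, Pi.add_apply, Pi.sub_apply]
  refine Finset.sum_congr rfl fun α _ => congrArg _ (Finset.prod_congr rfl fun i _ => ?_)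
  congr 2
  ring

/-- The prolongation of X is ∂/∂s in adapted jets. Moving θ along s translates its polynomial v in
s. The corresponding functions u_t satisfy ∂_t u_t = -X_Q u at t = 0, while the base point moves
with velocity ξ. Thus ∂^α u_t at the moving point has derivative -D_α(X_Q u) + ξ_i u_{α,i}, which is
φ_α. -/
theorem fderiv_jetMapInv_sDir {θ : Jet (n + 1) m} (hθ : θ ∈ C.jetTarget m) :
    fderiv ℝ C.jetMapInv θ (sDir n m)
      = (X.ξ (C.base.symm θ.1), fun α => X.coef α (C.jetMapInv θ)) := by
  obtain ⟨hb1, hb2, hb3⟩ := C.base_symm_mem hθ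
  set x := C.base.symm θ.1 with hx
  set f := C.pull (taylor θ) with hf
  have hfx : ContDiffAt ℝ ∞ f x := C.contDiffAt_pull_taylor hθ
  have hsx : (x, f x) ∈ C.total.source := C.graph_pull_taylor_mem hθ
  have hξx : fderiv ℝ C.base.symm θ.1 (Pi.single 0 1) = X.ξ x := by
    have h0 : HasFDerivAt C.base.symm (fderiv ℝ C.base.symm θ.1) (C.base x) := by
      rw [hb3]
      exact ((C.contDiffAt_base_symm hb1).differentiableAt (by simp)).hasFDerivAt
    have h1 : HasFDerivAt (fun r => C.base.symm (C.base r)) _ x :=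
      h0.comp x ((C.contDiffAt_base hb2).differentiableAt (by simp)).hasFDerivAt
    have h2 : (fun r => C.base.symm (C.base r)) =ᶠ[𝓝 x] id := by
      filter_upwards [C.base.open_source.mem_nhds hb2] with r hr using C.base.left_inv hr
    have h3 := DFunLike.congr_fun (h1.unique ((hasFDerivAt_id x).congr_of_eventuallyEq h2)) (X.ξ x)
    rw [ContinuousLinearMap.comp_apply, C.fderiv_base_ξ hsx] at h3
    exact h3
  -- the curve of jets
  have hcurve : HasDerivAt (fun t : ℝ => θ + t • sDir n m) (sDir n m) 0 := by
    simpa using ((hasDerivAt_id (0 : ℝ)).smul_const (sDir n m)).const_add θ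
  have hJ : HasDerivAt (fun t : ℝ => C.jetMapInv (θ + t • sDir n m))
      (fderiv ℝ C.jetMapInv θ (sDir n m)) 0 := by
    have h0 : HasFDerivAt C.jetMapInv (fderiv ℝ C.jetMapInv θ) (θ + (0 : ℝ) • sDir n m) := by
      rw [zero_smul, add_zero]
      exact ((C.contDiffAt_jetMapInv hθ).differentiableAt (by simp)).hasFDerivAt
    exact h0.comp_hasDerivAt (0 : ℝ) hcurve
  have hbase : HasDerivAt (fun t : ℝ => C.base.symm (θ.1 + t • Pi.single 0 1)) (X.ξ x) 0 := by
    rw [← hξx]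
    have hc1 : HasDerivAt (fun t : ℝ => θ.1 + t • (Pi.single 0 1 : Vec (n + 1)))
        (Pi.single 0 1) 0 := by
      simpa using ((hasDerivAt_id (0 : ℝ)).smul_const (Pi.single 0 1 : Vec (n + 1))).const_add θ.1
    have h0 : HasFDerivAt C.base.symm (fderiv ℝ C.base.symm θ.1)
        (θ.1 + (0 : ℝ) • (Pi.single 0 1 : Vec (n + 1))) := by
      rw [zero_smul, add_zero]
      exact ((C.contDiffAt_base_symm hb1).differentiableAt (by simp)).hasFDerivAt
    exact h0.comp_hasDerivAt (0 : ℝ) hc1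
  refine Prod.ext ?_ (funext fun α => ?_)
  · have h1 : HasDerivAt (fun t : ℝ => (C.jetMapInv (θ + t • sDir n m)).1)
        (fderiv ℝ C.jetMapInv θ (sDir n m)).1 0 :=
      (ContinuousLinearMap.fst ℝ (Vec (n + 1)) (MIdx (n + 1) m → ℝ)).hasFDerivAt.comp_hasDerivAt
        (0 : ℝ) hJ
    exact h1.unique hbase
  have h1 : HasDerivAt (fun t : ℝ => (C.jetMapInv (θ + t • sDir n m)).2 α)
      ((fderiv ℝ C.jetMapInv θ (sDir n m)).2 α) 0 :=
    ((ContinuousLinearMap.proj α).comp (ContinuousLinearMap.snd ℝ (Vec (n + 1))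
      (MIdx (n + 1) m → ℝ))).hasFDerivAt.comp_hasDerivAt (0 : ℝ) hJ
  refine h1.unique ?_
  -- `H (t, ·)` is the function u that corresponds to v translated by t in s.
  let H : ℝ × Vec (n + 1) → ℝ := fun q => C.pull (taylor (θ + q.1 • sDir n m)) q.2
  have hHsm : ContDiffAt ℝ ∞ H (0, x) := by
    have h2 : ContDiffAt ℝ ∞ (fun q : ℝ × Vec (n + 1) => (θ + q.1 • sDir n m, q.2)) (0, x) :=
      ContDiff.contDiffAt (by fun_prop)
    have h3 := C.contDiffAt_pull_taylor_uncurry hθ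
    refine ContDiffAt.comp (0, x) (g := fun q : Jet (n + 1) m × Vec (n + 1) =>
      C.pull (taylor q.1) q.2) (f := fun q : ℝ × Vec (n + 1) => (θ + q.1 • sDir n m, q.2)) ?_ h2
    simp only [zero_smul, add_zero]
    exact h3
  have hH0 : (fun y => H (0, y)) = f := by
    ext y; simp [H, hf]
  -- the derivative of `H` in the time direction
  have hHt : (fun y => dirDeriv ((1 : ℝ), 0) H (0, y)) =ᶠ[𝓝 x] fun y => - X.side f y := by
    have hpush : C.push f =ᶠ[𝓝 (C.base x)] taylor θ := by
      rw [hb3]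
      exact C.push_pull (contDiff_taylor _).continuous.continuousAt (C.taylor_mem_target hθ)
    have hgr : ∀ᶠ y in 𝓝 x, (C.base y, taylor θ (C.base y)) ∈ C.total.target := by
      have h3 : ContinuousAt (fun y => (C.base y, taylor θ (C.base y))) x :=
        (C.contDiffAt_base hb2).continuousAt.prodMk
          ((contDiff_taylor θ).continuous.continuousAt.comp (C.contDiffAt_base hb2).continuousAt)
      refine h3.eventually (C.total.open_target.mem_nhds ?_)
      change (C.base x, taylor θ (C.base x)) ∈ C.total.target
      rw [hb3]; exact C.taylor_mem_target hθ
    have hsl : Tendsto (fun y : Vec (n + 1) => ((0 : ℝ), y)) (𝓝 x) (𝓝 (0, x)) :=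
      Continuous.tendsto (by fun_prop) _
    filter_upwards [hgr, C.base.open_source.mem_nhds hb2,
      (C.contDiffAt_base hb2).continuousAt.eventually hpush.eventuallyEq_nhds,
      hsl.eventually hHsm.eventually_differentiableAt,
      C.graph_eventually_mem hfx hsx, (hfx.of_le (m := 1) (by simp)).eventually (by simp)]
      with y hy hyb hyp hyd hys hyf
    have hH0y : H (0, y) = f y := congrFun hH0 y
    have hHd : HasDerivAt (fun t : ℝ => H (t, y)) (dirDeriv ((1 : ℝ), 0) H (0, y)) 0 :=
      hyd.hasFDerivAt.comp_hasDerivAt (0 : ℝ) (f := fun t : ℝ => (t, y))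
        ((hasDerivAt_id (0 : ℝ)).prodMk (hasDerivAt_const (0 : ℝ) y))
    have hL : HasDerivAt (fun t : ℝ => (C.total (y, H (t, y))).2)
        (C.vcoef (y, f y) * dirDeriv ((1 : ℝ), 0) H (0, y)) 0 := by
      have h4 : HasFDerivAt C.total (fderiv ℝ C.total (y, f y)) (y, H (0, y)) := by
        rw [hH0y]; exact ((C.contDiffAt_total hys).differentiableAt (by simp)).hasFDerivAt
      have h5 := (ContinuousLinearMap.snd ℝ (Vec (n + 1)) ℝ).hasFDerivAt.comp_hasDerivAt (0 : ℝ)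
        (h4.comp_hasDerivAt (0 : ℝ) ((hasDerivAt_const (0 : ℝ) y).prodMk hHd))
      refine h5.congr_deriv ?_
      have h6 : ((0 : Vec (n + 1)), dirDeriv ((1 : ℝ), 0) H (0, y))
          = dirDeriv ((1 : ℝ), 0) H (0, y) • ((0 : Vec (n + 1)), (1 : ℝ)) := by simp
      rw [h6, map_smul]
      simp [vcoef, mul_comm]
    have hR : HasDerivAt (fun t : ℝ => taylor θ (C.base y - t • Pi.single 0 1))
        (- dirDeriv (Pi.single 0 1) (taylor θ) (C.base y)) 0 := by
      have h7 : HasDerivAt (fun t : ℝ => C.base y - t • (Pi.single 0 1 : Vec (n + 1)))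
          (- Pi.single 0 1) 0 := by
        simpa using ((hasDerivAt_id (0 : ℝ)).smul_const
          (Pi.single 0 1 : Vec (n + 1))).const_sub (C.base y)
      have h8 : HasFDerivAt (taylor θ) (fderiv ℝ (taylor θ) (C.base y))
          (C.base y - (0 : ℝ) • (Pi.single 0 1 : Vec (n + 1))) := by
        rw [zero_smul, sub_zero]
        exact ((contDiff_taylor θ).differentiable (by simp) _).hasFDerivAt
      refine (h8.comp_hasDerivAt (0 : ℝ) h7).congr_deriv ?_
      rw [map_neg]; rfl
    -- Inserting u_t into v(x, u) gives back the translated v. Comparing t-derivatives yields v_u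
    -- ∂_t u_t = -v_s = -v_u X_Q u.
    have hLR : (fun t : ℝ => (C.total (y, H (t, y))).2) =ᶠ[𝓝 0]
        fun t : ℝ => taylor θ (C.base y - t • Pi.single 0 1) := by
      have h9 : ContinuousAt (fun t : ℝ => (C.base y, taylor θ (C.base y - t • Pi.single 0 1))) 0 :=
        by
          have := (contDiff_taylor θ).continuous
          exact Continuous.continuousAt (by fun_prop)
      have h10 := h9.eventually (C.total.open_target.mem_nhds (by
        change (C.base y, taylor θ (C.base y - (0 : ℝ) • Pi.single 0 1)) ∈ C.total.target
        rw [zero_smul, sub_zero]; exact hy))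
      filter_upwards [h10] with t ht
      rw [← taylor_add_smul_sDir] at ht ⊢
      have h11 := C.total_symm_eq (g := taylor (θ + t • sDir n m)) hyb ht
      change (C.total (y, C.pull (taylor (θ + t • sDir n m)) y)).2 = _
      rw [← h11, C.total.right_inv ht]
    have h12 := hL.unique (hR.congr_of_eventuallyEq hLR)
    have hyf' : ContDiffAt ℝ ∞ f y := by
      exact C.contDiffAt_pull (contDiff_taylor θ).contDiffAt hyb hy
    have h13 := C.dirDeriv_push hyf' hys
    have h14 : dirDeriv (Pi.single 0 1) (C.push f) (C.base y)
        = dirDeriv (Pi.single 0 1) (taylor θ) (C.base y) :=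
      ((EventuallyEq.dirDeriv hyp (Pi.single 0 1)).self_of_nhds)
    rw [← h14, h13, ← mul_neg] at h12
    exact mul_left_cancel₀ (C.vcoef_ne_zero hys) h12
  -- the total derivative
  let P : ℝ × Vec (n + 1) → ℝ := fun q => pderiv α.1 (fun y => H (q.1, y)) q.2
  have hP : ContDiffAt ℝ ∞ P (0, x) := hHsm.pderiv_slice α.1
  have hPd := hP.differentiableAt (by simp)
  have hPt : dirDeriv ((1 : ℝ), 0) P (0, x) = - pderiv α.1 (X.side f) x := by
    rw [show P = fun r => pderiv α.1 (fun y => H (r.1, y)) r.2 from rfl,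
      dirDeriv_pderiv_slice hHsm, (hHt.pderiv α.1).self_of_nhds,
      pderiv_neg_at (X.contDiffAt_side hfx (C.source_subset hsx))]
  have hPx : dirDeriv ((0 : ℝ), X.ξ x) P (0, x)
      = ∑ i, X.ξ x i * pderiv (α.1 + Pi.single i 1) f x := by
    rw [← dirDeriv_slice hPd, dirDeriv_eq_sum]
    refine Finset.sum_congr rfl fun i _ => ?_
    rw [(pderiv_add_single hfx α.1 i).self_of_nhds]
    simp only [P, hH0]
  have hpath : HasDerivAt (fun t : ℝ => (t, C.base.symm (θ.1 + t • Pi.single 0 1)))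
      ((1 : ℝ), X.ξ x) 0 := (hasDerivAt_id (0 : ℝ)).prodMk hbase
  have hfin : HasDerivAt (fun t : ℝ => P (t, C.base.symm (θ.1 + t • Pi.single 0 1)))
      (fderiv ℝ P (0, x) (1, X.ξ x)) 0 := by
    have h2 : HasFDerivAt P (fderiv ℝ P (0, x))
        (0, C.base.symm (θ.1 + (0 : ℝ) • Pi.single 0 1)) := by
      rw [zero_smul, add_zero]
      exact hPd.hasFDerivAt
    exact h2.comp_hasDerivAt (0 : ℝ) hpath
  refine hfin.congr_deriv ?_
  have hsplit : ((1 : ℝ), X.ξ x) = ((1 : ℝ), (0 : Vec (n + 1))) + ((0 : ℝ), X.ξ x) := by simp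
  have hx1 : (C.jetMapInv θ).1 = x := rfl
  -- `coef` is defined through the Taylor polynomial of the jet, which may replace `f` by
  -- `coef_congr`.
  have hjet : jet m f x = jet m (taylor (C.jetMapInv θ)) x := by
    have := jet_taylor (C.jetMapInv θ)
    rw [hx1] at this
    rw [this]; rfl
  rw [hsplit, map_add]
  change dirDeriv ((1 : ℝ), 0) P (0, x) + dirDeriv ((0 : ℝ), X.ξ x) P (0, x) = _
  rw [hPt, hPx, X.coef_congr hfx (contDiff_taylor (C.jetMapInv θ)).contDiffAt
    (C.source_subset hsx) hjet α]
  rfl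

theorem prolong_jetMapInv {θ : Jet (n + 1) m} (hθ : θ ∈ C.jetTarget m) {F : Jet (n + 1) m → ℝ}
    (hF : DifferentiableAt ℝ F (C.jetMapInv θ)) :
    X.prolong F (C.jetMapInv θ) = dirDeriv (sDir n m) (fun η => F (C.jetMapInv η)) θ := by
  have h1 : HasFDerivAt (fun η => F (C.jetMapInv η)) _ θ :=
    hF.hasFDerivAt.comp θ ((C.contDiffAt_jetMapInv hθ).differentiableAt (by simp)).hasFDerivAt
  rw [dirDeriv, h1.fderiv, ContinuousLinearMap.comp_apply, C.fderiv_jetMapInv_sDir hθ]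
  rfl

end AdaptedChart

/-! ### Symmetries as ideal conditions, and their form in adapted variables -/

theorem InIdeal.smoothNear {E ι : Type*} [NormedAddCommGroup E] [NormedSpace ℝ E] [Fintype ι]
    {F : ι → E → ℝ} {h : E → ℝ} {x : E} (hh : InIdeal F h x) (hF : ∀ i, SmoothNear (F i) x) :
    SmoothNear h x := by
  obtain ⟨G, hG, hs⟩ := hh
  exact (SmoothNear.sum fun i _ => (hG i).mul (hF i)).congr hs.symm

theorem ProjectableField.isAlgebraicSymmetryNear_iff {p m : ℕ} (X : ProjectableField p)
    {ι : Type*} [Fintype ι] (F : ι → Jet p m → ℝ) (θ₀ : Jet p m) :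
    X.IsAlgebraicSymmetryNear F θ₀ ↔ ∀ i, InIdeal F (X.prolong (F i)) θ₀ := by
  constructor
  · rintro ⟨N, G, hN, hθ, hG, hsum⟩ i
    refine ⟨G i, fun k => (hG i k).smoothNear hN hθ, ?_⟩
    filter_upwards [hN.mem_nhds hθ] with η hη using hsum η hη i
  · intro h
    choose G hG hsum using h
    obtain ⟨N, hNs, hN, hθ⟩ := mem_nhds_iff.1
      ((eventually_all.2 fun i => eventually_all.2 (hG i)).and (eventually_all.2 hsum))
    exact ⟨N, G, hN, hθ, fun i k η hη => ((hNs hη).1 i k).contDiffWithinAt,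
      fun η hη i => (hNs hη).2 i⟩

theorem ProjectableField.IsAlgebraicSymmetryNear.isSymmetryNear {p m : ℕ}
    {X : ProjectableField p} {ι : Type*} [Fintype ι] {F : ι → Jet p m → ℝ} {θ₀ : Jet p m}
    (h : X.IsAlgebraicSymmetryNear F θ₀) : X.IsSymmetryNear F θ₀ := by
  obtain ⟨N, G, hN, hθ, -, hsum⟩ := h
  refine ⟨N, hN, hθ, fun η hη h0 i => ?_⟩
  rw [hsum η hη i]
  exact Finset.sum_eq_zero fun k _ => by rw [h0 k, mul_zero]

/-- The two alternatives of maximal rank: if θ₀ satisfies the system, `inIdeal_of_linearIndependent`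
applies; otherwise some equation is a unit near θ₀. -/
theorem ProjectableField.IsSymmetryNear.isAlgebraicSymmetryNear {p m : ℕ}
    {X : ProjectableField p} {ι : Type} [Fintype ι] {F : ι → Jet p m → ℝ} {θ₀ : Jet p m}
    (h : X.IsSymmetryNear F θ₀) (hrank : MaximalRankAt F θ₀) (hF : ∀ i, SmoothNear (F i) θ₀)
    (hXF : ∀ i, SmoothNear (X.prolong (F i)) θ₀) : X.IsAlgebraicSymmetryNear F θ₀ := by
  rw [isAlgebraicSymmetryNear_iff]
  intro i
  by_cases h0 : ∀ k, F k θ₀ = 0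
  · obtain ⟨N, hN, hθ, hs⟩ := h
    refine inIdeal_of_linearIndependent hF h0 (hrank h0) (hXF i) ?_
    filter_upwards [hN.mem_nhds hθ] with η hη hη0 using hs η hη hη0 i
  · push Not at h0
    obtain ⟨k, hk⟩ := h0
    exact inIdeal_of_ne_zero (hF k) hk (hXF i)

section sDeriv

variable {n m : ℕ}

theorem contDiff_sDeriv (ℓ : SIdx (n + 1) m) : ContDiff ℝ ∞ (sDeriv (n := n) ℓ) := by
  unfold sDeriv; fun_prop

theorem dirDeriv_sDir_sDeriv (ℓ : SIdx (n + 1) m) (θ : Jet (n + 1) m) :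
    dirDeriv (AdaptedChart.sDir n m) (sDeriv ℓ) θ = 0 := by
  have h : HasFDerivAt (sDeriv (n := n) ℓ) ((ContinuousLinearMap.proj _).comp
      (ContinuousLinearMap.snd ℝ (Vec (n + 1)) (MIdx (n + 1) m → ℝ))) θ :=
    ((ContinuousLinearMap.proj (R := ℝ) (φ := fun _ : MIdx (n + 1) m => ℝ) _).comp
      (ContinuousLinearMap.snd ℝ (Vec (n + 1)) (MIdx (n + 1) m → ℝ))).hasFDerivAt
  rw [dirDeriv, h.fderiv]
  rfl

end sDeriv

namespace AdaptedChart

variable {n m : ℕ} {X : ProjectableField (n + 1)} (C : AdaptedChart X)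

theorem isOpen_jetDomain {D : Set (Jet (n + 1) m)} (hD : IsOpen D) : IsOpen (C.jetDomain D) := by
  have hc : ContinuousOn C.jetMapInv (C.jetTarget m) := fun θ hθ =>
    (C.contDiffAt_jetMapInv hθ).continuousAt.continuousWithinAt
  exact hc.isOpen_inter_preimage C.isOpen_jetTarget hD

theorem prolong_eventuallyEq {F : Jet (n + 1) m → ℝ} {θ : Jet (n + 1) m}
    (hθ : θ ∈ C.jetSource m) (hF : SmoothNear F θ) :
    X.prolong F =ᶠ[𝓝 θ] fun η => dirDeriv (sDir n m) (fun η => F (C.jetMapInv η)) (C.jetMap η) := by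
  filter_upwards [C.isOpen_jetSource.mem_nhds hθ, hF] with η hη hFη
  rw [← C.prolong_jetMapInv (C.jetMap_mem hη), C.jetMapInv_jetMap hη]
  rw [C.jetMapInv_jetMap hη]
  exact hFη.differentiableAt (by simp)

theorem smoothNear_comp_jetMapInv {F : Jet (n + 1) m → ℝ} {θ : Jet (n + 1) m}
    (hθ : θ ∈ C.jetSource m) (hF : SmoothNear F θ) :
    SmoothNear (fun η => F (C.jetMapInv η)) (C.jetMap θ) :=
  SmoothNear.comp (by rwa [C.jetMapInv_jetMap hθ]) (C.smoothNear_jetMapInv (C.jetMap_mem hθ))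

theorem smoothNear_prolong {F : Jet (n + 1) m → ℝ} {θ : Jet (n + 1) m}
    (hθ : θ ∈ C.jetSource m) (hF : SmoothNear F θ) : SmoothNear (X.prolong F) θ :=
  SmoothNear.congr (SmoothNear.comp ((C.smoothNear_comp_jetMapInv hθ hF).dirDeriv _)
    (C.smoothNear_jetMap hθ)) (C.prolong_eventuallyEq hθ hF).symm

theorem tendsto_jetMap {θ : Jet (n + 1) m} (hθ : θ ∈ C.jetSource m) :
    Tendsto C.jetMap (𝓝 θ) (𝓝 (C.jetMap θ)) := (C.contDiffAt_jetMap hθ).continuousAt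

theorem tendsto_jetMapInv {θ : Jet (n + 1) m} (hθ : θ ∈ C.jetSource m) :
    Tendsto C.jetMapInv (𝓝 (C.jetMap θ)) (𝓝 θ) := by
  have := (C.contDiffAt_jetMapInv (C.jetMap_mem hθ)).continuousAt
  rwa [ContinuousAt, C.jetMapInv_jetMap hθ] at this

theorem eventually_jetMap_jetMapInv {θ : Jet (n + 1) m} (hθ : θ ∈ C.jetSource m) :
    ∀ᶠ η in 𝓝 (C.jetMap θ), C.jetMap (C.jetMapInv η) = η := by
  filter_upwards [C.isOpen_jetTarget.mem_nhds (C.jetMap_mem hθ)] with η hη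
  exact C.jetMap_jetMapInv hη

/-- The iterated prolongations of `Δ` are its iterated `s`-derivatives in adapted variables. -/
theorem prolong_iterate {Δ : Jet (n + 1) m → ℝ} {θ : Jet (n + 1) m} (hθ : θ ∈ C.jetSource m)
    (hΔ : SmoothNear Δ θ) (j : ℕ) :
    SmoothNear (X.prolong^[j] Δ) θ ∧ (X.prolong^[j] Δ) =ᶠ[𝓝 θ] fun η =>
      (dirDeriv (sDir n m))^[j] (fun η => Δ (C.jetMapInv η)) (C.jetMap η) := by
  induction j with
  | zero =>
    refine ⟨hΔ, ?_⟩
    filter_upwards [C.isOpen_jetSource.mem_nhds hθ] with η hη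
    simp [C.jetMapInv_jetMap hη]
  | succ j ih =>
    rw [Function.iterate_succ_apply', Function.iterate_succ_apply']
    refine ⟨C.smoothNear_prolong hθ ih.1, (C.prolong_eventuallyEq hθ ih.1).trans ?_⟩
    have h1 : (fun η => (X.prolong^[j] Δ) (C.jetMapInv η)) =ᶠ[𝓝 (C.jetMap θ)]
        (dirDeriv (sDir n m))^[j] (fun η => Δ (C.jetMapInv η)) := by
      filter_upwards [(C.tendsto_jetMapInv hθ).eventually ih.2,
        C.eventually_jetMap_jetMapInv hθ] with η h2 h3
      rw [h2, h3]
    exact (C.tendsto_jetMap hθ).eventually (h1.dirDeriv _)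

/-- The system `Δ = ∂_s Δ = ⋯ = 0`, `v_s^{(ℓ)} = 0` in adapted variables. -/
def adaptedSystem (F : Jet (n + 1) m → ℝ) (σ : ℕ) :
    Fin σ ⊕ SIdx (n + 1) m → Jet (n + 1) m → ℝ :=
  Sum.elim (fun j => (dirDeriv (sDir n m))^[(j : ℕ)] F) (fun ℓ => sDeriv ℓ)

variable {Δ : Jet (n + 1) m → ℝ} {θ : Jet (n + 1) m}

/-- Together with `adaptedSystem_inIdeal`, this says that the two systems generate the same ideal.
The Δ^{(j)} correspond one to one; the invariant surface equations correspond only up to smooth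
linear combinations. -/
theorem condSystem_inIdeal (hθ : θ ∈ C.jetSource m) (hΔ : SmoothNear Δ θ) (σ : ℕ)
    (i : Fin σ ⊕ SIdx (n + 1) m) :
    InIdeal (fun i η => adaptedSystem (fun η => Δ (C.jetMapInv η)) σ i (C.jetMap η))
      (X.condSystem Δ σ i) θ := by
  rcases i with j | α
  · exact (inIdeal_self (F := fun i η => adaptedSystem (fun η => Δ (C.jetMapInv η)) σ i
      (C.jetMap η)) (Sum.inl j)).congr (C.prolong_iterate hθ hΔ j).2.symm
  · exact (C.sideEq_inIdeal α hθ).trans fun ℓ =>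
      inIdeal_self (F := fun i η => adaptedSystem (fun η => Δ (C.jetMapInv η)) σ i
      (C.jetMap η)) (Sum.inr ℓ)

theorem adaptedSystem_inIdeal (hθ : θ ∈ C.jetSource m) (hΔ : SmoothNear Δ θ) (σ : ℕ)
    (i : Fin σ ⊕ SIdx (n + 1) m) :
    InIdeal (X.condSystem Δ σ)
      (fun η => adaptedSystem (fun η => Δ (C.jetMapInv η)) σ i (C.jetMap η)) θ := by
  rcases i with j | ℓ
  · exact (inIdeal_self (F := X.condSystem Δ σ) (Sum.inl j)).congr (C.prolong_iterate hθ hΔ j).2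
  · exact (C.sDeriv_inIdeal ℓ hθ).trans fun α =>
      inIdeal_self (F := X.condSystem Δ σ) (Sum.inr α)

theorem smoothNear_sideEq (hθ : θ ∈ C.jetSource m) (α : SIdx (n + 1) m) :
    SmoothNear (X.sideEq α) θ :=
  (C.sideEq_inIdeal α hθ).smoothNear fun ℓ =>
    ((contDiff_sDeriv ℓ).smoothNear _).comp (C.smoothNear_jetMap hθ)

theorem smoothNear_condSystem (hθ : θ ∈ C.jetSource m) (hΔ : SmoothNear Δ θ) (σ : ℕ)
    (i : Fin σ ⊕ SIdx (n + 1) m) : SmoothNear (X.condSystem Δ σ i) θ := by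
  rcases i with j | α
  · exact (C.prolong_iterate hθ hΔ j).1
  · exact C.smoothNear_sideEq hθ α

/-- X_Q u = 0 is always invariant: in adapted variables its consequences are combinations of the
v_s^{(ℓ)}, and ∂_s differentiates only the coefficients. -/
theorem prolong_sideEq_inIdeal (hθ : θ ∈ C.jetSource m) (α : SIdx (n + 1) m) :
    InIdeal (fun (α : SIdx (n + 1) m) => X.sideEq α) (X.prolong (X.sideEq α)) θ := by
  obtain ⟨G, hG, hsum⟩ := C.sideEq_inIdeal α hθ
  have hG' : ∀ ℓ, SmoothNear (fun η => G ℓ (C.jetMapInv η)) (C.jetMap θ) := fun ℓ =>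
    C.smoothNear_comp_jetMapInv hθ (hG ℓ)
  have h1 : (fun η => X.sideEq α (C.jetMapInv η)) =ᶠ[𝓝 (C.jetMap θ)]
      fun η => ∑ ℓ, G ℓ (C.jetMapInv η) * sDeriv ℓ η := by
    filter_upwards [(C.tendsto_jetMapInv hθ).eventually hsum,
      C.eventually_jetMap_jetMapInv hθ] with η h2 h3
    rw [h2]
    simp only [h3]
  have h2 : InIdeal (fun (ℓ : SIdx (n + 1) m) η => sDeriv ℓ η)
      (dirDeriv (sDir n m) fun η => X.sideEq α (C.jetMapInv η)) (C.jetMap θ) := by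
    refine ⟨fun ℓ => dirDeriv (sDir n m) (fun η => G ℓ (C.jetMapInv η)),
      fun ℓ => (hG' ℓ).dirDeriv _, (h1.dirDeriv _).trans ?_⟩
    filter_upwards [eventually_all.2 hG'] with η hη
    have hd : ∀ ℓ, DifferentiableAt ℝ (fun η => G ℓ (C.jetMapInv η)) η := fun ℓ =>
      (hη ℓ).differentiableAt (by simp)
    have hs : ∀ ℓ : SIdx (n + 1) m, DifferentiableAt ℝ (sDeriv (n := n) ℓ) η := fun ℓ =>
      (contDiff_sDeriv ℓ).differentiable (by simp) η
    have hm : ∀ ℓ, DifferentiableAt ℝ (fun η => G ℓ (C.jetMapInv η) * sDeriv ℓ η) η := fun ℓ =>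
      (hd ℓ).mul (hs ℓ)
    rw [dirDeriv_sum fun ℓ _ => hm ℓ]
    refine Finset.sum_congr rfl fun ℓ _ => ?_
    rw [dirDeriv_mul (hd ℓ) (hs ℓ), dirDeriv_sDir_sDeriv, mul_zero, add_zero]
  exact ((h2.comp (C.smoothNear_jetMap hθ)).congr
    (C.prolong_eventuallyEq hθ (C.smoothNear_sideEq hθ α)).symm).trans
      fun ℓ => C.sDeriv_inIdeal ℓ hθ

/-- The algebraic symmetry condition in adapted variables. -/
theorem isAlgebraicSymmetryNear_iff_inIdeal (hθ : θ ∈ C.jetSource m) (hΔ : SmoothNear Δ θ)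
    {σ : ℕ} (hσ : 1 ≤ σ) :
    X.IsAlgebraicSymmetryNear (X.condSystem Δ σ) θ ↔
      InIdeal (adaptedSystem (fun η => Δ (C.jetMapInv η)) σ)
        ((dirDeriv (sDir n m))^[σ] fun η => Δ (C.jetMapInv η)) (C.jetMap θ) := by
  rw [ProjectableField.isAlgebraicSymmetryNear_iff]
  constructor
  · intro h
    -- Only the last of the equations Δ^{(j)} = 0 carries information, since X^* maps each of the
    -- others to the next one.
    have h1 := h (Sum.inl ⟨σ - 1, by omega⟩)
    have h2 : X.prolong (X.condSystem Δ σ (Sum.inl ⟨σ - 1, by omega⟩)) = X.prolong^[σ] Δ := by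
      obtain ⟨k, rfl⟩ : ∃ k, σ = k + 1 := ⟨σ - 1, by omega⟩
      rw [Function.iterate_succ_apply']
      rfl
    rw [h2] at h1
    have h3 := ((h1.trans (C.condSystem_inIdeal hθ hΔ σ)).congr (C.prolong_iterate hθ hΔ σ).2)
    rw [← C.jetMapInv_jetMap hθ] at h3
    have h4 := h3.comp (C.smoothNear_jetMapInv (C.jetMap_mem hθ))
    refine (h4.congr ?_).trans fun i => (inIdeal_self i).congr ?_
    · filter_upwards [C.eventually_jetMap_jetMapInv hθ] with η hη
      rw [hη]
    · filter_upwards [C.eventually_jetMap_jetMapInv hθ] with η hη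
      rw [hη]
  · intro h i
    rcases i with j | α
    · have h2 : X.prolong (X.condSystem Δ σ (Sum.inl j)) = X.prolong^[(j : ℕ) + 1] Δ := by
        rw [Function.iterate_succ_apply']; rfl
      rw [h2]
      rcases Nat.lt_or_ge ((j : ℕ) + 1) σ with hj | hj
      · exact inIdeal_self (F := X.condSystem Δ σ) (Sum.inl ⟨(j : ℕ) + 1, hj⟩)
      · have hjσ : (j : ℕ) + 1 = σ := le_antisymm j.2 hj
        rw [hjσ]
        exact ((h.comp (C.smoothNear_jetMap hθ)).congr (C.prolong_iterate hθ hΔ σ).2.symm).trans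
          (C.adaptedSystem_inIdeal hθ hΔ σ)
    · exact (C.prolong_sideEq_inIdeal hθ α).trans fun β =>
        inIdeal_self (F := X.condSystem Δ σ) (Sum.inr β)

end AdaptedChart

/-! ### Fundamental systems of linear differential equations -/

section LinearODE

variable {A : Type} [NormedAddCommGroup A] [NormedSpace ℝ A] {σ : ℕ}

/-- The right-hand side of the first order system for `y^{(σ)} = ∑ g_i y^{(i)}`. -/
def companion (g y : Fin σ → ℝ) (j : Fin σ) : ℝ :=
  if h : (j : ℕ) + 1 < σ then y ⟨j + 1, h⟩ else ∑ i, g i * y i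

theorem companion_add (g y z : Fin σ → ℝ) :
    companion g (y + z) = companion g y + companion g z := by
  ext j
  simp only [companion, Pi.add_apply]
  split_ifs
  · rfl
  · simp [mul_add, Finset.sum_add_distrib]

theorem companion_smul (g y : Fin σ → ℝ) (c : ℝ) : companion g (c • y) = c • companion g y := by
  ext j
  simp only [companion, Pi.smul_apply, smul_eq_mul]
  split_ifs
  · rfl
  · rw [Finset.mul_sum]
    exact Finset.sum_congr rfl fun i _ => by ring

theorem companion_sum {ι : Type*} (s : Finset ι) (g : Fin σ → ℝ) (y : ι → Fin σ → ℝ) :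
    companion g (∑ i ∈ s, y i) = ∑ i ∈ s, companion g (y i) := by
  classical
  induction s using Finset.induction_on with
  | empty => simpa using companion_smul g 0 0
  | insert a s ha ih => rw [Finset.sum_insert ha, Finset.sum_insert ha, companion_add, ih]

/-- In 1 + M the 1 covers the shift rows and M the last row. -/
theorem lipschitzWith_companion {g : Fin σ → ℝ} {M : NNReal} (hg : ∑ i, |g i| ≤ M) :
    LipschitzWith (1 + M) (companion g) := by
  refine LipschitzWith.of_dist_le_mul fun y z => ?_
  have hsub : companion g y - companion g z = companion g (y - z) := by
    have h := companion_add g y ((-1 : ℝ) • z)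
    rw [companion_smul] at h
    simp only [neg_smul, one_smul, ← sub_eq_add_neg] at h
    exact h.symm
  rw [dist_eq_norm, dist_eq_norm, hsub, pi_norm_le_iff_of_nonneg (by positivity)]
  intro j
  unfold companion
  split_ifs with h
  · refine (norm_le_pi_norm _ _).trans ?_
    refine le_mul_of_one_le_left (norm_nonneg _) ?_
    push_cast
    linarith [M.2]
  · refine (norm_sum_le _ _).trans ?_
    calc ∑ i, ‖g i * (y - z) i‖ ≤ ∑ i, |g i| * ‖y - z‖ := by
          refine Finset.sum_le_sum fun i _ => ?_
          rw [norm_mul, Real.norm_eq_abs]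
          exact mul_le_mul_of_nonneg_left (norm_le_pi_norm _ _) (abs_nonneg _)
      _ ≤ _ := by
          rw [← Finset.sum_mul]
          refine mul_le_mul_of_nonneg_right ?_ (norm_nonneg _)
          push_cast
          linarith

/-- Solutions of the companion system with unit vectors as initial values at s₀; the variable in `A`
is a parameter of the equation. -/
theorem exists_fundamental_system [FiniteDimensional ℝ A] {g : Fin σ → ℝ × A → ℝ} {s₀ : ℝ} {a₀ : A}
    (hg : ∀ i, SmoothNear (g i) (s₀, a₀)) :
    ∃ Y : Fin σ → ℝ × A → Fin σ → ℝ, (∀ r, SmoothNear (Y r) (s₀, a₀)) ∧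
      (∀ r, ∀ᶠ a in 𝓝 a₀, Y r (s₀, a) = Pi.single r 1) ∧
      ∀ r, ∀ᶠ q in 𝓝 (s₀, a₀),
        HasDerivAt (fun t => Y r (t, q.2)) (companion (fun i => g i q) (Y r q)) q.1 := by
  have key : ∀ r : Fin σ, ∃ Y : ℝ × A → Fin σ → ℝ, SmoothNear Y (s₀, a₀) ∧
      (∀ᶠ a in 𝓝 a₀, Y (s₀, a) = Pi.single r 1) ∧ ∀ᶠ q in 𝓝 (s₀, a₀),
        HasDerivAt (fun t => Y (t, q.2)) (companion (fun i => g i q) (Y q)) q.1 := by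
    intro r
    set y₀ : Fin σ → ℝ := Pi.single r 1
    have hf : SmoothNear (fun w : ℝ × A × (Fin σ → ℝ) =>
        companion (fun i => g i (w.1, w.2.1)) w.2.2) (s₀, a₀, y₀) := by
      refine smoothNear_pi fun j => ?_
      unfold companion
      split_ifs with h
      · exact ContDiff.smoothNear (by fun_prop) _
      · refine SmoothNear.sum fun i _ => SmoothNear.mul ?_ (ContDiff.smoothNear (by fun_prop) _)
        exact SmoothNear.comp (f := fun w : ℝ × A × (Fin σ → ℝ) => (w.1, w.2.1)) (hg i)
          (ContDiff.smoothNear (by fun_prop) _)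
    obtain ⟨Y, h1, h2, h3⟩ := hf.exists_ode_solution
    have ht : Tendsto (fun q : ℝ × A => (q.1, q.2, y₀)) (𝓝 (s₀, a₀)) (𝓝 (s₀, a₀, y₀)) := by
      have : Continuous fun q : ℝ × A => (q.1, q.2, y₀) := by fun_prop
      exact this.tendsto (s₀, a₀)
    have ht' : Tendsto (fun a : A => (a, y₀)) (𝓝 a₀) (𝓝 (a₀, y₀)) :=
      Continuous.tendsto (by fun_prop) _
    refine ⟨fun q => Y (q.1, q.2, y₀), ?_, ht'.eventually h2, ht.eventually h3⟩
    exact SmoothNear.comp (f := fun q : ℝ × A => (q.1, q.2, y₀)) h1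
      (ContDiff.smoothNear (by fun_prop) _)
  choose Y h1 h2 h3 using key
  exact ⟨Y, h1, h2, h3⟩

/-- The solutions of a linear equation are combinations of the fundamental ones. -/
theorem eq_sum_fundamental {g : Fin σ → ℝ × A → ℝ} {s₀ : ℝ} {a₀ : A}
    (hg : ∀ i, SmoothNear (g i) (s₀, a₀)) {Y : Fin σ → ℝ × A → Fin σ → ℝ}
    (hY0 : ∀ r, ∀ᶠ a in 𝓝 a₀, Y r (s₀, a) = Pi.single r 1)
    (hY : ∀ r, ∀ᶠ q in 𝓝 (s₀, a₀),
      HasDerivAt (fun t => Y r (t, q.2)) (companion (fun i => g i q) (Y r q)) q.1)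
    {Z : ℝ × A → Fin σ → ℝ} (hZ : ∀ᶠ q in 𝓝 (s₀, a₀),
      HasDerivAt (fun t => Z (t, q.2)) (companion (fun i => g i q) (Z q)) q.1) :
    ∀ᶠ q in 𝓝 (s₀, a₀), Z q = ∑ r, Z (s₀, q.2) r • Y r q := by
  -- A strict bound at the base point persists nearby and gives one Lipschitz constant for the
  -- uniqueness theorem.
  obtain ⟨M, hM⟩ : ∃ M : NNReal, ∑ i, |g i (s₀, a₀)| < M :=
    ⟨(∑ i, |g i (s₀, a₀)|).toNNReal + 1, by
      push_cast
      linarith [Real.le_coe_toNNReal (∑ i, |g i (s₀, a₀)|)]⟩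
  have hbd : ∀ᶠ q in 𝓝 (s₀, a₀), ∑ i, |g i q| < M := by
    have : ContinuousAt (fun q => ∑ i, |g i q|) (s₀, a₀) :=
      tendsto_finsetSum _ fun i _ => (hg i).contDiffAt.continuousAt.abs
    exact this.eventually_lt_const hM
  obtain ⟨I, hI, U, hU, hIU⟩ := mem_nhds_prod_iff.1 (hbd.and (hZ.and (eventually_all.2 hY)))
  obtain ⟨ε, hε, hεI⟩ := Metric.mem_nhds_iff.1 hI
  have hev : ∀ᶠ q in 𝓝 (s₀, a₀), q.1 ∈ Metric.ball s₀ ε ∧ q.2 ∈ U ∧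
      ∀ r, Y r (s₀, q.2) = Pi.single r 1 := by
    have h1 : ∀ᶠ a in 𝓝 a₀, a ∈ U ∧ ∀ r, Y r (s₀, a) = Pi.single r 1 :=
      (show ∀ᶠ a in 𝓝 a₀, a ∈ U from hU).and (eventually_all.2 hY0)
    exact prod_mem_nhds (Metric.ball_mem_nhds _ hε) h1
  filter_upwards [hev] with q hq
  rcases q with ⟨t, a⟩
  obtain ⟨ht, ha, h0⟩ := hq
  simp only at ht ha h0
  rw [Real.ball_eq_Ioo] at ht hεI
  have huniq := ODE_solution_unique_of_mem_Ioo (t₀ := s₀) (s := fun _ => Set.univ)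
    (v := fun t => companion fun i => g i (t, a)) (K := 1 + M)
    (f := fun t => Z (t, a)) (g := fun t => ∑ r, Z (s₀, a) r • Y r (t, a))
    (a := s₀ - ε) (b := s₀ + ε)
    (fun t ht => (lipschitzWith_companion (hIU (Set.mk_mem_prod (hεI ht) ha)).1.le).lipschitzOnWith)
    ⟨by linarith, by linarith⟩
    (fun t ht => ⟨(hIU (Set.mk_mem_prod (hεI ht) ha)).2.1, trivial⟩)
    (fun t ht => ⟨by
      rw [companion_sum]
      simp only [companion_smul]
      exact HasDerivAt.fun_sum fun r _ =>
        ((hIU (Set.mk_mem_prod (hεI ht) ha)).2.2 r).const_smul (Z (s₀, a) r), trivial⟩)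
    (by
      simp only [h0]
      ext j
      simp [Finset.sum_apply, Pi.single_apply])
  exact huniq ht

end LinearODE

/-! ### The normal form in product coordinates -/

section NormalForm

variable {A : Type} [NormedAddCommGroup A] [NormedSpace ℝ A] {σ : ℕ}

/-- Iterated derivatives along a line through a function of `(s, a)`. -/
theorem iteratedDeriv_eventuallyEq {R : ℝ × A → ℝ} {q₀ : ℝ × A} (hR : SmoothNear R q₀) (j : ℕ) :
    ∀ᶠ q in 𝓝 q₀, iteratedDeriv j (fun s => R (s, q.2)) q.1
      = (dirDeriv ((1 : ℝ), (0 : A)))^[j] R q := by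
  induction j with
  | zero => simp
  | succ j ih =>
    filter_upwards [ih.eventually_nhds, hR.dirDeriv_iterate ((1 : ℝ), (0 : A)) j] with q h1 h2
    rw [iteratedDeriv_succ, Function.iterate_succ_apply']
    have h3 : iteratedDeriv j (fun s => R (s, q.2)) =ᶠ[𝓝 q.1]
        fun s => (dirDeriv ((1 : ℝ), (0 : A)))^[j] R (s, q.2) := by
      have : Tendsto (fun s : ℝ => (s, q.2)) (𝓝 q.1) (𝓝 q) := by
        have : Continuous fun s : ℝ => (s, q.2) := by fun_prop
        exact this.tendsto q.1
      exact this.eventually h1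
    rw [h3.deriv_eq]
    have h4 : HasDerivAt (fun s => (dirDeriv ((1 : ℝ), (0 : A)))^[j] R (s, q.2))
        (fderiv ℝ ((dirDeriv ((1 : ℝ), (0 : A)))^[j] R) q ((1 : ℝ), (0 : A))) q.1 := by
      have h5 : HasFDerivAt ((dirDeriv ((1 : ℝ), (0 : A)))^[j] R)
        (fderiv ℝ ((dirDeriv ((1 : ℝ), (0 : A)))^[j] R) q) (q.1, q.2) :=
        (h2.differentiableAt (by simp)).hasFDerivAt
      exact h5.comp_hasDerivAt q.1 ((hasDerivAt_id q.1).prodMk (hasDerivAt_const q.1 q.2))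
    exact h4.deriv

end NormalForm

/-! ### Smoothness of determinants and adjugates -/

section Det

variable {E : Type*} [NormedAddCommGroup E] [NormedSpace ℝ E] {σ : ℕ}

theorem SmoothNear.prod {ι : Type*} {s : Finset ι} {f : ι → E → ℝ} {x : E}
    (hf : ∀ i ∈ s, SmoothNear (f i) x) : SmoothNear (fun y => ∏ i ∈ s, f i y) x := by
  filter_upwards [(Finset.eventually_all s).2 hf] with y hy using contDiffAt_prod hy

theorem smoothNear_det {M : E → Matrix (Fin σ) (Fin σ) ℝ} {x : E}
    (hM : ∀ i j, SmoothNear (fun y => M y i j) x) : SmoothNear (fun y => (M y).det) x := by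
  simp only [Matrix.det_apply']
  exact SmoothNear.sum fun τ _ => (smoothNear_const _ _).mul (SmoothNear.prod fun i _ => hM _ _)

theorem smoothNear_adjugate {M : E → Matrix (Fin σ) (Fin σ) ℝ} {x : E}
    (hM : ∀ i j, SmoothNear (fun y => M y i j) x) (i j : Fin σ) :
    SmoothNear (fun y => (M y).adjugate i j) x := by
  simp only [Matrix.adjugate_apply]
  refine smoothNear_det fun k l => ?_
  by_cases hk : k = j
  · subst hk
    simpa only [Matrix.updateRow_self] using smoothNear_const _ x
  · simpa only [Matrix.updateRow_ne hk] using hM k l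

end Det

section NormalForm

variable {A L : Type} [NormedAddCommGroup A] [NormedSpace ℝ A] [Fintype L] {σ : ℕ}

/-- The direction of `s` in the space of the `(s, a, η)`. -/
def prodDir (A L : Type) [NormedAddCommGroup A] : ℝ × A × (L → ℝ) := (1, 0, 0)

/-- The system `F = ∂_s F = ⋯ = 0`, `η = 0` for a function of `(s, a, η)`. -/
def prodSystem (F : ℝ × A × (L → ℝ) → ℝ) (σ : ℕ) : Fin σ ⊕ L → ℝ × A × (L → ℝ) → ℝ :=
  Sum.elim (fun j => (dirDeriv (prodDir A L))^[(j : ℕ)] F) (fun ℓ q => q.2.2 ℓ)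

/-- `F = ∑_r R_r(s, a) K_r(a) + ∑_ℓ Θ_ℓ(s, a, η) η_ℓ` near `p`, with smooth functions, and with
`s`-derivatives of the `R_r` that form an invertible matrix. -/
structure IsProdForm (F : ℝ × A × (L → ℝ) → ℝ) (p : ℝ × A × (L → ℝ)) (R : Fin σ → ℝ × A → ℝ)
    (K : Fin σ → A → ℝ) (Θ : L → ℝ × A × (L → ℝ) → ℝ) : Prop where
  smooth_R : ∀ r, SmoothNear (R r) (p.1, p.2.1)
  smooth_K : ∀ r, SmoothNear (K r) p.2.1
  smooth_Θ : ∀ ℓ, SmoothNear (Θ ℓ) p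
  det_ne_zero : (Matrix.of fun j r : Fin σ =>
    (dirDeriv ((1 : ℝ), (0 : A)))^[(j : ℕ)] (R r) (p.1, p.2.1)).det ≠ 0
  eq : F =ᶠ[𝓝 p] fun q => ∑ r, R r (q.1, q.2.1) * K r q.2.1 + ∑ ℓ, Θ ℓ q * q.2.2 ℓ

theorem dirDeriv_prodDir_fst {ρ : ℝ × A → ℝ} {q : ℝ × A × (L → ℝ)}
    (h : DifferentiableAt ℝ ρ (q.1, q.2.1)) :
    dirDeriv (prodDir A L) (fun q => ρ (q.1, q.2.1)) q
      = dirDeriv ((1 : ℝ), (0 : A)) ρ (q.1, q.2.1) := by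
  have h1 : HasFDerivAt (fun q : ℝ × A × (L → ℝ) => (q.1, q.2.1))
      ((ContinuousLinearMap.fst ℝ ℝ (A × (L → ℝ))).prod
        ((ContinuousLinearMap.fst ℝ A (L → ℝ)).comp
          (ContinuousLinearMap.snd ℝ ℝ (A × (L → ℝ))))) q :=
    ((ContinuousLinearMap.fst ℝ ℝ (A × (L → ℝ))).prod
        ((ContinuousLinearMap.fst ℝ A (L → ℝ)).comp
          (ContinuousLinearMap.snd ℝ ℝ (A × (L → ℝ))))).hasFDerivAt
  have h2 := HasFDerivAt.comp (g := ρ) q h.hasFDerivAt h1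
  have h3 : fderiv ℝ (fun q : ℝ × A × (L → ℝ) => ρ (q.1, q.2.1)) q = _ := h2.fderiv
  rw [dirDeriv, h3]
  rfl

theorem dirDeriv_prodDir_mid {K : A → ℝ} {q : ℝ × A × (L → ℝ)}
    (h : DifferentiableAt ℝ K q.2.1) :
    dirDeriv (prodDir A L) (fun q => K q.2.1) q = 0 := by
  have h1 : HasFDerivAt (fun q : ℝ × A × (L → ℝ) => q.2.1)
      ((ContinuousLinearMap.fst ℝ A (L → ℝ)).comp
          (ContinuousLinearMap.snd ℝ ℝ (A × (L → ℝ)))) q :=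
    ((ContinuousLinearMap.fst ℝ A (L → ℝ)).comp
          (ContinuousLinearMap.snd ℝ ℝ (A × (L → ℝ)))).hasFDerivAt
  have h2 := HasFDerivAt.comp (g := K) q h.hasFDerivAt h1
  have h3 : fderiv ℝ (fun q : ℝ × A × (L → ℝ) => K q.2.1) q = _ := h2.fderiv
  rw [dirDeriv, h3]
  exact map_zero (fderiv ℝ K q.2.1)

theorem dirDeriv_prodDir_snd (ℓ : L) (q : ℝ × A × (L → ℝ)) :
    dirDeriv (prodDir A L) (fun q => q.2.2 ℓ) q = 0 := by
  have h1 : HasFDerivAt (fun q : ℝ × A × (L → ℝ) => q.2.2 ℓ)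
      ((ContinuousLinearMap.proj (R := ℝ) (φ := fun _ : L => ℝ) ℓ).comp
        ((ContinuousLinearMap.snd ℝ A (L → ℝ)).comp
          (ContinuousLinearMap.snd ℝ ℝ (A × (L → ℝ))))) q :=
    ((ContinuousLinearMap.proj (R := ℝ) (φ := fun _ : L => ℝ) ℓ).comp
        ((ContinuousLinearMap.snd ℝ A (L → ℝ)).comp
          (ContinuousLinearMap.snd ℝ ℝ (A × (L → ℝ))))).hasFDerivAt
  rw [dirDeriv, h1.fderiv]
  rfl

namespace IsProdForm

variable {F : ℝ × A × (L → ℝ) → ℝ} {p : ℝ × A × (L → ℝ)} {R : Fin σ → ℝ × A → ℝ}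
  {K : Fin σ → A → ℝ} {Θ : L → ℝ × A × (L → ℝ) → ℝ}

theorem _root_.tendsto_fst_mid (p : ℝ × A × (L → ℝ)) :
    Tendsto (fun q : ℝ × A × (L → ℝ) => (q.1, q.2.1)) (𝓝 p) (𝓝 (p.1, p.2.1)) :=
  Continuous.tendsto (by fun_prop) p

theorem _root_.smoothNear_fst_mid (p : ℝ × A × (L → ℝ)) :
    SmoothNear (fun q : ℝ × A × (L → ℝ) => (q.1, q.2.1)) p :=
  ContDiff.smoothNear (by fun_prop) p

/-- ∂_s acts only on the R_r and Θ_ℓ, because K_r and η do not depend on s. -/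
theorem iterate_eq (h : IsProdForm F p R K Θ) (j : ℕ) :
    (dirDeriv (prodDir A L))^[j] F =ᶠ[𝓝 p] fun q =>
      ∑ r, (dirDeriv ((1 : ℝ), (0 : A)))^[j] (R r) (q.1, q.2.1) * K r q.2.1
        + ∑ ℓ, (dirDeriv (prodDir A L))^[j] (Θ ℓ) q * q.2.2 ℓ := by
  induction j with
  | zero => exact h.eq
  | succ j ih =>
    simp only [Function.iterate_succ_apply']
    refine (ih.dirDeriv _).trans ?_
    have hR := (tendsto_fst_mid p).eventually (eventually_all.2 fun r =>
      (h.smooth_R r).dirDeriv_iterate ((1 : ℝ), (0 : A)) j)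
    have hK : ∀ᶠ q in 𝓝 p, ∀ r, ContDiffAt ℝ ∞ (K r) q.2.1 :=
      (Continuous.tendsto (f := fun q : ℝ × A × (L → ℝ) => q.2.1) (by fun_prop) p).eventually
        (eventually_all.2 h.smooth_K)
    have hΘ := eventually_all.2 fun ℓ => (h.smooth_Θ ℓ).dirDeriv_iterate (prodDir A L) j
    filter_upwards [hR, hK, hΘ] with q h1 h2 h3
    have d1 : ∀ r, DifferentiableAt ℝ
        (fun q : ℝ × A × (L → ℝ) =>
          (dirDeriv ((1 : ℝ), (0 : A)))^[j] (R r) (q.1, q.2.1)) q := fun r =>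
      DifferentiableAt.comp (g := (dirDeriv ((1 : ℝ), (0 : A)))^[j] (R r)) q
        ((h1 r).differentiableAt (by simp)) (by fun_prop)
    have d2 : ∀ r, DifferentiableAt ℝ (fun q : ℝ × A × (L → ℝ) => K r q.2.1) q := fun r =>
      DifferentiableAt.comp (g := K r) q ((h2 r).differentiableAt (by simp)) (by fun_prop)
    have d3 : ∀ ℓ, DifferentiableAt ℝ ((dirDeriv (prodDir A L))^[j] (Θ ℓ)) q := fun ℓ =>
      (h3 ℓ).differentiableAt (by simp)
    have d4 : ∀ ℓ, DifferentiableAt ℝ (fun q : ℝ × A × (L → ℝ) => q.2.2 ℓ) q := fun ℓ => by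
      fun_prop
    have d12 := fun r => (d1 r).fun_mul (d2 r)
    have d34 := fun ℓ => (d3 ℓ).fun_mul (d4 ℓ)
    rw [dirDeriv_add (DifferentiableAt.fun_sum fun r _ => d12 r)
      (DifferentiableAt.fun_sum fun ℓ _ => d34 ℓ), dirDeriv_sum fun r _ => d12 r,
      dirDeriv_sum fun ℓ _ => d34 ℓ]
    congr 1
    · refine Finset.sum_congr rfl fun r _ => ?_
      rw [dirDeriv_mul (d1 r) (d2 r), dirDeriv_prodDir_mid ((h2 r).differentiableAt (by simp)),
        dirDeriv_prodDir_fst ((h1 r).differentiableAt (by simp))]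
      ring
    · refine Finset.sum_congr rfl fun ℓ _ => ?_
      rw [dirDeriv_mul (d3 ℓ) (d4 ℓ), dirDeriv_prodDir_snd]
      ring

/-- The derivatives of order j < σ show that W K lies in the ideal, where W is the Wronskian matrix.
As W is invertible, each K_r lies in it, and so does ∂_s^σ F by `iterate_eq`. -/
theorem inIdeal (h : IsProdForm F p R K Θ) :
    InIdeal (prodSystem F σ) ((dirDeriv (prodDir A L))^[σ] F) p := by
  set W : ℝ × A × (L → ℝ) → Matrix (Fin σ) (Fin σ) ℝ := fun q => Matrix.of fun j r =>
    (dirDeriv ((1 : ℝ), (0 : A)))^[(j : ℕ)] (R r) (q.1, q.2.1) with hW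
  have hWs : ∀ j r, SmoothNear (fun q => W q j r) p := fun j r =>
    SmoothNear.comp (g := (dirDeriv ((1 : ℝ), (0 : A)))^[(j : ℕ)] (R r))
      ((h.smooth_R r).dirDeriv_iterate _ _) (smoothNear_fst_mid p)
  have hdet := smoothNear_det hWs
  have hdet0 : (W p).det ≠ 0 := h.det_ne_zero
  have hη : ∀ ℓ, InIdeal (prodSystem F σ) (fun q => q.2.2 ℓ) p := fun ℓ =>
    inIdeal_self (F := prodSystem F σ) (Sum.inr ℓ)
  have hrest : ∀ j : ℕ, InIdeal (prodSystem F σ)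
      (fun q => ∑ ℓ, (dirDeriv (prodDir A L))^[j] (Θ ℓ) q * q.2.2 ℓ) p := fun j =>
    InIdeal.sum fun ℓ _ => (hη ℓ).mul_left ((h.smooth_Θ ℓ).dirDeriv_iterate _ _)
  have hWK : ∀ j : Fin σ, InIdeal (prodSystem F σ) (fun q => ∑ r, W q j r * K r q.2.1) p := by
    intro j
    refine ((inIdeal_self (F := prodSystem F σ) (Sum.inl j)).sub (hrest j)).congr ?_
    filter_upwards [h.iterate_eq j] with q hq
    change (dirDeriv (prodDir A L))^[(j : ℕ)] F q - _ = _
    rw [hq, add_sub_cancel_right]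
    rfl
  have hK : ∀ r, InIdeal (prodSystem F σ) (fun q => K r q.2.1) p := by
    intro r
    refine (InIdeal.sum (s := Finset.univ) fun j _ =>
      (hWK j).mul_left ((hdet.inv hdet0).mul (smoothNear_adjugate hWs r j))).congr ?_
    filter_upwards [hdet.contDiffAt.continuousAt.eventually_ne hdet0] with q hq
    -- Cramer's rule: adjugate and inverse determinant keep the coefficients smooth.
    have h1 : ∑ j, (W q).adjugate r j * ∑ r, W q j r * K r q.2.1 = (W q).det * K r q.2.1 := by
      have := congrFun (congrArg (fun M => Matrix.mulVec M fun r => K r q.2.1)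
        (Matrix.adjugate_mul (W q))) r
      rw [← Matrix.mulVec_mulVec] at this
      simpa [Matrix.mulVec, dotProduct, Matrix.one_apply, Finset.mul_sum] using this
    simp only [mul_assoc]
    rw [← Finset.mul_sum, h1, inv_mul_cancel_left₀ hq]
  refine InIdeal.congr (InIdeal.add (InIdeal.sum (s := Finset.univ) fun r _ => (hK r).mul_left
    (SmoothNear.comp (g := (dirDeriv ((1 : ℝ), (0 : A)))^[σ] (R r))
      ((h.smooth_R r).dirDeriv_iterate _ _) (smoothNear_fst_mid p))) (hrest σ)) ?_
  exact (h.iterate_eq σ).symm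

end IsProdForm

/-- The companion system says that each component is the derivative of the preceding one. -/
theorem iterate_fundamental {g : Fin σ → ℝ × A → ℝ} {q₀ : ℝ × A}
    {Y : ℝ × A → Fin σ → ℝ} (hYs : SmoothNear Y q₀)
    (hY : ∀ᶠ q in 𝓝 q₀,
      HasDerivAt (fun t => Y (t, q.2)) (companion (fun i => g i q) (Y q)) q.1)
    (hσ : 0 < σ) (j : ℕ) (hj : j < σ) :
    (dirDeriv ((1 : ℝ), (0 : A)))^[j] (fun q => Y q ⟨0, hσ⟩) =ᶠ[𝓝 q₀] fun q => Y q ⟨j, hj⟩ := by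
  induction j with
  | zero => exact EventuallyEq.rfl
  | succ j ih =>
    rw [Function.iterate_succ_apply']
    refine ((ih (by omega)).dirDeriv _).trans ?_
    filter_upwards [hY, hYs] with q h1 h2
    have h3 : HasFDerivAt (fun q => Y q ⟨j, by omega⟩)
        (fderiv ℝ (fun q => Y q ⟨j, by omega⟩) q) (q.1, q.2) :=
      ((contDiffAt_pi.1 h2 _).differentiableAt (by simp)).hasFDerivAt
    have h4 := h3.comp_hasDerivAt q.1 ((hasDerivAt_id q.1).prodMk (hasDerivAt_const q.1 q.2))
    have h5 := h4.unique (hasDerivAt_pi.1 h1 ⟨j, by omega⟩)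
    rw [dirDeriv, h5, companion, dif_pos hj]

/-- At s₀ the Wronskian matrix consists of the initial values and is the identity. -/
theorem det_fundamental {g : Fin σ → ℝ × A → ℝ} {s₀ : ℝ} {a₀ : A}
    {Y : Fin σ → ℝ × A → Fin σ → ℝ} (hYs : ∀ r, SmoothNear (Y r) (s₀, a₀))
    (hY0 : ∀ r, ∀ᶠ a in 𝓝 a₀, Y r (s₀, a) = Pi.single r 1)
    (hY : ∀ r, ∀ᶠ q in 𝓝 (s₀, a₀),
      HasDerivAt (fun t => Y r (t, q.2)) (companion (fun i => g i q) (Y r q)) q.1)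
    (hσ : 0 < σ) :
    (Matrix.of fun j r : Fin σ => (dirDeriv ((1 : ℝ), (0 : A)))^[(j : ℕ)]
      (fun q => Y r q ⟨0, hσ⟩) (s₀, a₀)).det ≠ 0 := by
  have h : (Matrix.of fun j r : Fin σ => (dirDeriv ((1 : ℝ), (0 : A)))^[(j : ℕ)]
      (fun q => Y r q ⟨0, hσ⟩) (s₀, a₀)) = 1 := by
    ext j r
    rw [Matrix.of_apply, (iterate_fundamental (hYs r) (hY r) hσ j j.2).self_of_nhds,
      Matrix.one_apply]
    change Y r (s₀, a₀) j = _
    rw [(hY0 r).self_of_nhds, Pi.single_apply]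
  rw [h, Matrix.det_one]
  exact one_ne_zero

/-- On η = 0 the ideal condition reads ∂_s^σ F = ∑ g_j ∂_s^j F. Hence F(s, a, 0) = ∑ R_r(s, a) ∂_s^r
F(s₀, a, 0) with fundamental solutions R_r, and the initial values are the K_r. Hadamard's lemma
accounts for F(s, a, η) - F(s, a, 0). -/
theorem exists_isProdForm [FiniteDimensional ℝ A] (hσ : 0 < σ) {F : ℝ × A × (L → ℝ) → ℝ}
    {p : ℝ × A × (L → ℝ)} (hF : SmoothNear F p)
    (h : InIdeal (prodSystem F σ) ((dirDeriv (prodDir A L))^[σ] F) p) :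
    ∃ (R : Fin σ → ℝ × A → ℝ) (K : Fin σ → A → ℝ) (Θ : L → ℝ × A × (L → ℝ) → ℝ),
      IsProdForm F p R K Θ := by
  obtain ⟨s₀, a₀, η₀⟩ := p
  by_cases h0 : η₀ = 0
  · subst h0
    obtain ⟨G, hG, hsum⟩ := h
    have hz : SmoothNear (fun q : ℝ × A => ((q.1, q.2, 0) : ℝ × A × (L → ℝ))) (s₀, a₀) :=
      ContDiff.smoothNear (by fun_prop) _
    have hzt : Tendsto (fun q : ℝ × A => ((q.1, q.2, 0) : ℝ × A × (L → ℝ))) (𝓝 (s₀, a₀))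
        (𝓝 (s₀, a₀, 0)) := hz.contDiffAt.continuousAt
    set g : Fin σ → ℝ × A → ℝ := fun j q => G (Sum.inl j) (q.1, q.2, 0)
    have hg : ∀ j, SmoothNear (g j) (s₀, a₀) := fun j =>
      SmoothNear.comp (g := G (Sum.inl j)) (hG (Sum.inl j)) hz
    obtain ⟨Y, hYs, hY0, hY⟩ := exists_fundamental_system hg
    set Z : ℝ × A → Fin σ → ℝ := fun q j =>
      (dirDeriv (prodDir A L))^[(j : ℕ)] F (q.1, q.2, 0) with hZdef
    have hZ : ∀ᶠ q in 𝓝 (s₀, a₀),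
        HasDerivAt (fun t => Z (t, q.2)) (companion (fun i => g i q) (Z q)) q.1 := by
      have hs := eventually_all.2 fun j : Fin σ => hF.dirDeriv_iterate (prodDir A L) j
      filter_upwards [hzt.eventually hs, hzt.eventually hsum] with q h1 h2
      refine hasDerivAt_pi.2 fun j => ?_
      have h3 : HasFDerivAt ((dirDeriv (prodDir A L))^[(j : ℕ)] F)
          (fderiv ℝ ((dirDeriv (prodDir A L))^[(j : ℕ)] F) (q.1, q.2, 0)) (q.1, q.2, 0) :=
        ((h1 j).differentiableAt (by simp)).hasFDerivAt
      have h4 := h3.comp_hasDerivAt q.1 ((hasDerivAt_id q.1).prodMk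
        (hasDerivAt_const q.1 ((q.2, 0) : A × (L → ℝ))))
      have h5 : companion (fun i => g i q) (Z q) j
          = (dirDeriv (prodDir A L))^[(j : ℕ) + 1] F (q.1, q.2, 0) := by
        rw [companion]
        split_ifs with hj
        · rfl
        · have : (j : ℕ) + 1 = σ := by omega
          rw [this, h2]
          simp [Fintype.sum_sum_type, prodSystem, g, hZdef]
      rw [h5, Function.iterate_succ_apply']
      exact h4
    have hFZ := eq_sum_fundamental hg hY0 hY hZ
    have hassoc : SmoothNear (fun q : (ℝ × A) × (L → ℝ) => F (q.1.1, q.1.2, q.2))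
        ((s₀, a₀), 0) :=
      SmoothNear.comp (f := fun q : (ℝ × A) × (L → ℝ) => (q.1.1, q.1.2, q.2)) (g := F) hF
        (ContDiff.smoothNear (by fun_prop) _)
    obtain ⟨Θ, hΘ, hΘsum⟩ := hassoc.hadamard
    refine ⟨fun r q => Y r q ⟨0, hσ⟩, fun r a => (dirDeriv (prodDir A L))^[(r : ℕ)] F (s₀, a, 0),
      fun ℓ q => Θ ℓ ((q.1, q.2.1), q.2.2), ⟨fun r => (hYs r).apply _, fun r => ?_, fun ℓ => ?_,
      det_fundamental hYs hY0 hY hσ, ?_⟩⟩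
    · exact SmoothNear.comp (g := (dirDeriv (prodDir A L))^[(r : ℕ)] F)
        (f := fun a : A => ((s₀, a, 0) : ℝ × A × (L → ℝ))) (hF.dirDeriv_iterate _ _)
        (ContDiff.smoothNear (by fun_prop) _)
    · exact SmoothNear.comp (g := Θ ℓ)
        (f := fun q : ℝ × A × (L → ℝ) => ((q.1, q.2.1), q.2.2)) (hΘ ℓ)
        (ContDiff.smoothNear (by fun_prop) _)
    · have ht : Tendsto (fun q : ℝ × A × (L → ℝ) => ((q.1, q.2.1), q.2.2)) (𝓝 (s₀, a₀, 0))
          (𝓝 ((s₀, a₀), 0)) :=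
        Continuous.tendsto (f := fun q : ℝ × A × (L → ℝ) => ((q.1, q.2.1), q.2.2))
          (by fun_prop) (s₀, a₀, 0)
      filter_upwards [ht.eventually hΘsum, (tendsto_fst_mid _).eventually hFZ] with q h1 h2
      have h3 := congrFun h2 ⟨0, hσ⟩
      simp only [hZdef, Function.iterate_zero, id, Finset.sum_apply, Pi.smul_apply,
        smul_eq_mul] at h3
      rw [show q = (q.1, q.2.1, q.2.2) from rfl, h1, h3]
      congr 1
      exact Finset.sum_congr rfl fun r _ => mul_comm _ _
  · obtain ⟨ℓ, hℓ⟩ : ∃ ℓ, η₀ ℓ ≠ 0 := by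
      by_contra! hne
      exact h0 (funext hne)
    -- Where some η_ℓ ≠ 0, F is a multiple of η_ℓ and K = 0 will do. Any R_r with non-zero Wronskian
    -- complete the form, such as the fundamental solutions of y^{(σ)} = 0.
    obtain ⟨Y, hYs, hY0, hY⟩ := exists_fundamental_system (σ := σ) (g := fun _ _ => 0)
      (s₀ := s₀) (a₀ := a₀) fun _ => smoothNear_const _ _
    obtain ⟨Θ, hΘ, hsum⟩ := inIdeal_of_ne_zero (F := fun (ℓ : L) (q : ℝ × A × (L → ℝ)) => q.2.2 ℓ)
      (i := ℓ) (ContDiff.smoothNear (by fun_prop) _) hℓ hF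
    refine ⟨fun r q => Y r q ⟨0, hσ⟩, fun _ _ => 0, Θ, ⟨fun r => (hYs r).apply _,
      fun r => smoothNear_const _ _, hΘ, det_fundamental hYs hY0 hY hσ, ?_⟩⟩
    simpa using hsum

end NormalForm

/-! ### Splitting an adapted jet into s, its z-part and the v_s^{(ℓ)} -/

section Split

variable {n m : ℕ}

/-- The jet with given `s`, `z`-part and `v_s^{(ℓ)}`. -/
def joinJet (q : ℝ × Jet n m × (SIdx (n + 1) m → ℝ)) : Jet (n + 1) m :=
  (Fin.cons q.1 q.2.1.1, fun α =>
    if h : α.1 0 = 0 then q.2.1.2 ⟨Fin.tail α.1, by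
      have := α.2
      rw [Fin.sum_univ_succ, h, zero_add] at this
      exact this⟩
    else q.2.2 ⟨α.1 - Pi.single 0 1, by
      have := α.2
      rw [Fin.sum_univ_succ] at this ⊢
      simp only [Pi.sub_apply, Pi.single_eq_same, ne_eq, Fin.succ_ne_zero, not_false_eq_true,
        Pi.single_eq_of_ne, tsub_zero]
      omega⟩)

/-- An adapted jet consists of `s`, its `z`-part and the `v_s^{(ℓ)}`. -/
def splitJet (n m : ℕ) :
    Jet (n + 1) m ≃L[ℝ] ℝ × Jet n m × (SIdx (n + 1) m → ℝ) :=
  LinearEquiv.toContinuousLinearEquiv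
    { toFun := fun θ => (θ.1 0, zPart θ, fun ℓ => sDeriv ℓ θ)
      map_add' := fun _ _ => rfl
      map_smul' := fun _ _ => rfl
      invFun := joinJet
      left_inv := fun θ => by
        refine Prod.ext (Fin.cons_self_tail θ.1) (funext fun α => ?_)
        by_cases h : α.1 0 = 0
        · simp only [joinJet, h, dif_pos, zPart]
          refine congrArg θ.2 (Subtype.ext ?_)
          change Fin.cons 0 (Fin.tail α.1) = α.1
          rw [← h]
          exact Fin.cons_self_tail α.1
        · simp only [joinJet, h, dif_neg, not_false_eq_true, sDeriv]
          refine congrArg θ.2 (Subtype.ext (funext fun i => ?_))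
          refine Fin.cases ?_ (fun i => ?_) i
          · simp only [Pi.add_apply, Pi.sub_apply, Pi.single_eq_same]
            omega
          · simp
      right_inv := fun q => by
        refine Prod.ext rfl (Prod.ext (Prod.ext (by simp [zPart, joinJet])
          (funext fun β => ?_)) (funext fun ℓ => ?_))
        · simp [zPart, joinJet]
        · simp [sDeriv, joinJet] }

theorem splitJet_apply (θ : Jet (n + 1) m) :
    splitJet n m θ = (θ.1 0, zPart θ, fun ℓ => sDeriv ℓ θ) := rfl

theorem splitJet_sDir : splitJet n m (AdaptedChart.sDir n m) = prodDir (Jet n m) _ := rfl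

theorem dirDeriv_comp_equiv {E E' : Type*} [NormedAddCommGroup E] [NormedSpace ℝ E]
    [NormedAddCommGroup E'] [NormedSpace ℝ E'] (e : E ≃L[ℝ] E') (f : E' → ℝ) (v : E) :
    dirDeriv v (fun x => f (e x)) = fun x => dirDeriv (e v) f (e x) := by
  ext x
  have h := e.comp_right_fderiv (f := f) (x := x)
  have h' : fderiv ℝ (fun x => f (e x)) x = _ := h
  rw [dirDeriv, h']
  rfl

theorem iterate_dirDeriv_comp_equiv {E E' : Type*} [NormedAddCommGroup E] [NormedSpace ℝ E]
    [NormedAddCommGroup E'] [NormedSpace ℝ E'] (e : E ≃L[ℝ] E') (f : E' → ℝ) (v : E) (k : ℕ) :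
    (dirDeriv v)^[k] (fun x => f (e x)) = fun x => (dirDeriv (e v))^[k] f (e x) := by
  induction k with
  | zero => rfl
  | succ k ih => rw [Function.iterate_succ_apply', ih, dirDeriv_comp_equiv,
      Function.iterate_succ_apply']

/-- Images of open sets of jets are open, so smoothness of R and K on such images is smoothness near
each point. -/
theorem isOpenMap_szPart : IsOpenMap (szPart : Jet (n + 1) m → ℝ × Jet n m) := by
  have h : IsOpenMap fun q : ℝ × Jet n m × (SIdx (n + 1) m → ℝ) => (q.1, q.2.1) :=
    IsOpenMap.id.prodMap isOpenMap_fst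
  exact h.comp (splitJet n m).toHomeomorph.isOpenMap

theorem isOpenMap_zPart : IsOpenMap (zPart : Jet (n + 1) m → Jet n m) :=
  isOpenMap_snd.comp isOpenMap_szPart

theorem continuous_szPart : Continuous (szPart : Jet (n + 1) m → ℝ × Jet n m) := by
  have h : Continuous fun q : ℝ × Jet n m × (SIdx (n + 1) m → ℝ) => (q.1, q.2.1) := by fun_prop
  exact h.comp (splitJet n m).continuous

theorem continuous_zPart : Continuous (zPart : Jet (n + 1) m → Jet n m) :=
  continuous_snd.comp continuous_szPart

/-- The algebraic condition in terms of the split coordinates. -/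
theorem adaptedSystem_inIdeal_iff (F : Jet (n + 1) m → ℝ) (σ : ℕ) (θ : Jet (n + 1) m) :
    InIdeal (AdaptedChart.adaptedSystem F σ) ((dirDeriv (AdaptedChart.sDir n m))^[σ] F) θ ↔
      InIdeal (prodSystem (fun q => F ((splitJet n m).symm q)) σ)
        ((dirDeriv (prodDir (Jet n m) _))^[σ] fun q => F ((splitJet n m).symm q))
        (splitJet n m θ) := by
  have hsymm : ∀ k, ((dirDeriv (prodDir (Jet n m) (SIdx (n + 1) m)))^[k]
      fun q => F ((splitJet n m).symm q)) =
      fun q => (dirDeriv (AdaptedChart.sDir n m))^[k] F ((splitJet n m).symm q) := fun k => by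
    rw [iterate_dirDeriv_comp_equiv, ← splitJet_sDir, ContinuousLinearEquiv.symm_apply_apply]
  have hsys : prodSystem (fun q => F ((splitJet n m).symm q)) σ = fun i q =>
      AdaptedChart.adaptedSystem F σ i ((splitJet n m).symm q) := by
    ext i q
    rcases i with j | ℓ
    · exact congrFun (hsymm j) q
    · have h := congrArg (fun w => w.2.2 ℓ) ((splitJet n m).apply_symm_apply q)
      exact h.symm
  rw [hsymm, hsys]
  constructor
  · intro h
    rw [← (splitJet n m).symm_apply_apply θ] at h
    exact h.comp ((splitJet n m).symm.contDiff.smoothNear _)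
  · intro h
    have h1 := h.comp ((splitJet n m).contDiff.smoothNear θ)
    simpa only [ContinuousLinearEquiv.symm_apply_apply] using h1

end Split

/-! ### Equivalence of normal forms and algebraic symmetries -/

section WeakForm

variable {n m : ℕ} {X : ProjectableField (n + 1)} {C : AdaptedChart X}
  {D : Set (Jet (n + 1) m)} {Δ : Jet (n + 1) m → ℝ} {θ₀ : Jet (n + 1) m} {σ : ℕ}

/-- Passage between the form on an open set of jets and its germ in split coordinates. The
Wronskian, written with iterated derivatives along the s-line on one side, uses the directional
derivative ∂_s on the other. -/
theorem hasWeakForm_iff_exists_isProdForm (hD : IsOpen D) (hθD : θ₀ ∈ D)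
    (hθ : θ₀ ∈ C.jetSource m) :
    HasWeakForm C D Δ σ θ₀ ↔ ∃ (R : Fin σ → ℝ × Jet n m → ℝ) (K : Fin σ → Jet n m → ℝ)
      (Θ : SIdx (n + 1) m → ℝ × Jet n m × (SIdx (n + 1) m → ℝ) → ℝ),
      IsProdForm (fun q => Δ (C.jetMapInv ((splitJet n m).symm q)))
        (splitJet n m (C.jetMap θ₀)) R K Θ := by
  set p := C.jetMap θ₀ with hp
  constructor
  · rintro ⟨N, R, K, Θ, hpN, h⟩
    have hR : ∀ r, SmoothNear (R r) (szPart p) := fun r =>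
      (h.smooth_R r).smoothNear (isOpenMap_szPart _ h.isOpen) (Set.mem_image_of_mem _ hpN)
    refine ⟨R, K, fun ℓ q => Θ ℓ ((splitJet n m).symm q), ⟨hR, fun r =>
      (h.smooth_K r).smoothNear (isOpenMap_zPart _ h.isOpen) (Set.mem_image_of_mem _ hpN),
      fun ℓ => ?_, ?_, ?_⟩⟩
    · refine SmoothNear.comp ?_ ((splitJet n m).symm.contDiff.smoothNear _)
      rw [ContinuousLinearEquiv.symm_apply_apply]
      exact (h.smooth_Θ ℓ).smoothNear h.isOpen hpN
    · have h1 := h.wronskian_ne_zero p hpN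
      have h2 : (Matrix.of fun j r : Fin σ => (dirDeriv ((1 : ℝ), (0 : Jet n m)))^[(j : ℕ)] (R r)
          (szPart p)) = Matrix.of fun j r : Fin σ =>
            iteratedDeriv (j : ℕ) (fun s => R r (s, zPart p)) (p.1 0) := by
        ext j r
        exact (iteratedDeriv_eventuallyEq (hR r) j).self_of_nhds.symm
      rw [← h2] at h1
      exact h1
    · have hN : ∀ᶠ q in 𝓝 (splitJet n m p), (splitJet n m).symm q ∈ N := by
        refine (splitJet n m).symm.continuous.continuousAt.eventually ?_
        rw [ContinuousLinearEquiv.symm_apply_apply]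
        exact h.isOpen.mem_nhds hpN
      filter_upwards [hN] with q hq
      rw [h.eq _ hq]
      have h2 := (splitJet n m).apply_symm_apply q
      rw [splitJet_apply] at h2
      rw [szPart, show zPart ((splitJet n m).symm q) = q.2.1 from congrArg (fun w => w.2.1) h2,
        show ((splitJet n m).symm q).1 0 = q.1 from congrArg (fun w => w.1) h2]
      congr 1
      refine Finset.sum_congr rfl fun ℓ _ => ?_
      rw [show sDeriv ℓ ((splitJet n m).symm q) = q.2.2 ℓ from congrArg (fun w => w.2.2 ℓ) h2]
  · rintro ⟨R, K, Θ, h⟩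
    have hR : ∀ r, SmoothNear (R r) (szPart p) := h.smooth_R
    have hK : ∀ r, SmoothNear (K r) (zPart p) := h.smooth_K
    have hsz : Tendsto szPart (𝓝 p) (𝓝 (szPart p)) := continuous_szPart.tendsto p
    have hz : Tendsto zPart (𝓝 p) (𝓝 (zPart p)) := continuous_zPart.tendsto p
    have hsp : Tendsto (splitJet n m) (𝓝 p) (𝓝 (splitJet n m p)) :=
      (splitJet n m).continuous.tendsto p
    -- The germ controls the Wronskian at one point only; continuity extends its non-vanishing to a
    -- neighbourhood.
    have hdet : ∀ᶠ q in 𝓝 (szPart p), (Matrix.of fun j r : Fin σ =>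
        (dirDeriv ((1 : ℝ), (0 : Jet n m)))^[(j : ℕ)] (R r) q).det ≠ 0 := by
      have : SmoothNear (fun q => (Matrix.of fun j r : Fin σ =>
          (dirDeriv ((1 : ℝ), (0 : Jet n m)))^[(j : ℕ)] (R r) q).det) (szPart p) :=
        smoothNear_det fun j r => (hR r).dirDeriv_iterate _ _
      exact this.contDiffAt.continuousAt.eventually_ne h.det_ne_zero
    have hW : ∀ᶠ q in 𝓝 (szPart p), (Matrix.of fun j r : Fin σ =>
        iteratedDeriv (j : ℕ) (fun s => R r (s, q.2)) q.1).det ≠ 0 := by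
      filter_upwards [hdet, eventually_all.2 fun r => eventually_all.2 fun j : Fin σ =>
        iteratedDeriv_eventuallyEq (hR r) j] with q h1 h2
      simpa only [h2] using h1
    have hpD : C.jetDomain D ∈ 𝓝 p := by
      refine (C.isOpen_jetDomain hD).mem_nhds ⟨C.jetMap_mem hθ, ?_⟩
      rwa [hp, C.jetMapInv_jetMap hθ]
    have hall := (((show ∀ᶠ θ in 𝓝 p, θ ∈ C.jetDomain D from hpD).and
      (hsz.eventually (eventually_all.2 hR))).and (hz.eventually (eventually_all.2 hK))).and
      (((hsp.eventually (eventually_all.2 h.smooth_Θ)).and (hsz.eventually hW)).and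
        (hsp.eventually h.eq))
    obtain ⟨N, hNs, hN, hpN⟩ := mem_nhds_iff.1 hall
    refine ⟨N, R, K, fun ℓ θ => Θ ℓ (splitJet n m θ), hpN, hN, fun θ hθ => (hNs hθ).1.1.1,
      ?_, ?_, fun ℓ θ hθ => ?_, fun θ hθ => (hNs hθ).2.1.2, fun θ hθ => ?_⟩
    · rintro r _ ⟨θ, hθ, rfl⟩
      exact ((hNs hθ).1.1.2 r).contDiffWithinAt
    · rintro r _ ⟨θ, hθ, rfl⟩
      exact ((hNs hθ).1.2 r).contDiffWithinAt
    · exact (ContDiffAt.comp (g := Θ ℓ) θ ((hNs hθ).2.1.1 ℓ)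
        (splitJet n m).contDiff.contDiffAt).contDiffWithinAt
    · have h1 := (hNs hθ).2.2
      simp only [ContinuousLinearEquiv.symm_apply_apply] at h1
      exact h1

theorem hasWeakForm_iff (hD : IsOpen D) (hΔ : ContDiffOn ℝ ∞ Δ D) (hθD : θ₀ ∈ D)
    (hθ : θ₀ ∈ C.jetSource m) (hσ : 1 ≤ σ) :
    HasWeakForm C D Δ σ θ₀ ↔ X.IsAlgebraicSymmetryNear (X.condSystem Δ σ) θ₀ := by
  have hΔs : SmoothNear Δ θ₀ := hΔ.smoothNear hD hθD
  rw [C.isAlgebraicSymmetryNear_iff_inIdeal hθ hΔs hσ, adaptedSystem_inIdeal_iff,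
    hasWeakForm_iff_exists_isProdForm hD hθD hθ]
  constructor
  · rintro ⟨R, K, Θ, h⟩
    exact h.inIdeal
  · refine exists_isProdForm hσ ?_
    refine SmoothNear.comp (g := fun η => Δ (C.jetMapInv η)) ?_
      ((splitJet n m).symm.contDiff.smoothNear _)
    rw [ContinuousLinearEquiv.symm_apply_apply]
    exact C.smoothNear_comp_jetMapInv hθ hΔs

/-- For σ = 1 the Wronskian is R itself, so the standard case is the weak case of order 1. -/
theorem IsStandardForm.isWeakForm {N : Set (Jet (n + 1) m)} {R : ℝ × Jet n m → ℝ}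
    {K : Jet n m → ℝ} {Θ : SIdx (n + 1) m → Jet (n + 1) m → ℝ}
    (h : IsStandardForm C D Δ N R K Θ) :
    IsWeakForm C D Δ N (fun _ : Fin 1 => R) (fun _ : Fin 1 => K) Θ where
  isOpen := h.isOpen
  subset := h.subset
  smooth_R _ := h.smooth_R
  smooth_K _ := h.smooth_K
  smooth_Θ := h.smooth_Θ
  wronskian_ne_zero θ hθ := by
    rw [Matrix.det_unique]
    simpa [szPart] using h.R_ne_zero θ hθ
  eq θ hθ := by simpa using h.eq θ hθ

theorem IsWeakForm.isStandardForm {N : Set (Jet (n + 1) m)} {R : Fin 1 → ℝ × Jet n m → ℝ}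
    {K : Fin 1 → Jet n m → ℝ} {Θ : SIdx (n + 1) m → Jet (n + 1) m → ℝ}
    (h : IsWeakForm C D Δ N R K Θ) : IsStandardForm C D Δ N (R 0) (K 0) Θ where
  isOpen := h.isOpen
  subset := h.subset
  smooth_R := h.smooth_R 0
  smooth_K := h.smooth_K 0
  smooth_Θ := h.smooth_Θ
  R_ne_zero θ hθ := by
    have h1 := h.wronskian_ne_zero θ hθ
    rw [Matrix.det_unique] at h1
    simpa [szPart] using h1
  eq θ hθ := by simpa using h.eq θ hθ

theorem hasStandardForm_iff_hasWeakForm : HasStandardForm C D Δ θ₀ ↔ HasWeakForm C D Δ 1 θ₀ :=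
  ⟨fun ⟨N, _, _, Θ, hp, h⟩ => ⟨N, _, _, Θ, hp, h.isWeakForm⟩,
    fun ⟨N, _, _, Θ, hp, h⟩ => ⟨N, _, _, Θ, hp, h.isStandardForm⟩⟩

theorem isSymmetryNear_of_hasWeakForm (hD : IsOpen D) (hΔ : ContDiffOn ℝ ∞ Δ D) (hθD : θ₀ ∈ D)
    (hθ : θ₀ ∈ C.jetSource m) (hσ : 1 ≤ σ) (h : HasWeakForm C D Δ σ θ₀) :
    X.IsSymmetryNear (X.condSystem Δ σ) θ₀ :=
  ((hasWeakForm_iff hD hΔ hθD hθ hσ).1 h).isSymmetryNear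

theorem hasWeakForm_of_isSymmetryNear (hD : IsOpen D) (hΔ : ContDiffOn ℝ ∞ Δ D) (hθD : θ₀ ∈ D)
    (hθ : θ₀ ∈ C.jetSource m) (hσ : 1 ≤ σ) (hrank : MaximalRankAt (X.condSystem Δ σ) θ₀)
    (h : X.IsSymmetryNear (X.condSystem Δ σ) θ₀) : HasWeakForm C D Δ σ θ₀ :=
  (hasWeakForm_iff hD hΔ hθD hθ hσ).2 <| h.isAlgebraicSymmetryNear hrank
    (C.smoothNear_condSystem hθ (hΔ.smoothNear hD hθD) σ)
    fun i => C.smoothNear_prolong hθ (C.smoothNear_condSystem hθ (hΔ.smoothNear hD hθD) σ i)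

end WeakForm

/-! ### Existence of adapted variables -/

section Existence

variable {n : ℕ}

/-- The projection that replaces the coordinate `0` by `0`. -/
def dropZero (n : ℕ) : Vec (n + 1) →L[ℝ] Vec (n + 1) :=
  ContinuousLinearMap.id ℝ _ -
    (ContinuousLinearMap.proj (R := ℝ) (φ := fun _ : Fin (n + 1) => ℝ) 0).smulRight
      (Pi.single 0 1)

theorem dropZero_apply (y : Vec (n + 1)) : dropZero n y = y - y 0 • Pi.single 0 1 := rfl

theorem dropZero_add_smul (y : Vec (n + 1)) (t : ℝ) :
    dropZero n (y + t • Pi.single 0 1) = dropZero n y := by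
  rw [dropZero_apply, dropZero_apply]
  ext i
  simp only [Pi.sub_apply, Pi.add_apply, Pi.smul_apply, smul_eq_mul, Pi.single_eq_same]
  ring

theorem hasDerivAt_shift {G : Type*} [NormedAddCommGroup G] [NormedSpace ℝ G] {f : ℝ → G} {f' : G}
    {s : ℝ} (h : HasDerivAt f f' s) : HasDerivAt (fun t => f (s + t)) f' 0 := by
  have h0 : HasDerivAt f f' (s + 0) := by rwa [add_zero]
  exact h0.comp_const_add s 0

theorem hasFDerivAt_of_fst_snd {E F G : Type*} [NormedAddCommGroup E] [NormedSpace ℝ E]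
    [NormedAddCommGroup F] [NormedSpace ℝ F] [NormedAddCommGroup G] [NormedSpace ℝ G]
    {f : E × F → G} {p : E × F} (hf : DifferentiableAt ℝ f p) {A : E →L[ℝ] G} {B : F →L[ℝ] G}
    (hA : HasFDerivAt (fun x => f (x, p.2)) A p.1) (hB : HasFDerivAt (fun y => f (p.1, y)) B p.2) :
    HasFDerivAt f (A.coprod B) p := by
  have h0 : HasFDerivAt f (fderiv ℝ f p) (p.1, p.2) := hf.hasFDerivAt
  have h1 := HasFDerivAt.comp (g := f) (f := fun x => (x, p.2)) p.1 h0
    ((hasFDerivAt_id p.1).prodMk (hasFDerivAt_const p.2 p.1))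
  have h2 := HasFDerivAt.comp (g := f) (f := fun y => (p.1, y)) p.2 h0
    ((hasFDerivAt_const p.1 p.2).prodMk (hasFDerivAt_id p.2))
  have e1 := h1.unique hA
  have e2 := h2.unique hB
  convert hf.hasFDerivAt using 1
  ext x
  · rw [← e1]; simp
  · rw [← e2]; simp

/-- The flow box: β(y) is the flow at time y_0, started on a hyperplane through x₀ transverse to
ξ(x₀). -/
theorem exists_straightening_base {ξ : Vec (n + 1) → Vec (n + 1)} {x₀ : Vec (n + 1)}
    (hξ : SmoothNear ξ x₀) (h0 : ξ x₀ ≠ 0) :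
    ∃ (β : Vec (n + 1) → Vec (n + 1)) (B : Vec (n + 1) ≃L[ℝ] Vec (n + 1)),
      SmoothNear β 0 ∧ β 0 = x₀ ∧ HasFDerivAt β (B : Vec (n + 1) →L[ℝ] Vec (n + 1)) 0 ∧
      ∀ᶠ y in 𝓝 0, HasDerivAt (fun t : ℝ => β (y + t • Pi.single 0 1)) (ξ (β y)) 0 := by
  obtain ⟨Φ, hΦ, hΦ0, hΦ'⟩ := hξ.exists_flow
  -- `B` sends the s-direction to ξ(x₀) and the hyperplane y_0 = 0 to a transverse one; it turns out
  -- to be the derivative of β at 0.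
  obtain ⟨B, hB⟩ := SeparatingDual.exists_continuousLinearEquiv_apply_eq (R := ℝ)
    (x := (Pi.single 0 1 : Vec (n + 1))) (by simp) h0
  set κ : Vec (n + 1) → ℝ × Vec (n + 1) := fun y => (y 0, x₀ + B (dropZero n y)) with hκ
  have hκ0 : κ 0 = (0, x₀) := by simp [hκ]
  have hκs : ContDiff ℝ ∞ κ := by
    refine ContDiff.prodMk (by fun_prop) (contDiff_const.add ?_)
    exact B.contDiff.comp (dropZero n).contDiff
  have hκt : Tendsto κ (𝓝 0) (𝓝 (0, x₀)) := by
    rw [← hκ0]; exact hκs.continuous.tendsto 0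
  have hflow0 : Φ (0, x₀) = x₀ := hΦ0.self_of_nhds
  refine ⟨fun y => Φ (κ y), B, ?_, ?_, ?_, ?_⟩
  · exact SmoothNear.comp (by rwa [hκ0]) (hκs.smoothNear 0)
  · change Φ (κ 0) = x₀
    rw [hκ0, hflow0]
  · have hd : DifferentiableAt ℝ Φ (0, x₀) := hΦ.contDiffAt.differentiableAt (by simp)
    have h1 : HasFDerivAt Φ ((ContinuousLinearMap.toSpanSingleton ℝ (ξ x₀)).coprod
        (ContinuousLinearMap.id ℝ _)) (0, x₀) := by
      refine hasFDerivAt_of_fst_snd hd ?_ ?_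
      · have := hΦ'.self_of_nhds
        rw [hflow0] at this
        exact this.hasFDerivAt
      · exact (hasFDerivAt_id x₀).congr_of_eventuallyEq hΦ0
    have h2 : HasFDerivAt κ ((ContinuousLinearMap.proj (R := ℝ)
        (φ := fun _ : Fin (n + 1) => ℝ) 0).prod
        ((B : Vec (n + 1) →L[ℝ] Vec (n + 1)).comp (dropZero n))) 0 := by
      refine HasFDerivAt.prodMk (ContinuousLinearMap.proj (R := ℝ)
        (φ := fun _ : Fin (n + 1) => ℝ) 0).hasFDerivAt (HasFDerivAt.const_add _ ?_)
      exact ((B : Vec (n + 1) →L[ℝ] Vec (n + 1)).comp (dropZero n)).hasFDerivAt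
    rw [← hκ0] at h1
    refine (h1.comp 0 h2).congr_fderiv ?_
    refine ContinuousLinearMap.ext fun y => ?_
    change y 0 • ξ x₀ + B (dropZero n y) = B y
    rw [dropZero_apply, map_sub, map_smul, hB]
    abel
  · filter_upwards [hκt.eventually hΦ'] with y hy
    have h1 := hasDerivAt_shift hy
    refine h1.congr_of_eventuallyEq (Eventually.of_forall fun t => ?_)
    simp only [hκ, dropZero_add_smul]
    simp

/-- A map of the form `(y, v) ↦ (β(y), Y(y, v))` that straightens `(ξ, φ)`. -/
theorem exists_straightening_total {ξ : Vec (n + 1) → Vec (n + 1)} {x₀ : Vec (n + 1)}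
    {φ : Vec (n + 1) × ℝ → ℝ} {u₀ : ℝ} (hφ : SmoothNear φ (x₀, u₀))
    {β : Vec (n + 1) → Vec (n + 1)} {B : Vec (n + 1) ≃L[ℝ] Vec (n + 1)}
    (hβs : SmoothNear β 0) (hβ0 : β 0 = x₀)
    (hβB : HasFDerivAt β (B : Vec (n + 1) →L[ℝ] Vec (n + 1)) 0)
    (hβ : ∀ᶠ y in 𝓝 0, HasDerivAt (fun t : ℝ => β (y + t • Pi.single 0 1)) (ξ (β y)) 0) :
    ∃ (T : Vec (n + 1) × ℝ → Vec (n + 1) × ℝ)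
      (T' : (Vec (n + 1) × ℝ) ≃L[ℝ] Vec (n + 1) × ℝ),
      SmoothNear T (0, u₀) ∧ T (0, u₀) = (x₀, u₀) ∧
      HasFDerivAt T (T' : Vec (n + 1) × ℝ →L[ℝ] Vec (n + 1) × ℝ) (0, u₀) ∧
      (∀ q, (T q).1 = β q.1) ∧
      ∀ᶠ q in 𝓝 ((0 : Vec (n + 1)), u₀),
        HasDerivAt (fun t : ℝ => T (q.1 + t • Pi.single 0 1, q.2)) (ξ (β q.1), φ (T q)) 0 := by
  -- the parameter is the point with `s = 0`
  set κ : ℝ × Vec (n + 1) × ℝ → Vec (n + 1) × ℝ :=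
    fun w => (w.2.1 + w.1 • Pi.single 0 1, w.2.2) with hκ
  have hκs : ContDiff ℝ ∞ κ := by
    refine ContDiff.prodMk ((by fun_prop : ContDiff ℝ ∞ fun w : ℝ × Vec (n + 1) × ℝ => w.2.1).add
      (ContDiff.smul contDiff_fst contDiff_const)) (by fun_prop)
  have hκ0 : κ (0, 0, u₀) = (0, u₀) := by simp [hκ]
  have hg : SmoothNear (fun w : ℝ × Vec (n + 1) × ℝ => φ (β (κ w).1, (κ w).2)) (0, 0, u₀) := by
    refine SmoothNear.comp (g := fun q : Vec (n + 1) × ℝ => φ (β q.1, q.2)) ?_ (hκs.smoothNear _)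
    rw [hκ0]
    refine SmoothNear.comp (g := φ) ?_ (SmoothNear.prodMk ?_ (ContDiff.smoothNear (by fun_prop) _))
    · simpa only [hβ0] using hφ
    · exact SmoothNear.comp (g := β) (f := fun q : Vec (n + 1) × ℝ => q.1) hβs
        (ContDiff.smoothNear (by fun_prop) _)
  obtain ⟨Y, hYs, hY0, hY⟩ := hg.exists_ode_solution
  -- Y solves ∂_s Y = φ(β, Y) with Y = v at s = 0, and μ separates the time s from the parameter and
  -- the initial value v.
  set μ : Vec (n + 1) × ℝ → ℝ × Vec (n + 1) × ℝ := fun q => (q.1 0, dropZero n q.1, q.2) with hμ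
  have hμs : ContDiff ℝ ∞ μ :=
    ContDiff.prodMk (by fun_prop) (ContDiff.prodMk ((dropZero n).contDiff.comp contDiff_fst)
      contDiff_snd)
  have hμ0 : μ (0, u₀) = (0, 0, u₀) := by simp [hμ]
  have hY00 : Y (0, 0, u₀) = u₀ := hY0.self_of_nhds
  have hYμ : SmoothNear (fun q => Y (μ q)) (0, u₀) :=
    SmoothNear.comp (by rwa [hμ0]) (hμs.smoothNear _)
  have hβ1 : SmoothNear (fun q : Vec (n + 1) × ℝ => β q.1) (0, u₀) :=
    SmoothNear.comp (g := β) (f := fun q : Vec (n + 1) × ℝ => q.1) hβs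
      (ContDiff.smoothNear (by fun_prop) _)
  set c : ℝ := φ (x₀, u₀) with hc
  -- The derivative of Y ∘ μ is v + c y_0; `shearEquiv` subtracts its argument, hence the sign.
  set b : Vec (n + 1) →L[ℝ] ℝ := (-c) • ContinuousLinearMap.proj (R := ℝ)
    (φ := fun _ : Fin (n + 1) => ℝ) 0 with hb
  have hYder : HasFDerivAt (fun q => Y (μ q)) ((-b).coprod (ContinuousLinearMap.id ℝ ℝ))
      (0, u₀) := by
    have hd : DifferentiableAt ℝ Y (0, 0, u₀) := hYs.contDiffAt.differentiableAt (by simp)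
    have h1 : HasFDerivAt Y ((ContinuousLinearMap.toSpanSingleton ℝ c).coprod
        (ContinuousLinearMap.snd ℝ (Vec (n + 1)) ℝ)) (0, 0, u₀) := by
      refine hasFDerivAt_of_fst_snd hd ?_ ?_
      · have h2 := hY.self_of_nhds
        simp only [hY00] at h2
        have h3 : φ (β (κ (0, 0, u₀)).1, (κ (0, 0, u₀)).2) = c := by rw [hκ0, hβ0]
        rw [h3] at h2
        exact h2.hasFDerivAt
      · exact (ContinuousLinearMap.hasFDerivAt _).congr_of_eventuallyEq hY0
    rw [← hμ0] at h1
    have h2 : HasFDerivAt μ ((((ContinuousLinearMap.proj (R := ℝ)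
        (φ := fun _ : Fin (n + 1) => ℝ) 0).comp (ContinuousLinearMap.fst ℝ _ ℝ)).prod
        (((dropZero n).comp (ContinuousLinearMap.fst ℝ _ ℝ)).prod
          (ContinuousLinearMap.snd ℝ _ ℝ)))) (0, u₀) :=
      ContinuousLinearMap.hasFDerivAt (((ContinuousLinearMap.proj (R := ℝ)
        (φ := fun _ : Fin (n + 1) => ℝ) 0).comp (ContinuousLinearMap.fst ℝ _ ℝ)).prod
        (((dropZero n).comp (ContinuousLinearMap.fst ℝ _ ℝ)).prod
          (ContinuousLinearMap.snd ℝ _ ℝ)))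
    refine (HasFDerivAt.comp (g := Y) _ h1 h2).congr_fderiv ?_
    refine ContinuousLinearMap.ext fun q => ?_
    change q.1 0 * c + q.2 = -(-c * q.1 0) + q.2
    ring
  refine ⟨fun q => (β q.1, Y (μ q)), (shearEquiv b).trans (B.prodCongr (ContinuousLinearEquiv.refl ℝ ℝ)),
      hβ1.prodMk hYμ, ?_, ?_, fun q => rfl, ?_⟩
  · change (β 0, Y (μ (0, u₀))) = _
    rw [hβ0, hμ0, hY00]
  · have h1 : HasFDerivAt (fun q : Vec (n + 1) × ℝ => β q.1)
        ((B : Vec (n + 1) →L[ℝ] Vec (n + 1)).comp (ContinuousLinearMap.fst ℝ _ ℝ)) (0, u₀) :=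
      HasFDerivAt.comp (g := β) (f := fun q : Vec (n + 1) × ℝ => q.1) (0, u₀) hβB
        (ContinuousLinearMap.fst ℝ (Vec (n + 1)) ℝ).hasFDerivAt
    refine (h1.prodMk hYder).congr_fderiv ?_
    refine ContinuousLinearMap.ext fun q => ?_
    refine Prod.ext rfl ?_
    change -(-c * q.1 0) + q.2 = q.2 - (-c * q.1 0)
    ring
  · have hμt : Tendsto μ (𝓝 (0, u₀)) (𝓝 (0, 0, u₀)) := by
      rw [← hμ0]; exact hμs.continuous.tendsto _
    have hfst : Tendsto (fun q : Vec (n + 1) × ℝ => q.1) (𝓝 (0, u₀)) (𝓝 0) :=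
      Continuous.tendsto (by fun_prop) _
    filter_upwards [hfst.eventually hβ, hμt.eventually hY] with q h1 h2
    refine h1.prodMk ?_
    have h3 := hasDerivAt_shift h2
    have h4 : (κ ((μ q).1, (μ q).2.1, Y (μ q))) = (q.1, Y (μ q)) := by
      simp [hκ, hμ, dropZero_apply]
    rw [h4] at h3
    refine h3.congr_of_eventuallyEq (Eventually.of_forall fun t => ?_)
    simp only [hμ, dropZero_add_smul]
    simp

/-- The chart consists of the local inverses of β and T. T carries lines in the s-direction to
curves with velocity (ξ, φ), so its inverse straightens the field. -/
theorem exists_adaptedChart (X : ProjectableField (n + 1)) {x₀ : Vec (n + 1)} {u₀ : ℝ}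
    (hdom : (x₀, u₀) ∈ X.dom) (h0 : X.ξ x₀ ≠ 0) :
    ∃ C : AdaptedChart X, (x₀, u₀) ∈ C.total.source := by
  have hξ : SmoothNear X.ξ x₀ := X.smooth_ξ.smoothNear (isOpenMap_fst _ X.isOpen_dom)
    (Set.mem_image_of_mem Prod.fst hdom)
  obtain ⟨β, B, hβs, hβ0, hβB, hβ⟩ := exists_straightening_base hξ h0
  obtain ⟨T, T', hTs, hT0, hTT', hTfst, hT⟩ := exists_straightening_total
    (X.smooth_φ.smoothNear X.isOpen_dom hdom) hβs hβ0 hβB hβ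
  obtain ⟨e, he0, -, heβ, hes, hes'⟩ := hβs.exists_openPartialHomeomorph B hβB univ_mem
  have hU : ∀ᶠ q in 𝓝 ((0 : Vec (n + 1)), u₀), (q.1 ∈ e.source ∧ T q ∈ X.dom) ∧
      HasDerivAt (fun t : ℝ => T (q.1 + t • Pi.single 0 1, q.2)) (X.ξ (β q.1), X.φ (T q)) 0 := by
    have h1 : Tendsto (fun q : Vec (n + 1) × ℝ => q.1) (𝓝 (0, u₀)) (𝓝 0) :=
      Continuous.tendsto (by fun_prop) _
    have h2 : Tendsto T (𝓝 (0, u₀)) (𝓝 (x₀, u₀)) := by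
      rw [← hT0]; exact hTs.contDiffAt.continuousAt
    exact ((h1.eventually (e.open_source.mem_nhds he0)).and
      (h2.eventually (X.isOpen_dom.mem_nhds hdom))).and hT
  obtain ⟨E, hE0, hEU, hET, hEs, hEs'⟩ := hTs.exists_openPartialHomeomorph T' hTT' hU
  have hmem : ∀ q ∈ E.target, E.symm q ∈ E.source ∧ T (E.symm q) = q := fun q hq =>
    ⟨E.map_target hq, by rw [← hET, E.right_inv hq]⟩
  refine ⟨{ base := e.symm
            total := E.symm
            source_subset := fun q hq => ?_
            fst_mem := fun q hq => ?_
            fst_eq := fun q hq => ?_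
            smooth_base := hes'
            smooth_base_symm := hes
            smooth_total := hEs'
            smooth_total_symm := hEs
            straighten := fun q hq => ?_ }, ?_⟩
  · obtain ⟨h1, h2⟩ := hmem q hq
    rw [← h2]
    exact (hEU h1).1.2
  · obtain ⟨h1, h2⟩ := hmem q hq
    rw [← h2, hTfst, ← heβ]
    exact e.map_source (hEU h1).1.1
  · obtain ⟨h1, h2⟩ := hmem q hq
    have h3 : q.1 = e (E.symm q).1 := by rw [heβ, ← hTfst, h2]
    rw [h3, e.left_inv (hEU h1).1.1]
  · obtain ⟨h1, h2⟩ := hmem q hq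
    have h3 := (hEU h1).2
    rw [← hTfst, h2] at h3
    have h4 : HasFDerivAt E.symm (fderiv ℝ E.symm q)
        (T ((E.symm q).1 + (0 : ℝ) • Pi.single 0 1, (E.symm q).2)) := by
      rw [zero_smul, add_zero, Prod.mk.eta, h2]
      exact ((hEs'.contDiffAt (E.open_target.mem_nhds hq)).differentiableAt (by simp)).hasFDerivAt
    have h5 := h4.comp_hasDerivAt (0 : ℝ) h3
    have h6 : HasDerivAt (fun t : ℝ => ((E.symm q).1 + t • (Pi.single 0 1 : Vec (n + 1)),
        (E.symm q).2)) ((Pi.single 0 1 : Vec (n + 1)), (0 : ℝ)) 0 := by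
      refine HasDerivAt.prodMk ?_ (hasDerivAt_const _ _)
      simpa using ((hasDerivAt_id (0 : ℝ)).smul_const (Pi.single 0 1 : Vec (n + 1))).const_add
        (E.symm q).1
    refine h5.unique (h6.congr_of_eventuallyEq ?_)
    have h7 : ContinuousAt (fun t : ℝ => ((E.symm q).1 + t • (Pi.single 0 1 : Vec (n + 1)),
        (E.symm q).2)) 0 := h6.continuousAt
    have h8 : ∀ᶠ t in 𝓝 (0 : ℝ), ((E.symm q).1 + t • (Pi.single 0 1 : Vec (n + 1)),
        (E.symm q).2) ∈ E.source := by
      refine h7.eventually (E.open_source.mem_nhds ?_)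
      simpa using h1
    filter_upwards [h8] with t ht
    change E.symm (T _) = _
    rw [← hET, E.left_inv ht]
  · change (x₀, u₀) ∈ E.target
    rw [← hT0, ← hET]
    exact E.map_source hE0

end Existence

/-! ### Functions of `z` alone -/

section Tail

variable {n m : ℕ}

/-- The projection `(s, z) ↦ z`. -/
def tailL (n : ℕ) : Vec (n + 1) →L[ℝ] Vec n :=
  ContinuousLinearMap.pi fun i => ContinuousLinearMap.proj (R := ℝ)
    (φ := fun _ : Fin (n + 1) => ℝ) i.succ

theorem contDiff_tail : ContDiff ℝ ∞ (Fin.tail : Vec (n + 1) → Vec n) := (tailL n).contDiff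

theorem contDiff_cons : ContDiff ℝ ∞ fun q : ℝ × Vec n => (Fin.cons q.1 q.2 : Vec (n + 1)) := by
  refine contDiff_pi.2 fun i => Fin.cases ?_ (fun i => ?_) i
  · simpa using contDiff_fst
  · simp only [Fin.cons_succ]; fun_prop

theorem dirDeriv_comp_tail {g : Vec n → ℝ} {y : Vec (n + 1)} (hg : DifferentiableAt ℝ g (Fin.tail y))
    (v : Vec (n + 1)) :
    dirDeriv v (fun y => g (Fin.tail y)) y = dirDeriv (Fin.tail v) g (Fin.tail y) := by
  have h1 : HasFDerivAt (fun y : Vec (n + 1) => (Fin.tail y : Vec n)) (tailL n) y :=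
    (tailL n).hasFDerivAt
  have h2 := HasFDerivAt.comp (g := g) y hg.hasFDerivAt h1
  have h3 : fderiv ℝ (fun y : Vec (n + 1) => g (Fin.tail y)) y = _ := h2.fderiv
  rw [dirDeriv, h3]
  rfl

theorem tail_single_succ (i : Fin n) :
    (Fin.tail (Pi.single i.succ 1 : Vec (n + 1)) : Vec n) = Pi.single i 1 := by
  ext j
  simp [Fin.tail, Pi.single_apply]

theorem tail_single_zero : (Fin.tail (Pi.single 0 1 : Vec (n + 1)) : Vec n) = 0 := by
  ext j
  simp [Fin.tail]

theorem ContDiffAt.comp_tail {g : Vec n → ℝ} {y : Vec (n + 1)}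
    (hg : ContDiffAt ℝ ∞ g (Fin.tail y)) : ContDiffAt ℝ ∞ (fun y => g (Fin.tail y)) y :=
  ContDiffAt.comp y hg contDiff_tail.contDiffAt

theorem dirDeriv_zero_comp_tail {g : Vec n → ℝ} {y : Vec (n + 1)}
    (hg : ContDiffAt ℝ ∞ g (Fin.tail y)) :
    dirDeriv (Pi.single 0 1) (fun y => g (Fin.tail y)) =ᶠ[𝓝 y] fun _ => 0 := by
  filter_upwards [contDiff_tail.continuous.continuousAt.eventually
    hg.eventually_differentiableAt] with z hz
  rw [dirDeriv_comp_tail hz, tail_single_zero, dirDeriv, map_zero]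

theorem dirDerivs_comp_tail {g : Vec n → ℝ} {y : Vec (n + 1)}
    (hg : ContDiffAt ℝ ∞ g (Fin.tail y)) (l : List (Fin n)) :
    dirDerivs (dirs (l.map Fin.succ)) (fun y => g (Fin.tail y)) =ᶠ[𝓝 y]
      fun y => dirDerivs (dirs l) g (Fin.tail y) := by
  induction l with
  | nil => exact EventuallyEq.rfl
  | cons i l ih =>
    refine (ih.dirDeriv (Pi.single i.succ 1)).trans ?_
    filter_upwards [contDiff_tail.continuous.continuousAt.eventually
      (hg.dirDerivs (dirs l)).eventually_differentiableAt] with z hz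
    rw [dirDeriv_comp_tail hz, tail_single_succ]
    rfl

theorem idxWord_cons_zero (β : Fin n → ℕ) :
    idxWord (Fin.cons 0 β : Fin (n + 1) → ℕ) = (idxWord β).map Fin.succ := by
  simp [idxWord, List.finRange_succ, List.flatMap_map, List.map_flatMap]

/-- With `sDeriv_jet_comp_tail` this describes the jets of v = w(z): the z-part is the jet of w, the
same for every s, and all v_s^{(ℓ)} vanish. -/
theorem zPart_jet_comp_tail {g : Vec n → ℝ} {y : Vec (n + 1)}
    (hg : ContDiffAt ℝ ∞ g (Fin.tail y)) :
    zPart (jet m (fun y => g (Fin.tail y)) y) = jet m g (Fin.tail y) := by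
  refine Prod.ext rfl (funext fun β => ?_)
  change pderiv (Fin.cons 0 β.1) (fun y => g (Fin.tail y)) y = pderiv β.1 g (Fin.tail y)
  rw [pderiv_eq_dirDerivs, pderiv_eq_dirDerivs, idxWord_cons_zero]
  exact (dirDerivs_comp_tail hg _).self_of_nhds

theorem sDeriv_jet_comp_tail {g : Vec n → ℝ} {y : Vec (n + 1)}
    (hg : ContDiffAt ℝ ∞ g (Fin.tail y)) (ℓ : SIdx (n + 1) m) :
    sDeriv ℓ (jet m (fun y => g (Fin.tail y)) y) = 0 := by
  change pderiv (ℓ.1 + Pi.single 0 1) (fun y => g (Fin.tail y)) y = 0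
  rw [(pderiv_add_single' hg.comp_tail ℓ.1 0).self_of_nhds,
    ((dirDeriv_zero_comp_tail hg).pderiv ℓ.1).self_of_nhds, pderiv_const_zero]

end Tail

/-- Smooth functions with an invertible Wronskian have no vanishing linear combination. -/
theorem eq_zero_of_wronskian {σ : ℕ} {ρ : Fin σ → ℝ → ℝ} {s : ℝ} {k : Fin σ → ℝ}
    (hρ : ∀ r, ContDiffAt ℝ ∞ (ρ r) s)
    (hW : (Matrix.of fun j r : Fin σ => iteratedDeriv (j : ℕ) (ρ r) s).det ≠ 0)
    (h : (fun t => ∑ r, ρ r t * k r) =ᶠ[𝓝 s] fun _ => 0) : k = 0 := by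
  refine Matrix.eq_zero_of_mulVec_eq_zero hW (funext fun j => ?_)
  -- Differentiating the relation j = 0, …, σ - 1 times at `s` gives the Wronskian matrix times `k`
  -- equal to zero.
  have h1 := h.iteratedDeriv_eq (j : ℕ)
  have h2 : iteratedDeriv (j : ℕ) (fun t => ∑ r, ρ r t * k r) s
      = ∑ r, iteratedDeriv (j : ℕ) (ρ r) s * k r := by
    have hr : ∀ r, ContDiffAt ℝ (j : ℕ) (ρ r) s := fun r => (hρ r).of_le (by exact_mod_cast le_top)
    rw [iteratedDeriv_fun_sum fun r _ => (hr r).mul contDiffAt_const]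
    refine Finset.sum_congr rfl fun r _ => ?_
    simp only [mul_comm _ (k r)]
    rw [iteratedDeriv_const_mul _ (hr r)]
  rw [h2] at h1
  simpa [Matrix.mulVec, dotProduct] using h1

/-! ### Reduced equations and invariant functions -/

namespace AdaptedChart

variable {n m : ℕ} {X : ProjectableField (n + 1)} (C : AdaptedChart X)

theorem isOpen_box {I : Set ℝ} {Z : Set (Vec n)} (hI : IsOpen I) (hZ : IsOpen Z) :
    IsOpen (C.box I Z) :=
  C.base.isOpen_inter_preimage ((hI.preimage (continuous_apply 0)).inter
    (hZ.preimage contDiff_tail.continuous))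

/-- For v = w(z) the Θ-terms drop out and Δ = ∑ R_r(s, ·) K_r, where K_r does not depend on s. For
fixed z the sum vanishes for all s in the open set I only if every K_r does, by the Wronskian. -/
theorem _root_.IsWeakForm.isReducedSystem {D : Set (Jet (n + 1) m)} {Δ : Jet (n + 1) m → ℝ}
    {N : Set (Jet (n + 1) m)} {σ : ℕ} {R : Fin σ → ℝ × Jet n m → ℝ} {K : Fin σ → Jet n m → ℝ}
    {Θ : SIdx (n + 1) m → Jet (n + 1) m → ℝ} (h : IsWeakForm C D Δ N R K Θ) :
    C.IsReducedSystem Δ N K := by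
  intro I Z w hI hIne hZ hw hN
  set g : Vec (n + 1) → ℝ := fun y => w (Fin.tail y) with hg
  have hwz : ∀ z ∈ Z, ContDiffAt ℝ ∞ w z := fun z hz => hw.contDiffAt (hZ.mem_nhds hz)
  have hjet : ∀ y : Vec (n + 1), y 0 ∈ I → Fin.tail y ∈ Z → jet m g y ∈ N := by
    intro y h1 h2
    have := hN _ h1 _ h2
    rwa [Fin.cons_self_tail] at this
  have htar : ∀ y : Vec (n + 1), y 0 ∈ I → Fin.tail y ∈ Z → (y, g y) ∈ C.total.target := by
    intro y h1 h2
    have := (h.subset (hjet y h1 h2)).1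
    rwa [jet_val] at this
  have heq : ∀ y : Vec (n + 1), y 0 ∈ I → Fin.tail y ∈ Z →
      Δ (jet m (C.lift w) (C.base.symm y)) =
        ∑ r, R r (y 0, jet m w (Fin.tail y)) * K r (jet m w (Fin.tail y)) := by
    intro y h1 h2
    have h3 := h.eq _ (hjet y h1 h2)
    rw [C.jetMapInv_jet (hwz _ h2).comp_tail (htar y h1 h2)] at h3
    rw [szPart, zPart_jet_comp_tail (hwz _ h2)] at h3
    simp only [sDeriv_jet_comp_tail (hwz _ h2), mul_zero, Finset.sum_const_zero, add_zero,
      hg] at h3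
    exact h3
  refine ⟨fun x hx => ?_, fun x hx => ?_, fun hΔ => ?_, fun hK x hx => ?_⟩
  · exact (C.contDiffAt_pull (hwz _ hx.2.2).comp_tail hx.1
      (htar _ hx.2.1 hx.2.2)).contDiffWithinAt
  · have ht := htar _ hx.2.1 hx.2.2
    have hgc := (hwz _ hx.2.2).comp_tail
    have hs := C.graph_pull_mem hx.1 ht
    have h1 := C.dirDeriv_push (C.contDiffAt_pull hgc hx.1 ht) hs
    rw [((C.push_pull hgc.continuousAt ht).dirDeriv _).self_of_nhds,
      (dirDeriv_zero_comp_tail (hwz _ hx.2.2)).self_of_nhds] at h1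
    -- v = w(z) has v_s = 0, and v_s = v_u · X_Q u with v_u ≠ 0.
    exact (mul_eq_zero.1 h1.symm).resolve_left (C.vcoef_ne_zero hs)
  · suffices hk : ∀ z ∈ Z, (fun r => K r (jet m w z)) = 0 from
      fun r z hz => congrFun (hk z hz) r
    intro z hz
    obtain ⟨s, hs⟩ := hIne
    have hzero : ∀ t ∈ I, ∑ r, R r (t, jet m w z) * K r (jet m w z) = 0 := by
      intro t ht
      have h1 : (Fin.cons t z : Vec (n + 1)) 0 ∈ I := ht
      have h2 : Fin.tail (Fin.cons t z : Vec (n + 1)) ∈ Z := by simpa using hz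
      have h3 := heq _ h1 h2
      have h4 := (C.total_symm_fst (htar _ h1 h2)).1
      rw [hΔ _ ⟨C.base.map_target h4, by rw [C.base.right_inv h4]; exact h1,
        by rw [C.base.right_inv h4]; exact h2⟩] at h3
      simpa using h3.symm
    have hjs := hN s hs z hz
    have htail : Fin.tail (Fin.cons s z : Vec (n + 1)) = z := Fin.tail_cons _ _
    have hzp : zPart (jet m g (Fin.cons s z)) = jet m w z := by
      rw [zPart_jet_comp_tail (by rw [htail]; exact hwz z hz), htail]
    refine eq_zero_of_wronskian (s := s) (ρ := fun r t => R r (t, jet m w z)) (fun r => ?_) ?_ ?_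
    · have h1 : (s, jet m w z) ∈ szPart '' N := ⟨_, hjs, by rw [szPart, hzp]; rfl⟩
      exact ContDiffAt.comp (g := R r) s
        ((h.smooth_R r).contDiffAt ((isOpenMap_szPart _ h.isOpen).mem_nhds h1))
        (contDiffAt_id.prodMk contDiffAt_const)
    · have h1 := h.wronskian_ne_zero _ hjs
      rw [hzp] at h1
      exact h1
    · filter_upwards [hI.mem_nhds hs] with t ht using hzero t ht
  · have h1 := heq _ hx.2.1 hx.2.2
    rw [C.base.left_inv hx.1] at h1
    rw [h1]
    exact Finset.sum_eq_zero fun r _ => by rw [hK r _ hx.2.2, mul_zero]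

/-- X_Q f = 0 gives v_s = 0 by `dirDeriv_push`, and since I is connected, v does not depend on s. -/
theorem invariantsAreLifts : C.InvariantsAreLifts := by
  intro I Z f hI hIc hIne hZ htar hf hsrc hside
  have hbox := C.isOpen_box hI hZ
  have hmem : ∀ s ∈ I, ∀ z ∈ Z, C.base.symm (Fin.cons s z) ∈ C.box I Z := by
    intro s hs z hz
    have h1 := htar s hs z hz
    refine ⟨C.base.map_target h1, ?_, ?_⟩
    · rw [C.base.right_inv h1]; exact hs
    · rw [C.base.right_inv h1, Fin.tail_cons]; exact hz
  have hpush : ∀ s ∈ I, ∀ z ∈ Z, ContDiffAt ℝ ∞ (C.push f) (Fin.cons s z) ∧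
      dirDeriv (Pi.single 0 1) (C.push f) (Fin.cons s z) = 0 := by
    intro s hs z hz
    have hx := hmem s hs z hz
    have hfx := hf.contDiffAt (hbox.mem_nhds hx)
    have h1 := C.contDiffAt_push hfx (hsrc _ hx)
    have h2 := C.dirDeriv_push hfx (hsrc _ hx)
    rw [hside _ hx, mul_zero] at h2
    rw [C.base.right_inv (htar s hs z hz)] at h1 h2
    exact ⟨h1, h2⟩
  obtain ⟨s₁, hs₁⟩ := hIne
  have hconst : ∀ z ∈ Z, ∀ s ∈ I, C.push f (Fin.cons s z) = C.push f (Fin.cons s₁ z) := by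
    intro z hz s hs
    have hd : ∀ t ∈ I, HasDerivAt (fun t => C.push f (Fin.cons t z)) 0 t := by
      intro t ht
      obtain ⟨h1, h2⟩ := hpush t ht z hz
      have h3 : HasDerivAt (fun t : ℝ => (Fin.cons t z : Vec (n + 1))) (Pi.single 0 1) t := by
        refine hasDerivAt_pi.2 fun i => Fin.cases ?_ (fun i => ?_) i
        · simp only [Fin.cons_zero, Pi.single_eq_same]
          exact hasDerivAt_id t
        · simpa using hasDerivAt_const t (z i)
      have h4 := (h1.differentiableAt (by simp)).hasFDerivAt.comp_hasDerivAt t h3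
      rw [← h2]
      exact h4
    exact hI.is_const_of_deriv_eq_zero hIc.isPreconnected
      (fun t ht => (hd t ht).differentiableAt.differentiableWithinAt)
      (fun t ht => (hd t ht).deriv) hs hs₁
  -- w is v on an arbitrary slice s = s₁, on which it is smooth in z.
  refine ⟨fun z => C.push f (Fin.cons s₁ z), fun z hz => ?_, fun x hx => ?_⟩
  · refine ContDiffAt.contDiffWithinAt (ContDiffAt.comp (g := C.push f) z (hpush s₁ hs₁ z hz).1 ?_)
    exact (contDiff_cons.comp (contDiff_const.prodMk contDiff_id)).contDiffAt
  · have h1 : C.push f (Fin.cons s₁ (Fin.tail (C.base x))) = C.push f (C.base x) := by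
      rw [← hconst _ hx.2.2 _ hx.2.1, Fin.cons_self_tail]
    rw [lift, pull, h1]
    exact (C.pull_push_apply (hsrc x hx)).symm

end AdaptedChart

end

theorem proposition1 (n m : ℕ) (hm : 1 ≤ m) (X : ProjectableField (n + 1))
    (D : Set (Jet (n + 1) m)) (hD : IsOpen D) (Δ : Jet (n + 1) m → ℝ) (hΔ : ContDiffOn ℝ ∞ Δ D)
    (θ₀ : Jet (n + 1) m) (hθ₀ : θ₀ ∈ D) (hdom : (θ₀.1, θ₀.val) ∈ X.dom) (hξ : X.ξ θ₀.1 ≠ 0) :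
    -- adapted variables exist near the given point
    (∃ C : AdaptedChart X, (θ₀.1, θ₀.val) ∈ C.total.source) ∧
    -- and, in whatever adapted variables,
    ∀ C : AdaptedChart X, (θ₀.1, θ₀.val) ∈ C.total.source →
      -- standard conditional symmetries
      ((HasStandardForm C D Δ θ₀ ↔ X.IsAlgebraicSymmetryNear (X.condSystem Δ 1) θ₀) ∧
        (HasStandardForm C D Δ θ₀ → X.IsSymmetryNear (X.condSystem Δ 1) θ₀) ∧
        (MaximalRankAt (X.condSystem Δ 1) θ₀ →
          X.IsSymmetryNear (X.condSystem Δ 1) θ₀ → HasStandardForm C D Δ θ₀) ∧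
        (∀ N R K Θ, IsStandardForm C D Δ N R K Θ →
          C.IsReducedSystem Δ N (fun _ : Fin 1 => K))) ∧
      -- weak conditional symmetries of order `σ`
      (∀ σ : ℕ, 1 ≤ σ →
        (HasWeakForm C D Δ σ θ₀ ↔ X.IsAlgebraicSymmetryNear (X.condSystem Δ σ) θ₀) ∧
        (HasWeakForm C D Δ σ θ₀ → X.IsSymmetryNear (X.condSystem Δ σ) θ₀) ∧
        (MaximalRankAt (X.condSystem Δ σ) θ₀ →
          X.IsSymmetryNear (X.condSystem Δ σ) θ₀ → HasWeakForm C D Δ σ θ₀) ∧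
        (∀ (N : Set (Jet (n + 1) m)) (R : Fin σ → ℝ × Jet n m → ℝ) (K : Fin σ → Jet n m → ℝ)
          (Θ : SIdx (n + 1) m → Jet (n + 1) m → ℝ), IsWeakForm C D Δ N R K Θ →
          C.IsReducedSystem Δ N K)) ∧
      -- the invariant functions are the functions of `z`
      C.InvariantsAreLifts := by
  have hchart := exists_adaptedChart X hdom hξ
  refine ⟨hchart, fun C hC => ?_⟩
  have hθ : θ₀ ∈ C.jetSource m := hC
  refine ⟨?_, fun σ hσ => ?_, C.invariantsAreLifts⟩
  · rw [hasStandardForm_iff_hasWeakForm]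
    exact ⟨hasWeakForm_iff hD hΔ hθ₀ hθ le_rfl, isSymmetryNear_of_hasWeakForm hD hΔ hθ₀ hθ le_rfl,
      hasWeakForm_of_isSymmetryNear hD hΔ hθ₀ hθ le_rfl,
      fun N R K Θ h => h.isWeakForm.isReducedSystem⟩
  · exact ⟨hasWeakForm_iff hD hΔ hθ₀ hθ hσ, isSymmetryNear_of_hasWeakForm hD hΔ hθ₀ hθ hσ,
      hasWeakForm_of_isSymmetryNear hD hΔ hθ₀ hθ hσ, fun N R K Θ h => h.isReducedSystem⟩
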